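/- Let $X,Y,Z$ be the Pauli matrices and write $XX=X\otimes X$, $YY=Y\otimes Y$, $ZZ=Z\otimes Z$. For a set $\mathcal S$ of two-qubit terms, an $\mathcal S^+$-Hamiltonian on $n$ qubits of size at most $B$ is an operator $\sum_{\ell=1}^{t} w_\ell\,(K_\ell)_{i_\ell j_\ell}$ with $t\le B$, where each $K_\ell\in\mathcal S$ acts on a pair of distinct qubits $i_\ell\neq j_\ell$ and $0<w_\ell\le B$. Let $H_{\mathrm{target}}$ be a Hamiltonian on a Hilbert space $\mathcal H$ of dimension $N$. A Hamiltonian $H_{\mathrm{sim}}$ on $\mathcal H_{\mathrm{sim}}$ together with an isometry $\mathcal E:\mathcal H\to\mathcal H_{\mathrm{sim}}$ simulates $H_{\mathrm{target}}$ with error $(\eta,\epsilon)$ if there is an isometry $\widetilde{\mathcal E}:\mathcal H\to\mathcal H_{\mathrm{sim}}$ whose image is the span of $N$ lowest-energy eigenvectors of $H_{\mathrm{sim}}$ (the first $N$ vectors of an orthonormal eigenbasis in nondecreasing order of energy), with $\|H_{\mathrm{target}}-\widetilde{\mathcal E}^\dagger H_{\mathrm{sim}}\widetilde{\mathcal E}\|\le\epsilon$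 and $\|\mathcal E-\widetilde{\mathcal E}\|\le\eta$ (operator norms). The local terms $\mathcal S$ simulate the local terms $\mathcal T$ to inverse polynomial error if for all polynomials $p,q$ with natural-number coefficients there is a polynomial $r$ with natural-number coefficients and the following property. For every $n$ and every $\mathcal T^+$-Hamiltonian $H$ on $n$ qubits of size at most $p(n)$, there are $m\le r(n)$, an $\mathcal S^+$-Hamiltonian $H'$ on $m$ qubits of size at most $r(n)$, a real number $c$ with $|c|\le r(n)$, and an isometry $\mathcal E:(\mathbb C^2)^{\otimes n}\to(\mathbb C^2)^{\otimes m}$ such that $(H'+cI,\mathcal E)$ simulates $H$ with error $\left(\frac1{q(n)+1},\frac1{q(n)+1}\right)$. Here $\mathcal E$ is required to encode qubits locally: the $m$ physical qubits are partitioned into $n$ blocks and a set of ancillas, and $\mathcal E$ is the tensor product of maps sending the $i$-th logical qubit into the $i$-th block with a fixed state of the ancillas. **Lemma.** For every real $a>1$, the single local term $aXX-YY-ZZ$ simulates the local terms $\{XX,\,-YY-ZZ\}$ to inverse polynomial error. -/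

import Mathlib

open scoped Kronecker

noncomputable section

namespace QSim

/-- The Hilbert space of `n` qubits; the computational basis is indexed by bit strings. -/
abbrev Qubits (n : ℕ) : Type := EuclideanSpace ℂ (Fin n → Fin 2)

/-- The operator on `n` qubits with a given matrix in the computational basis. -/
def op {n : ℕ} (A : Matrix (Fin n → Fin 2) (Fin n → Fin 2) ℂ) : Qubits n →L[ℂ] Qubits n :=
  Matrix.toEuclideanCLM (𝕜 := ℂ) A

/-- The Pauli matrices. -/
def pauliX : Matrix (Fin 2) (Fin 2) ℂ := !![0, 1; 1, 0]
def pauliY : Matrix (Fin 2) (Fin 2) ℂ := !![0, -Complex.I; Complex.I, 0]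
def pauliZ : Matrix (Fin 2) (Fin 2) ℂ := !![1, 0; 0, -1]

/-- A two-qubit interaction term, as a `4 × 4` matrix. -/
abbrev TwoLocal : Type := Matrix (Fin 2 × Fin 2) (Fin 2 × Fin 2) ℂ

def XX : TwoLocal := pauliX ⊗ₖ pauliX
def YY : TwoLocal := pauliY ⊗ₖ pauliY
def ZZ : TwoLocal := pauliZ ⊗ₖ pauliZ

/-- The two-qubit term `K` applied to the qubits `i` and `j` (used for `i ≠ j`) of an `n`-qubit
system, tensored with the identity on the other qubits. -/
def onPair {n : ℕ} (K : TwoLocal) (i j : Fin n) :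
    Matrix (Fin n → Fin 2) (Fin n → Fin 2) ℂ :=
  Matrix.of fun x y =>
    if ∀ k, k ≠ i → k ≠ j → x k = y k then K (x i, x j) (y i, y j) else 0

/-- `H` is an `𝒮⁺`-Hamiltonian on `n` qubits of size at most `B`: a sum of at most `B` terms, each
of which is an element of `𝒮` acting on a pair of distinct qubits, with a weight in `(0, B]`. -/
def IsPlusHamiltonian (S : Set TwoLocal) (n B : ℕ)
    (H : Matrix (Fin n → Fin 2) (Fin n → Fin 2) ℂ) : Prop :=
  ∃ (t : ℕ) (K : Fin t → TwoLocal) (i j : Fin t → Fin n) (w : Fin t → ℝ),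
    t ≤ B ∧
    (∀ l, K l ∈ S ∧ i l ≠ j l ∧ 0 < w l ∧ w l ≤ (B : ℝ)) ∧
    H = ∑ l, (w l : ℂ) • onPair (K l) (i l) (j l)

/-- `W` is the subspace formed by the `N` lowest energy eigenvectors of `H`: the span of the first
`N` vectors of an orthonormal eigenbasis of `H` listed in nondecreasing order of energy. -/
def IsLowestEnergySubspace {V : Type*} [NormedAddCommGroup V] [InnerProductSpace ℂ V]
    (H : V →L[ℂ] V) (N : ℕ) (W : Submodule ℂ V) : Prop :=
  ∃ (b : OrthonormalBasis (Fin (Module.finrank ℂ V)) ℂ V)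
    (e : Fin (Module.finrank ℂ V) → ℝ),
    Monotone e ∧ (∀ j, H (b j) = (e j : ℂ) • b j) ∧
    W = Submodule.span ℂ (b '' {j | (j : ℕ) < N})

/-- `(Hsim, E)` simulates `Htarget` with error `(η, ε)`. -/
def Simulates {V W : Type*}
    [NormedAddCommGroup V] [InnerProductSpace ℂ V] [CompleteSpace V]
    [NormedAddCommGroup W] [InnerProductSpace ℂ W] [CompleteSpace W]
    (Hsim : W →L[ℂ] W) (E : V →ₗᵢ[ℂ] W) (Htarget : V →L[ℂ] V) (η ε : ℝ) : Prop :=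
  ∃ E' : V →ₗᵢ[ℂ] W,
    IsLowestEnergySubspace Hsim (Module.finrank ℂ V) (LinearMap.range E'.toLinearMap) ∧
    ‖Htarget - (ContinuousLinearMap.adjoint E'.toContinuousLinearMap ∘L Hsim ∘L
      E'.toContinuousLinearMap)‖ ≤ ε ∧
    ‖E.toContinuousLinearMap - E'.toContinuousLinearMap‖ ≤ η

/-- `E` encodes each of the `n` logical qubits separately: the `m` physical qubits are divided into
`n` disjoint blocks and a set of ancillas (`blk k = none`), and `E` is the tensor product of maps
`v i` from the logical qubit `i` to its block with a fixed state `φ` of the ancillas.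
(When `E` is an isometry, every `v i` is a multiple of an isometry.) -/
def IsLocalEncoding {n m : ℕ} (E : Qubits n →ₗᵢ[ℂ] Qubits m) : Prop :=
  ∃ (blk : Fin m → Option (Fin n))
    (φ : ({k : Fin m // blk k = none} → Fin 2) → ℂ)
    (v : (i : Fin n) → Fin 2 → ({k : Fin m // blk k = some i} → Fin 2) → ℂ),
    ∀ (x : Fin n → Fin 2) (y : Fin m → Fin 2),
      E (EuclideanSpace.single x 1) y = φ (fun k => y k) * ∏ i, v i (x i) (fun k => y k)

/-- The local terms `𝒮` simulate the local terms `𝒯` to inverse polynomial error: for all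
polynomials `p` and `q` there is a polynomial `r` such that every `𝒯⁺`-Hamiltonian on `n` qubits of
size at most `p n` is simulated, with error at most `1 / (q n + 1)`, by some `𝒮⁺`-Hamiltonian on at
most `r n` qubits and of size at most `r n`, up to a shift by a polynomially bounded multiple of the
identity. -/
def SimulatesToInversePolyError (S T : Set TwoLocal) : Prop :=
  ∀ p q : Polynomial ℕ, ∃ r : Polynomial ℕ,
    ∀ (n : ℕ) (Htarget : Matrix (Fin n → Fin 2) (Fin n → Fin 2) ℂ),
      IsPlusHamiltonian T n (p.eval n) Htarget →
      ∃ (m : ℕ) (Hsim : Matrix (Fin m → Fin 2) (Fin m → Fin 2) ℂ) (c : ℝ)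
        (E : Qubits n →ₗᵢ[ℂ] Qubits m),
        m ≤ r.eval n ∧
        IsPlusHamiltonian S m (r.eval n) Hsim ∧
        |c| ≤ ((r.eval n : ℕ) : ℝ) ∧
        IsLocalEncoding E ∧
        Simulates (op (Hsim + (c : ℂ) • 1)) E (op Htarget)
          (1 / (((q.eval n : ℕ) : ℝ) + 1)) (1 / (((q.eval n : ℕ) : ℝ) + 1))

end QSim

end

/-! Each logical qubit is stored in the two-dimensional ground space of a four-qubit star: a center
joined to three leaves by `aXX - YY - ZZ`. In the Hadamard-rotated frame this interaction is `aZZ -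
YY - XX`, which conserves Hamming weight, so the star can be diagonalized by hand. With s = √(a²+3),
its ground energy is -(a+2s), its ground vectors have weights one and three, and the excitation
energies are bounded below by 2s - 4, which is positive because a > 1.

Interactions between two stars act on the code in two ways. To first order only the X-component of
each Pauli survives projection, with opposite signs on center and leaf. Leaf-leaf terms therefore
give +XX and leaf-center terms give -XX, so one interaction with positive weights yields XX with
either sign. For the second-order effect, each star is coupled through a weighted sum of its center
and leaf Paulis whose projection to the code vanishes. The term -E†VH₀⁻¹VE then excites both stars
of a pair and returns them, so distinct pairs do not interfere. A pair of stars contributes -(c₀ +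
c₁XX + d(YY+ZZ)) with d > 0, which is the desired -YY-ZZ up to a constant and an XX term; the
first-order terms absorb the latter.

The simulator is D²H₀ + DV + W, with H₀ the stars, V the second-order coupling and W the first-order
correction. `simulates_second_order` bounds the error by O(L⁶/D), where L bounds the norms of V and
W relative to the gap, so a polynomially large D suffices. `exists_starGadget` supplies the star
with its spectral data and d > 0. `enc_mul_pert_mul_resp` computes the second-order term for n
stars, `effective_eq` matches the effective Hamiltonian with the target, and `exists_simulation`
collects the estimates. -/

open scoped Kronecker

noncomputable section

namespace QSim

/-! ### Min-max bound and polar decomposition. -/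

section Perturbation

open ContinuousLinearMap

variable {V W : Type*}
  [NormedAddCommGroup V] [InnerProductSpace ℂ V] [FiniteDimensional ℂ V] [CompleteSpace V]
  [NormedAddCommGroup W] [InnerProductSpace ℂ W] [FiniteDimensional ℂ W] [CompleteSpace W]

/-- A self-adjoint operator has an orthonormal eigenbasis listed in nondecreasing order. -/
theorem exists_sorted_eigenbasis (H : W →L[ℂ] W) (hH : IsSelfAdjoint H) :
    ∃ (b : OrthonormalBasis (Fin (Module.finrank ℂ W)) ℂ W)
      (e : Fin (Module.finrank ℂ W) → ℝ),
      Monotone e ∧ ∀ j, H (b j) = (e j : ℂ) • b j := by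
  have hs : (H : W →ₗ[ℂ] W).IsSymmetric := hH.isSymmetric
  refine ⟨(hs.eigenvectorBasis rfl).reindex Fin.revPerm,
    fun j => hs.eigenvalues rfl (Fin.rev j), ?_, ?_⟩
  · intro i j hij
    exact hs.eigenvalues_antitone rfl (Fin.rev_le_rev.mpr hij)
  · intro j
    rw [OrthonormalBasis.reindex_apply]
    exact hs.apply_eigenvectorBasis rfl (Fin.rev j)

omit [FiniteDimensional ℂ W] in
theorem inner_apply_eq_sum {ι : Type*} [Fintype ι] (H : W →L[ℂ] W) (b : OrthonormalBasis ι ℂ W)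
    (e : ι → ℝ) (he : ∀ j, H (b j) = (e j : ℂ) • b j) (hH : IsSelfAdjoint H) (y : W) :
    (inner ℂ y (H y)).re = ∑ j, e j * ‖inner ℂ (b j) y‖ ^ 2 := by
  rw [← b.sum_inner_mul_inner y (H y), Complex.re_sum]
  refine Finset.sum_congr rfl fun j _ => ?_
  have h1 : inner ℂ (b j) (H y) = (e j : ℂ) * inner ℂ (b j) y := by
    have h2 := hH.isSymmetric (b j) y
    simp only [ContinuousLinearMap.coe_coe] at h2
    rw [← h2, he, inner_smul_left, Complex.conj_ofReal]
  rw [h1, ← inner_conj_symm y (b j)]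
  have h3 := RCLike.conj_mul (K := ℂ) (inner ℂ (b j) y)
  calc _ = ((e j : ℂ) * ((starRingEnd ℂ) (inner ℂ (b j) y) * inner ℂ (b j) y)).re := by ring_nf
    _ = _ := by rw [h3, Complex.re_ofReal_mul]; norm_cast

-- Half of Courant–Fischer: the span of the eigenvectors 0, …, j has dimension j + 1 > dim V, so it
-- contains a nonzero vector killed by T†. On that vector the energy is at most e j and at least Λ.
omit [FiniteDimensional ℂ W] in
theorem sorted_eigenvalue_ge (H : W →L[ℂ] W) (hH : IsSelfAdjoint H)
    (b : OrthonormalBasis (Fin (Module.finrank ℂ W)) ℂ W)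
    (e : Fin (Module.finrank ℂ W) → ℝ) (hmono : Monotone e)
    (he : ∀ j, H (b j) = (e j : ℂ) • b j) (T : V →L[ℂ] W) (Λ : ℝ)
    (hΛ : ∀ y, adjoint T y = 0 → Λ * ‖y‖ ^ 2 ≤ (inner ℂ y (H y)).re)
    (j : Fin (Module.finrank ℂ W)) (hj : Module.finrank ℂ V ≤ j) : Λ ≤ e j := by
  let φ : (Finset.Iic j → ℂ) →ₗ[ℂ] V :=
    (adjoint T : W →ₗ[ℂ] V) ∘ₗ (Fintype.linearCombination ℂ (fun k : Finset.Iic j => b k))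
  have hdim : Module.finrank ℂ V < Module.finrank ℂ (Finset.Iic j → ℂ) := by
    rw [Module.finrank_fintype_fun_eq_card, Fintype.card_coe, Fin.card_Iic]
    omega
  obtain ⟨c, hc, hc0⟩ := (Submodule.ne_bot_iff _).mp (LinearMap.ker_ne_bot_of_finrank_lt hdim (f := φ))
  set y : W := Fintype.linearCombination ℂ (fun k : Finset.Iic j => b k) c with hy
  have hTy : adjoint T y = 0 := hc
  have hon : Orthonormal ℂ (fun k : Finset.Iic j => b k) :=
    b.orthonormal.comp _ Subtype.val_injective
  have hy0 : y ≠ 0 := by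
    intro h0
    apply hc0
    have := Fintype.linearIndependent_iff.mp hon.linearIndependent c
      (by rw [← Fintype.linearCombination_apply]; exact h0)
    exact funext this
  have hin : ∀ k, j < k → inner ℂ (b k) y = 0 := by
    intro k hk
    rw [hy, Fintype.linearCombination_apply, inner_sum]
    refine Finset.sum_eq_zero fun i _ => ?_
    rw [inner_smul_right, b.inner_eq_ite, if_neg, mul_zero]
    rintro rfl
    exact absurd (Finset.mem_Iic.mp i.2) (not_le.mpr hk)
  have h1 := hΛ y hTy
  rw [inner_apply_eq_sum H b e he hH] at h1
  have h2 : ∑ k, e k * ‖inner ℂ (b k) y‖ ^ 2 ≤ e j * ‖y‖ ^ 2 := by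
    rw [← b.sum_sq_norm_inner_right y, Finset.mul_sum]
    refine Finset.sum_le_sum fun k _ => ?_
    rcases le_or_gt k j with h | h
    · exact mul_le_mul_of_nonneg_right (hmono h) (by positivity)
    · simp [hin k h]
  have h3 : 0 < ‖y‖ ^ 2 := by positivity
  exact le_of_mul_le_mul_right (h1.trans h2) h3

omit [FiniteDimensional ℂ W] in
/-- Polar decomposition of an almost isometric operator. -/
theorem exists_polar (T : V →L[ℂ] W) (δ : ℝ) (hδ : δ ≤ 1 / 2)
    (hT : ‖adjoint T ∘L T - 1‖ ≤ δ) :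
    ∃ (U : V →ₗᵢ[ℂ] W) (S R : V →L[ℂ] V), T = U.toContinuousLinearMap ∘L S ∧
      U.toContinuousLinearMap = T ∘L R ∧ S ∘L R = 1 ∧ ‖S - 1‖ ≤ δ ∧ ‖R‖ ≤ 2 := by
  have hδ0 : 0 ≤ δ := (norm_nonneg _).trans hT
  set G : V →L[ℂ] V := adjoint T ∘L T with hG
  have hGpos : 0 ≤ G := by
    rw [ContinuousLinearMap.nonneg_iff_isPositive]
    exact isPositive_adjoint_comp_self T
  set S := CFC.sqrt G with hS
  have hSS : S * S = G := CFC.sqrt_mul_sqrt_self G hGpos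
  have hSpos : S.IsPositive := (ContinuousLinearMap.nonneg_iff_isPositive _).mp (CFC.sqrt_nonneg G)
  -- From (S+1)(S-1) = G - 1, and since S ≥ 0 makes S + 1 norm-nondecreasing, S is at least as close
  -- to 1 as G is.
  have hSn : ‖S - 1‖ ≤ δ := by
    refine opNorm_le_bound _ hδ0 fun x => ?_
    set y := (S - 1) x with hy
    have h1 : (S + 1) y = (G - 1) x := by
      have : (S + 1) * (S - 1) = G - 1 := by rw [← hSS]; noncomm_ring
      rw [← this]; rfl
    have h2 : ‖y‖ ^ 2 ≤ ‖(S + 1) y‖ ^ 2 := by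
      have h4 : (S + 1) y = S y + y := rfl
      have h3 : 0 ≤ (inner ℂ (S y) y).re := hSpos.re_inner_nonneg_left y
      rw [h4, @norm_add_sq ℂ]
      have h5 : 0 ≤ ‖S y‖ ^ 2 := by positivity
      simp only [RCLike.re_to_complex]
      linarith
    have h3 : ‖y‖ ≤ ‖(S + 1) y‖ := by
      exact le_of_sq_le_sq h2 (norm_nonneg _)
    rw [h1] at h3
    exact h3.trans (le_of_opNorm_le _ hT x)
  have hlow : ∀ x, ‖x‖ ≤ 2 * ‖S x‖ := by
    intro x
    have h1 : ‖(S - 1) x‖ ≤ δ * ‖x‖ := le_of_opNorm_le _ hSn x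
    have h2 : x = S x - (S - 1) x := by simp
    have h3 : ‖x‖ ≤ ‖S x‖ + ‖(S - 1) x‖ := by
      conv_lhs => rw [h2]
      exact norm_sub_le _ _
    nlinarith [norm_nonneg x]
  have hinj : Function.Injective (S : V →ₗ[ℂ] V) := by
    rw [← LinearMap.ker_eq_bot, LinearMap.ker_eq_bot']
    intro x hx
    have h1 := hlow x
    have hx' : S x = 0 := hx
    rw [hx', norm_zero, mul_zero] at h1
    exact norm_le_zero_iff.mp h1
  let Re := LinearEquiv.ofInjectiveEndo (S : V →ₗ[ℂ] V) hinj
  let R : V →L[ℂ] V := LinearMap.toContinuousLinearMap (Re.symm : V →ₗ[ℂ] V)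
  have hSR : ∀ x, S (R x) = x := fun x => Re.apply_symm_apply x
  have hRS : ∀ x, R (S x) = x := fun x => Re.symm_apply_apply x
  have hTn : ∀ z, ‖T z‖ = ‖S z‖ := by
    intro z
    have h1 : inner ℂ (T z) (T z) = inner ℂ (S z) (S z) := by
      rw [← adjoint_inner_right, ← adjoint_inner_right S, hSpos.isSelfAdjoint.adjoint_eq]
      change inner ℂ z (G z) = inner ℂ z ((S * S) z)
      rw [hSS]
    rw [@norm_eq_sqrt_re_inner ℂ, @norm_eq_sqrt_re_inner ℂ _ _ _ _ (S z), h1]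
  let U : V →ₗᵢ[ℂ] W :=
    { toLinearMap := (T ∘L R : V →L[ℂ] W)
      norm_map' := fun x => by
        change ‖T (R x)‖ = ‖x‖
        rw [hTn, hSR] }
  refine ⟨U, S, R, ?_, rfl, ?_, hSn, ?_⟩
  · ext x
    change T x = T (R (S x))
    rw [hRS]
  · ext x
    exact hSR x
  · refine opNorm_le_bound _ (by norm_num) fun x => ?_
    have := hlow (R x)
    rwa [hSR] at this

end Perturbation

/-! ### From an approximately invariant subspace to the exact low-energy subspace. -/

section LowEnergy

open ContinuousLinearMap

variable {V W : Type*}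
  [NormedAddCommGroup V] [InnerProductSpace ℂ V] [FiniteDimensional ℂ V] [CompleteSpace V]
  [NormedAddCommGroup W] [InnerProductSpace ℂ W] [FiniteDimensional ℂ W] [CompleteSpace W]

/-- If `H T ≈ T K` for an approximate isometry `T` and `H` is large on the orthogonal complement of
the range of `T`, then `H` restricted to its low-energy subspace is approximately `K`. -/
theorem exists_low_energy_isometry (H : W →L[ℂ] W) (hH : IsSelfAdjoint H) (T : V →L[ℂ] W)
    (K : V →L[ℂ] V) (E : V →ₗᵢ[ℂ] W) {Λ h ε δ : ℝ}
    (hΛ : ∀ y, adjoint T y = 0 → Λ * ‖y‖ ^ 2 ≤ (inner ℂ y (H y)).re)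
    (hK : ‖K‖ ≤ h) (hres : ‖H ∘L T - T ∘L K‖ ≤ ε) (hTE : ‖T - E.toContinuousLinearMap‖ ≤ δ)
    (hgap : h + 1 ≤ Λ) (hsmall : 3 * (δ + ε) ≤ 1 / 2) :
    ∃ E' : V →ₗᵢ[ℂ] W,
      IsLowestEnergySubspace H (Module.finrank ℂ V) (LinearMap.range E'.toLinearMap) ∧
      ‖K - (adjoint E'.toContinuousLinearMap ∘L H ∘L E'.toContinuousLinearMap)‖ ≤
        2 * ε + 12 * (δ + ε) * h ∧
      ‖E.toContinuousLinearMap - E'.toContinuousLinearMap‖ ≤ 4 * (δ + ε) := by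
  obtain ⟨b, e, hmono, he⟩ := exists_sorted_eigenbasis H hH
  have hhigh := sorted_eigenvalue_ge H hH b e hmono he T Λ hΛ
  have hε : 0 ≤ ε := (norm_nonneg _).trans hres
  have hδ : 0 ≤ δ := (norm_nonneg _).trans hTE
  have hh : 0 ≤ h := (norm_nonneg _).trans hK
  set N := Module.finrank ℂ V with hN
  set L : Submodule ℂ W := Submodule.span ℂ (b '' {j | (j : ℕ) < N}) with hL
  have hNW : N ≤ Module.finrank ℂ W := LinearMap.finrank_le_finrank_of_injective E.injective
  set P : W →L[ℂ] W := L.starProjection with hP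
  have hPle : ‖P‖ ≤ 1 := Submodule.starProjection_norm_le L
  have hPmem : ∀ y, P y ∈ L := fun y => Submodule.starProjection_apply_mem L y
  have hPlow : ∀ j : Fin (Module.finrank ℂ W), (j : ℕ) < N → P (b j) = b j := fun j hj =>
    Submodule.starProjection_eq_self_iff.mpr (Submodule.subset_span ⟨j, hj, rfl⟩)
  have hPhigh : ∀ j : Fin (Module.finrank ℂ W), N ≤ (j : ℕ) → P (b j) = 0 := by
    intro j hj
    rw [hP, Submodule.starProjection_apply_eq_zero_iff, Submodule.mem_orthogonal]
    intro u hu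
    induction hu using Submodule.span_induction with
    | mem x hx =>
      obtain ⟨i, hi, rfl⟩ := hx
      rw [b.inner_eq_ite, if_neg]
      rintro rfl
      exact absurd hi (not_lt.mpr hj)
    | zero => simp
    | add x y _ _ hx hy => rw [inner_add_left, hx, hy, add_zero]
    | smul a x _ hx => rw [inner_smul_left, hx, mul_zero]
  have hcomm : H ∘L P = P ∘L H := by
    have : (H ∘L P : W →L[ℂ] W).toLinearMap = (P ∘L H : W →L[ℂ] W).toLinearMap := by
      refine b.toBasis.ext fun j => ?_
      simp only [OrthonormalBasis.coe_toBasis, ContinuousLinearMap.coe_coe, coe_comp,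
        Function.comp_apply, he, map_smul]
      rcases lt_or_ge (j : ℕ) N with hj | hj
      · rw [hPlow j hj, he]
      · rw [hPhigh j hj, map_zero, smul_zero]
    exact ContinuousLinearMap.coe_injective this
  have hHbig : ∀ y, P y = 0 → Λ * ‖y‖ ≤ ‖H y‖ := by
    intro y hy
    have h1 : Λ * ‖y‖ ^ 2 ≤ (inner ℂ y (H y)).re := by
      rw [inner_apply_eq_sum H b e he hH, ← b.sum_sq_norm_inner_right y, Finset.mul_sum]
      refine Finset.sum_le_sum fun j _ => ?_
      rcases lt_or_ge (j : ℕ) N with hj | hj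
      · have : inner ℂ (b j) y = 0 := by
          rw [← hPlow j hj, hP, Submodule.inner_starProjection_left_eq_right, ← hP, hy,
            inner_zero_right]
        simp [this]
      · exact mul_le_mul_of_nonneg_right (hhigh j hj) (by positivity)
    have h2 : (inner ℂ y (H y)).re ≤ ‖y‖ * ‖H y‖ :=
      (Complex.re_le_norm _).trans (norm_inner_le_norm y (H y))
    rcases eq_or_ne y 0 with rfl | hy0
    · simp
    · have h3 : 0 < ‖y‖ := norm_pos_iff.mpr hy0
      nlinarith
  set Y : V →L[ℂ] W := T - P ∘L T with hY
  -- Sylvester-type estimate. The high-energy part Y of T satisfies HY = YK + (1-P)(HT - TK). Since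
  -- H is at least Λ there, Λ‖Y‖ ≤ h‖Y‖ + ε, and Λ - h ≥ 1.
  have hYn : ‖Y‖ ≤ ε := by
    have hPP : ∀ y, P (P y) = P y := fun y =>
      Submodule.starProjection_eq_self_iff.mpr (hPmem y)
    have h1 : ∀ x, Λ * ‖Y x‖ ≤ ‖Y‖ * (h * ‖x‖) + ε * ‖x‖ := by
      intro x
      have h2 := hHbig (Y x) (by simp [hY, hPP])
      have h3 : H (Y x) = Y (K x) +
          ((H ∘L T - T ∘L K) x - P ((H ∘L T - T ∘L K) x)) := by
        have h4 : H (P (T x)) = P (H (T x)) := DFunLike.congr_fun hcomm (T x)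
        simp only [hY, sub_apply, coe_comp, Function.comp_apply, map_sub, h4]
        abel
      have h5 : ‖(H ∘L T - T ∘L K) x - P ((H ∘L T - T ∘L K) x)‖ ≤ ε * ‖x‖ := by
        set z := (H ∘L T - T ∘L K) x with hz
        have h6 : ‖z - P z‖ ≤ ‖z‖ := by
          have h7 : z - P z = Lᗮ.starProjection z := by
            rw [Submodule.starProjection_orthogonal_val]
          rw [h7]
          exact Submodule.norm_starProjection_apply_le _ z
        exact h6.trans (le_of_opNorm_le _ hres x)
      have h8 : ‖Y (K x)‖ ≤ ‖Y‖ * (h * ‖x‖) :=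
        (le_opNorm _ _).trans (mul_le_mul_of_nonneg_left (le_of_opNorm_le _ hK x) (norm_nonneg _))
      calc Λ * ‖Y x‖ ≤ ‖H (Y x)‖ := h2
        _ ≤ _ := by rw [h3]; exact (norm_add_le _ _).trans (add_le_add h8 h5)
    have hΛ0 : 0 < Λ := by linarith
    have h2 : ‖Y‖ ≤ (‖Y‖ * h + ε) / Λ := by
      refine opNorm_le_bound _ (by positivity) fun x => ?_
      rw [div_mul_eq_mul_div, le_div_iff₀ hΛ0]
      nlinarith [h1 x]
    rw [le_div_iff₀ hΛ0] at h2
    nlinarith [norm_nonneg Y]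
  set Ec := E.toContinuousLinearMap with hEc
  have hEn : ‖Ec‖ ≤ 1 := E.norm_toContinuousLinearMap_le
  have hEE : adjoint Ec ∘L Ec = 1 := by
    rw [← ContinuousLinearMap.norm_map_iff_adjoint_comp_self]
    exact fun x => E.norm_map x
  set T' : V →L[ℂ] W := P ∘L T with hT'
  set ρ := δ + ε with hρ
  have hT'E : ‖T' - Ec‖ ≤ ρ := by
    have : T' - Ec = (T - Ec) - Y := by rw [hY]; abel
    rw [this]
    exact (norm_sub_le _ _).trans (add_le_add hTE hYn)
  -- Expanding T' around the isometry E gives ρ² + 2ρ, and ρ ≤ 1.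
  have hgram : ‖adjoint T' ∘L T' - 1‖ ≤ 3 * ρ := by
    have h1 : adjoint T' ∘L T' - 1 = adjoint (T' - Ec) ∘L (T' - Ec) + adjoint (T' - Ec) ∘L Ec
        + adjoint Ec ∘L (T' - Ec) := by
      rw [← hEE]
      simp only [map_sub, sub_comp, comp_sub]
      abel
    rw [h1]
    have h2 : ‖adjoint (T' - Ec)‖ ≤ ρ := by rwa [LinearIsometryEquiv.norm_map]
    have h3 : ‖adjoint Ec‖ ≤ 1 := by rwa [LinearIsometryEquiv.norm_map]
    have h4 : ‖adjoint (T' - Ec) ∘L (T' - Ec)‖ ≤ ρ * ρ :=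
      (opNorm_comp_le _ _).trans (mul_le_mul h2 hT'E (norm_nonneg _) (by positivity))
    have h5 : ‖adjoint (T' - Ec) ∘L Ec‖ ≤ ρ * 1 :=
      (opNorm_comp_le _ _).trans (mul_le_mul h2 hEn (norm_nonneg _) (by positivity))
    have h6 : ‖adjoint Ec ∘L (T' - Ec)‖ ≤ 1 * ρ :=
      (opNorm_comp_le _ _).trans (mul_le_mul h3 hT'E (norm_nonneg _) (by positivity))
    have h7 : ρ ≤ 1 := by linarith
    have h8 : 0 ≤ ρ := by positivity
    calc _ ≤ ρ * ρ + ρ * 1 + 1 * ρ :=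
          (norm_add_le _ _).trans (add_le_add ((norm_add_le _ _).trans (add_le_add h4 h5)) h6)
      _ ≤ 3 * ρ := by nlinarith
  obtain ⟨U, S, R, hTUS, hUTR, hSR, hSn, hRn⟩ := exists_polar T' (3 * ρ) hsmall hgram
  set Uc := U.toContinuousLinearMap with hUc
  have hUn : ‖Uc‖ ≤ 1 := U.norm_toContinuousLinearMap_le
  have hUU : adjoint Uc ∘L Uc = 1 := by
    rw [← ContinuousLinearMap.norm_map_iff_adjoint_comp_self]
    exact fun x => U.norm_map x
  refine ⟨U, ⟨b, e, hmono, he, ?_⟩, ?_, ?_⟩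
  · apply Submodule.eq_of_le_of_finrank_eq
    · rintro _ ⟨x, rfl⟩
      have : U x = P (T (R x)) := DFunLike.congr_fun hUTR x
      change U x ∈ L
      rw [this]
      exact hPmem _
    · rw [LinearMap.finrank_range_of_inj U.injective, ← hN]
      have h1 : (b '' {j | (j : ℕ) < N}) =
          Set.range (fun i : Fin N => b (Fin.castLE hNW i)) := by
        ext x
        constructor
        · rintro ⟨j, hj, rfl⟩
          exact ⟨⟨j, hj⟩, rfl⟩
        · rintro ⟨i, rfl⟩
          exact ⟨Fin.castLE hNW i, i.2, rfl⟩
      rw [h1, finrank_span_eq_card, Fintype.card_fin]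
      exact (b.orthonormal.comp _ (Fin.castLE_injective hNW)).linearIndependent
  · set D : V →L[ℂ] W := P ∘L (H ∘L T - T ∘L K) with hD
    have hDn : ‖D‖ ≤ ε := by
      have := (opNorm_comp_le P (H ∘L T - T ∘L K)).trans
        (mul_le_mul hPle hres (norm_nonneg _) zero_le_one)
      linarith
    have hHT : H ∘L T' = T' ∘L K + D := by
      rw [hD, comp_sub, hT', ← comp_assoc, hcomm, comp_assoc, comp_assoc]
      abel
    have hUT : adjoint Uc ∘L T' = S := by
      rw [hTUS, ← comp_assoc, hUU]; rfl
    -- Since SR = 1, K - SKR is the commutator of K with S - 1, times R; it is small because S is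
    -- close to 1.
    have h1 : K - (adjoint Uc ∘L H ∘L Uc) =
        (K ∘L (S - 1) - (S - 1) ∘L K) ∘L R - adjoint Uc ∘L D ∘L R := by
      have h2 : H ∘L Uc = (T' ∘L K + D) ∘L R := by
        rw [← hHT, comp_assoc, ← hUTR]
      have h3 : adjoint Uc ∘L H ∘L Uc = (S ∘L K + adjoint Uc ∘L D) ∘L R := by
        rw [h2, ← comp_assoc, comp_add, ← comp_assoc, hUT]
      have h4 : K ∘L (S ∘L R) = K := by rw [hSR]; rfl
      have h5 : K ∘L (1 : V →L[ℂ] V) = K := rfl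
      have h6 : (1 : V →L[ℂ] V) ∘L K = K := rfl
      rw [h3, sub_comp, comp_sub, sub_comp S, h5, h6, sub_comp, sub_comp, comp_assoc K, h4,
        add_comp, comp_assoc (adjoint Uc)]
      abel
    rw [h1]
    have hρ0 : 0 ≤ ρ := by positivity
    have h2 : ‖K ∘L (S - 1)‖ ≤ h * (3 * ρ) :=
      (opNorm_comp_le _ _).trans (mul_le_mul hK hSn (norm_nonneg _) hh)
    have h3 : ‖(S - 1) ∘L K‖ ≤ (3 * ρ) * h :=
      (opNorm_comp_le _ _).trans (mul_le_mul hSn hK (norm_nonneg _) (by positivity))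
    have h4 : ‖(K ∘L (S - 1) - (S - 1) ∘L K) ∘L R‖ ≤ (h * (3 * ρ) + (3 * ρ) * h) * 2 :=
      (opNorm_comp_le _ _).trans
        (mul_le_mul ((norm_sub_le _ _).trans (add_le_add h2 h3)) hRn (norm_nonneg _)
          (by positivity))
    have h5 : ‖adjoint Uc‖ ≤ 1 := by rwa [LinearIsometryEquiv.norm_map]
    have h6 : ‖D ∘L R‖ ≤ ε * 2 :=
      (opNorm_comp_le _ _).trans (mul_le_mul hDn hRn (norm_nonneg _) hε)
    have h7 : ‖adjoint Uc ∘L D ∘L R‖ ≤ 1 * (ε * 2) :=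
      (opNorm_comp_le _ _).trans (mul_le_mul h5 h6 (norm_nonneg _) zero_le_one)
    calc _ ≤ (h * (3 * ρ) + (3 * ρ) * h) * 2 + 1 * (ε * 2) :=
          (norm_sub_le _ _).trans (add_le_add h4 h7)
      _ = _ := by ring
  · have h1 : Ec - Uc = Uc ∘L (S - 1) - (T' - Ec) := by
      rw [comp_sub, ← hTUS]
      have : Uc ∘L (1 : V →L[ℂ] V) = Uc := rfl
      rw [this]
      abel
    rw [h1]
    have h2 : ‖Uc ∘L (S - 1)‖ ≤ 1 * (3 * ρ) :=
      (opNorm_comp_le _ _).trans (mul_le_mul hUn hSn (norm_nonneg _) zero_le_one)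
    calc _ ≤ 1 * (3 * ρ) + ρ := (norm_sub_le _ _).trans (add_le_add h2 hT'E)
      _ = _ := by ring

end LowEnergy

/-! ### Second-order perturbation theory with explicit error. -/

section SecondOrder

open ContinuousLinearMap

variable {V W : Type*}
  [NormedAddCommGroup V] [InnerProductSpace ℂ V] [FiniteDimensional ℂ V] [CompleteSpace V]
  [NormedAddCommGroup W] [InnerProductSpace ℂ W] [FiniteDimensional ℂ W] [CompleteSpace W]

-- The range of F is orthogonal to the code, where H₀ ≥ g; Cauchy–Schwarz turns this quadratic bound
-- into a bound on the pseudo-inverse of H₀.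
omit [FiniteDimensional ℂ V] [FiniteDimensional ℂ W] in
theorem norm_le_of_gap (H₀ : W →L[ℂ] W) (E : V →L[ℂ] W) {g m : ℝ} (hg : 0 < g)
    (hgap : ∀ x, g * (‖x‖ ^ 2 - ‖adjoint E x‖ ^ 2) ≤ (inner ℂ x (H₀ x)).re)
    (F : V →L[ℂ] W) (hF : adjoint E ∘L F = 0) (hm : ‖H₀ ∘L F‖ ≤ m) : ‖F‖ ≤ m / g := by
  have hm0 : 0 ≤ m := (norm_nonneg _).trans hm
  refine opNorm_le_bound _ (by positivity) fun x => ?_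
  rw [div_mul_eq_mul_div, le_div_iff₀ hg]
  have h1 := hgap (F x)
  have h0 : adjoint E (F x) = 0 := DFunLike.congr_fun hF x
  rw [h0, norm_zero] at h1
  have h2 : (inner ℂ (F x) (H₀ (F x))).re ≤ ‖F x‖ * ‖H₀ (F x)‖ :=
    (Complex.re_le_norm _).trans (norm_inner_le_norm _ _)
  have h3 : ‖H₀ (F x)‖ ≤ m * ‖x‖ := le_of_opNorm_le _ hm x
  rcases eq_or_ne (F x) 0 with h | h
  · rw [h, norm_zero, zero_mul]; positivity
  · have h4 : 0 < ‖F x‖ := norm_pos_iff.mpr h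
    nlinarith

-- H₀ + EE† is injective, hence invertible, and E†(H₀ + EE†) = E†. Its inverse therefore preserves
-- orthogonality to the code and inverts H₀ there.
omit [FiniteDimensional ℂ V] in
theorem exists_preimage_of_gap (H₀ : W →L[ℂ] W) (hH : IsSelfAdjoint H₀) (E : V →L[ℂ] W)
    (hEE : adjoint E ∘L E = 1) {g : ℝ} (hg : 0 < g) (hE : H₀ ∘L E = 0)
    (hgap : ∀ x, g * (‖x‖ ^ 2 - ‖adjoint E x‖ ^ 2) ≤ (inner ℂ x (H₀ x)).re)
    (M : V →L[ℂ] W) (hM : adjoint E ∘L M = 0) :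
    ∃ F : V →L[ℂ] W, H₀ ∘L F = M ∧ adjoint E ∘L F = 0 := by
  have hEH : adjoint E ∘L H₀ = 0 := by
    have := congrArg adjoint hE
    rwa [adjoint_comp, hH.adjoint_eq, map_zero] at this
  set A : W →L[ℂ] W := H₀ + E ∘L adjoint E with hA
  have hEA : ∀ x, adjoint E (A x) = adjoint E x := by
    intro x
    have h1 : adjoint E (H₀ x) = 0 := DFunLike.congr_fun hEH x
    have h2 : adjoint E (E (adjoint E x)) = adjoint E x := DFunLike.congr_fun hEE (adjoint E x)
    simp [hA, h1, h2]
  have hinj : Function.Injective (A : W →ₗ[ℂ] W) := by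
    rw [← LinearMap.ker_eq_bot, LinearMap.ker_eq_bot']
    intro x hx
    have hx' : A x = 0 := hx
    have h1 : adjoint E x = 0 := by rw [← hEA, hx', map_zero]
    have h2 : H₀ x = 0 := by simpa [hA, h1] using hx'
    have h3 := hgap x
    rw [h1, h2, inner_zero_right, norm_zero, Complex.zero_re] at h3
    have h4 : ‖x‖ ^ 2 ≤ 0 := by nlinarith
    simpa using h4
  let Ae := LinearEquiv.ofInjectiveEndo (A : W →ₗ[ℂ] W) hinj
  let R : W →L[ℂ] W := LinearMap.toContinuousLinearMap (Ae.symm : W →ₗ[ℂ] W)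
  have hAR : ∀ x, A (R x) = x := fun x => Ae.apply_symm_apply x
  have hE0 : ∀ x, adjoint E (R (M x)) = 0 := by
    intro x
    rw [← hEA, hAR]
    exact DFunLike.congr_fun hM x
  refine ⟨R ∘L M, ?_, ?_⟩
  · ext x
    have h1 := hAR (M x)
    simpa [hA, hE0 x] using h1
  · ext x
    exact hE0 x

/-- Energy balance for a vector with at most half its norm in the code: 3/4 is 1 - (1/2)², and the
subtracted terms bound D‖X‖ and ‖Y‖. The left side leaves a margin 1 over the bound 2L² for the
effective Hamiltonian. -/
theorem perturbation_gap_bound {g L D : ℝ} (hg : 0 < g) (hL : 1 ≤ L) (hgL : 1 ≤ g * L)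
    (hD : 400 * L ^ 6 ≤ D) :
    2 * L ^ 2 + 1 ≤ D ^ 2 * (g * (3 / 4)) - D * (g * L) - g * L := by
  have hL0 : 0 < L := by linarith
  have h1 : L ^ 3 ≤ L ^ 6 := pow_le_pow_right₀ hL (by norm_num)
  have h2 : L ≤ L ^ 6 := le_self_pow₀ hL (by norm_num)
  have h3 : 1 ≤ L ^ 3 := one_le_pow₀ hL
  have hL2 : 1 ≤ L ^ 2 := one_le_pow₀ hL
  have hD0 : 400 ≤ D := by linarith
  have h4 : g * L ≤ g * (D / 400) := mul_le_mul_of_nonneg_left (by linarith) hg.le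
  have h5 : D * (g * L) ≤ D * (g * (D / 400)) := mul_le_mul_of_nonneg_left h4 (by linarith)
  have h6 : 1 * (g * L) ≤ D * (g * L) := mul_le_mul_of_nonneg_right (by linarith) (by linarith)
  have h7 : D * D ≤ g * L * (D * D) := le_mul_of_one_le_left (by positivity) hgL
  have h8 : 400 * L ^ 3 * 400 ≤ D * D :=
    mul_le_mul (by linarith) hD0 (by norm_num) (by linarith)
  have h9 : 160000 * L ^ 2 ≤ g * (D * D) := by
    refine le_of_mul_le_mul_left ?_ hL0
    calc L * (160000 * L ^ 2) = 400 * L ^ 3 * 400 := by ring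
      _ ≤ g * L * (D * D) := h8.trans h7
      _ = L * (g * (D * D)) := by ring
  have h10 : D * (g * (D / 400)) = g * (D * D) / 400 := by ring
  have h11 : D ^ 2 * (g * (3 / 4)) = g * (D * D) * (3 / 4) := by ring
  linarith

omit [FiniteDimensional ℂ W] [CompleteSpace W] in
theorem neg_mul_le_re_inner (X : W →L[ℂ] W) {m : ℝ} (hX : ‖X‖ ≤ m) (y : W) :
    -(m * ‖y‖ ^ 2) ≤ (inner ℂ y (X y)).re := by
  have h : |(inner ℂ y (X y)).re| ≤ ‖y‖ * (m * ‖y‖) :=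
    (Complex.abs_re_le_norm _).trans ((norm_inner_le_norm _ _).trans
      (mul_le_mul_of_nonneg_left (le_of_opNorm_le _ hX y) (norm_nonneg _)))
  have h2 : ‖y‖ * (m * ‖y‖) = m * ‖y‖ ^ 2 := by ring
  rw [h2] at h
  exact (abs_le.mp h).1

omit [FiniteDimensional ℂ V] [FiniteDimensional ℂ W] in
theorem quadratic_form_ge (H₀ X Y : W →L[ℂ] W) (E : V →L[ℂ] W) {g L D : ℝ} (hg : 0 < g)
    (hL : 1 ≤ L) (hgL : 1 ≤ g * L)
    (hgap : ∀ x, g * (‖x‖ ^ 2 - ‖adjoint E x‖ ^ 2) ≤ (inner ℂ x (H₀ x)).re)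
    (hXn : ‖X‖ ≤ g * L) (hYn : ‖Y‖ ≤ g * L) (hD : 400 * L ^ 6 ≤ D) (y : W)
    (hy : ‖adjoint E y‖ ≤ 1 / 2 * ‖y‖) :
    (2 * L ^ 2 + 1) * ‖y‖ ^ 2 ≤
      (inner ℂ y ((((D : ℂ) ^ 2) • H₀ + (D : ℂ) • X + Y) y)).re := by
  have hD0 : 0 ≤ D := le_trans (by positivity) hD
  have hXl := neg_mul_le_re_inner X hXn y
  have hYl := neg_mul_le_re_inner Y hYn y
  have h4 : (inner ℂ y ((((D : ℂ) ^ 2) • H₀ + (D : ℂ) • X + Y) y)).re =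
      D ^ 2 * (inner ℂ y (H₀ y)).re + D * (inner ℂ y (X y)).re + (inner ℂ y (Y y)).re := by
    simp only [add_apply, smul_apply, inner_add_right, inner_smul_right, Complex.add_re]
    rw [← Complex.ofReal_pow, Complex.re_ofReal_mul, Complex.re_ofReal_mul]
  have h5 : g * (3 / 4 * ‖y‖ ^ 2) ≤ (inner ℂ y (H₀ y)).re := by
    refine le_trans (mul_le_mul_of_nonneg_left ?_ hg.le) (hgap y)
    have h6 := pow_le_pow_left₀ (norm_nonneg _) hy 2
    rw [mul_pow] at h6
    linarith
  have h6 := mul_le_mul_of_nonneg_right (perturbation_gap_bound hg hL hgL hD)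
    (sq_nonneg ‖y‖)
  have h7 := mul_le_mul_of_nonneg_left h5 (sq_nonneg D)
  have h8 := mul_le_mul_of_nonneg_left hXl hD0
  rw [h4]
  linarith

set_option maxHeartbeats 800000 in
/-- Second-order perturbation theory: with `H₀` gapped and `E` an isometry onto its kernel, the
low-energy part of `D² H₀ + D V + W` is `E† W E - E† V H₀⁻¹ V E` up to an error of order `1/D`. -/
theorem simulates_second_order (H₀ X Y : W →L[ℂ] W) (hH : IsSelfAdjoint H₀)
    (hX : IsSelfAdjoint X) (hY : IsSelfAdjoint Y) (E : V →ₗᵢ[ℂ] W) (F₁ : V →L[ℂ] W)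
    {g L D : ℝ} (hg : 0 < g) (hL : 1 ≤ L) (hgL : 1 ≤ g * L)
    (hE : H₀ ∘L E.toContinuousLinearMap = 0)
    (hgap : ∀ x, g * (‖x‖ ^ 2 - ‖adjoint E.toContinuousLinearMap x‖ ^ 2) ≤
      (inner ℂ x (H₀ x)).re)
    (hF : H₀ ∘L F₁ = X ∘L E.toContinuousLinearMap)
    (hEF : adjoint E.toContinuousLinearMap ∘L F₁ = 0)
    (hXn : ‖X‖ ≤ g * L) (hYn : ‖Y‖ ≤ g * L) (hg1 : g ≤ 1) (K : V →L[ℂ] V)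
    (hK : K = adjoint E.toContinuousLinearMap ∘L Y ∘L E.toContinuousLinearMap -
      adjoint E.toContinuousLinearMap ∘L X ∘L F₁)
    (hD : 400 * L ^ 6 ≤ D) :
    Simulates (((D : ℂ) ^ 2) • H₀ + (D : ℂ) • X + Y) E K (400 * L ^ 6 / D) (400 * L ^ 6 / D) := by
  set Ec := E.toContinuousLinearMap with hEc
  have hEn : ‖Ec‖ ≤ 1 := E.norm_toContinuousLinearMap_le
  have hEan : ‖adjoint Ec‖ ≤ 1 := by rwa [LinearIsometryEquiv.norm_map]
  have hEE : adjoint Ec ∘L Ec = 1 := by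
    rw [← ContinuousLinearMap.norm_map_iff_adjoint_comp_self]
    exact fun x => E.norm_map x
  have hL0 : 0 < L := by linarith
  have hD1 : 400 ≤ D := by
    have : 1 ≤ L ^ 6 := one_le_pow₀ hL
    linarith
  have hD0 : 0 < D := by linarith
  have hDc : (D : ℂ) ≠ 0 := by exact_mod_cast hD0.ne'
  have hgLL : g * L ≤ L := by nlinarith
  have hXE : ‖X ∘L Ec‖ ≤ g * L := by
    have := (opNorm_comp_le X Ec).trans (mul_le_mul hXn hEn (norm_nonneg _) (by positivity))
    linarith
  have hYE : ‖Y ∘L Ec‖ ≤ g * L := by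
    have := (opNorm_comp_le Y Ec).trans (mul_le_mul hYn hEn (norm_nonneg _) (by positivity))
    linarith
  have hF1n : ‖F₁‖ ≤ L := by
    have := norm_le_of_gap H₀ Ec hg hgap F₁ hEF (m := g * L) (by rw [hF]; exact hXE)
    rwa [mul_div_cancel_left₀ _ hg.ne'] at this
  have hXF : ‖X ∘L F₁‖ ≤ g * L * L :=
    (opNorm_comp_le X F₁).trans (mul_le_mul hXn hF1n (norm_nonneg _) (by positivity))
  set M : V →L[ℂ] W := X ∘L F₁ - Y ∘L Ec with hM
  have hMn : ‖M‖ ≤ g * (2 * L ^ 2) := by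
    calc ‖M‖ ≤ g * L * L + g * L := (norm_sub_le _ _).trans (add_le_add hXF hYE)
      _ ≤ g * (2 * L ^ 2) := by nlinarith [mul_nonneg hg.le hL0.le]
  have hKM : K = - (adjoint Ec ∘L M) := by
    rw [hK, hM, comp_sub]; abel
  have hL2 : (1 : ℝ) ≤ L ^ 2 := one_le_pow₀ hL
  have hKn : ‖K‖ ≤ 2 * L ^ 2 := by
    rw [hKM, norm_neg]
    have := (opNorm_comp_le (adjoint Ec) M).trans
      (mul_le_mul hEan hMn (norm_nonneg _) zero_le_one)
    nlinarith
  -- F₂ solves H₀F₂ = XF₁ - YE + EK. This is solvable because K is exactly the compression that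
  -- makes the right side orthogonal to the code.
  obtain ⟨F₂, hF2, hEF2⟩ := exists_preimage_of_gap H₀ hH Ec hEE hg hE hgap
    (M - Ec ∘L (adjoint Ec ∘L M)) (by
      rw [comp_sub, ← comp_assoc, hEE]
      exact sub_self _)
  have hF2n : ‖F₂‖ ≤ 2 * L ^ 2 := by
    have h1 : ‖M - Ec ∘L (adjoint Ec ∘L M)‖ ≤ g * (2 * L ^ 2) := by
      refine opNorm_le_bound _ (by positivity) fun x => ?_
      refine le_trans ?_ (le_of_opNorm_le _ hMn x)
      set y := M x with hy
      change ‖y - Ec (adjoint Ec y)‖ ≤ ‖y‖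
      have h2 : adjoint Ec (Ec (adjoint Ec y)) = adjoint Ec y :=
        DFunLike.congr_fun hEE (adjoint Ec y)
      have h3 : inner ℂ (y - Ec (adjoint Ec y)) (Ec (adjoint Ec y)) = 0 := by
        rw [← adjoint_inner_left, map_sub, h2, sub_self, inner_zero_left]
      have h4 := norm_add_sq_eq_norm_sq_add_norm_sq_of_inner_eq_zero
        (y - Ec (adjoint Ec y)) (Ec (adjoint Ec y)) h3
      rw [sub_add_cancel] at h4
      exact abs_le_of_sq_le_sq' (by nlinarith [norm_nonneg (Ec (adjoint Ec y))]) (norm_nonneg _) |>.2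
    have := norm_le_of_gap H₀ Ec hg hgap F₂ hEF2 (m := g * (2 * L ^ 2)) (by rw [hF2]; exact h1)
    rwa [mul_div_cancel_left₀ _ hg.ne'] at this
  set H := ((D : ℂ) ^ 2) • H₀ + (D : ℂ) • X + Y with hHdef
  have hHsa : IsSelfAdjoint H := by
    rw [hHdef]
    have c1 : IsSelfAdjoint ((D : ℂ) ^ 2) := by simp [isSelfAdjoint_iff]
    have c2 : IsSelfAdjoint (D : ℂ) := by simp [isSelfAdjoint_iff]
    exact IsSelfAdjoint.add (IsSelfAdjoint.add (IsSelfAdjoint.smul c1 hH)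
      (IsSelfAdjoint.smul c2 hX)) hY
  -- Truncated series for the dressed encoding: F₁ cancels the order D part of HT - TK and F₂ the
  -- order 1 part, leaving terms of order 1/D and 1/D².
  set T : V →L[ℂ] W := Ec - (D : ℂ)⁻¹ • F₁ + ((D : ℂ)⁻¹ ^ 2) • F₂ with hT
  have hnD : ‖(D : ℂ)⁻¹‖ = D⁻¹ := by
    rw [norm_inv, Complex.norm_real, Real.norm_of_nonneg hD0.le]
  have hTE : ‖T - Ec‖ ≤ 3 * L ^ 2 / D := by
    have h1 : T - Ec = ((D : ℂ)⁻¹ ^ 2) • F₂ - (D : ℂ)⁻¹ • F₁ := by rw [hT]; abel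
    rw [h1]
    refine (norm_sub_le _ _).trans ?_
    rw [norm_smul, norm_smul, norm_pow, hnD]
    have h2 : D⁻¹ ^ 2 * ‖F₂‖ ≤ D⁻¹ * (2 * L ^ 2) := by
      have h3 : D⁻¹ ^ 2 ≤ D⁻¹ := by
        have : D⁻¹ ≤ 1 := inv_le_one_of_one_le₀ (by linarith)
        nlinarith [inv_pos.mpr hD0]
      exact mul_le_mul h3 hF2n (norm_nonneg _) (by positivity)
    have h4 : D⁻¹ * ‖F₁‖ ≤ D⁻¹ * L ^ 2 :=
      mul_le_mul_of_nonneg_left (hF1n.trans (by nlinarith)) (by positivity)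
    calc _ ≤ D⁻¹ * (2 * L ^ 2) + D⁻¹ * L ^ 2 := add_le_add h2 h4
      _ = _ := by field_simp; ring
  have hres : ‖H ∘L T - T ∘L K‖ ≤ 11 * L ^ 4 / D := by
    have h1 : H ∘L T - T ∘L K = (D : ℂ)⁻¹ • (X ∘L F₂ - Y ∘L F₁ + F₁ ∘L K) +
        ((D : ℂ)⁻¹ ^ 2) • (Y ∘L F₂ - F₂ ∘L K) := by
      have h0 : ∀ x, H₀ (Ec x) = 0 := fun x => DFunLike.congr_fun hE x
      have h1 : ∀ x, H₀ (F₁ x) = X (Ec x) := fun x => DFunLike.congr_fun hF x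
      have h2 : ∀ x, H₀ (F₂ x) = X (F₁ x) - Y (Ec x) + Ec (K x) := by
        intro x
        have := DFunLike.congr_fun hF2 x
        rw [hKM]
        simp only [coe_comp, Function.comp_apply, sub_apply, neg_apply, map_neg] at this ⊢
        rw [this, hM]
        simp only [coe_comp, Function.comp_apply, sub_apply, map_sub]
        abel
      ext x
      simp only [hHdef, hT, sub_apply, add_apply, coe_comp, Function.comp_apply, smul_apply,
        map_add, map_sub, map_smul, h0, h1, h2, smul_zero]
      match_scalars <;> field_simp <;> ring
    rw [h1]
    have n1 : ‖X ∘L F₂‖ ≤ L * (2 * L ^ 2) :=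
      (opNorm_comp_le _ _).trans
        (mul_le_mul (hXn.trans hgLL) hF2n (norm_nonneg _) (by positivity))
    have n2 : ‖Y ∘L F₁‖ ≤ L * L :=
      (opNorm_comp_le _ _).trans
        (mul_le_mul (hYn.trans hgLL) hF1n (norm_nonneg _) (by positivity))
    have n3 : ‖F₁ ∘L K‖ ≤ L * (2 * L ^ 2) :=
      (opNorm_comp_le _ _).trans (mul_le_mul hF1n hKn (norm_nonneg _) (by positivity))
    have n4 : ‖Y ∘L F₂‖ ≤ L * (2 * L ^ 2) :=
      (opNorm_comp_le _ _).trans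
        (mul_le_mul (hYn.trans hgLL) hF2n (norm_nonneg _) (by positivity))
    have n5 : ‖F₂ ∘L K‖ ≤ (2 * L ^ 2) * (2 * L ^ 2) :=
      (opNorm_comp_le _ _).trans (mul_le_mul hF2n hKn (norm_nonneg _) (by positivity))
    have n6 : ‖X ∘L F₂ - Y ∘L F₁ + F₁ ∘L K‖ ≤ L * (2 * L ^ 2) + L * L + L * (2 * L ^ 2) :=
      (norm_add_le _ _).trans (add_le_add ((norm_sub_le _ _).trans (add_le_add n1 n2)) n3)
    have n7 : ‖Y ∘L F₂ - F₂ ∘L K‖ ≤ L * (2 * L ^ 2) + (2 * L ^ 2) * (2 * L ^ 2) :=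
      (norm_sub_le _ _).trans (add_le_add n4 n5)
    have h3 : D⁻¹ ^ 2 ≤ D⁻¹ := by
      have : D⁻¹ ≤ 1 := inv_le_one_of_one_le₀ (by linarith)
      nlinarith [inv_pos.mpr hD0]
    refine (norm_add_le _ _).trans ?_
    rw [norm_smul, norm_smul, norm_pow, hnD]
    have h4 : L ^ 3 ≤ L ^ 4 := pow_le_pow_right₀ hL (by norm_num)
    have h5 : L ^ 2 ≤ L ^ 4 := pow_le_pow_right₀ hL (by norm_num)
    calc _ ≤ D⁻¹ * (5 * L ^ 4) + D⁻¹ * (6 * L ^ 4) := by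
          refine add_le_add (mul_le_mul_of_nonneg_left (n6.trans ?_) (by positivity))
            (mul_le_mul h3 (n7.trans ?_) (norm_nonneg _) (by positivity))
          · nlinarith
          · nlinarith
      _ = _ := by field_simp; ring
  have hδ1 : 3 * L ^ 2 / D ≤ 1 / 2 := by
    rw [div_le_div_iff₀ hD0 (by norm_num)]
    have : L ^ 2 ≤ L ^ 6 := pow_le_pow_right₀ hL (by norm_num)
    nlinarith
  have hΛ : ∀ y, adjoint T y = 0 → (2 * L ^ 2 + 1) * ‖y‖ ^ 2 ≤ (inner ℂ y (H y)).re := by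
    intro y hy
    have h1 : ‖adjoint Ec y‖ ≤ (1 / 2) * ‖y‖ := by
      have h2 : adjoint Ec y = - adjoint (T - Ec) y := by
        rw [map_sub, sub_apply, hy, zero_sub, neg_neg]
      rw [h2, norm_neg]
      refine le_of_opNorm_le _ ?_ y
      rw [LinearIsometryEquiv.norm_map]
      exact hTE.trans hδ1
    exact quadratic_form_ge H₀ X Y Ec hg hL hgL hgap hXn hYn hD y h1
  have hsum : 3 * L ^ 2 / D + 11 * L ^ 4 / D ≤ 14 * L ^ 4 / D := by
    rw [← add_div]
    have h5 : L ^ 2 ≤ L ^ 4 := pow_le_pow_right₀ hL (by norm_num)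
    gcongr
    linarith
  have h6 : 0 ≤ L ^ 6 := by positivity
  have h46 : L ^ 4 ≤ L ^ 6 := pow_le_pow_right₀ hL (by norm_num)
  obtain ⟨E', h1, h2, h3⟩ := exists_low_energy_isometry H hHsa T K E hΛ hKn hres hTE le_rfl (by
    have : 14 * L ^ 4 / D ≤ 1 / 6 := by
      rw [div_le_div_iff₀ hD0 (by norm_num)]
      nlinarith
    linarith)
  -- The energy error is at most (22L⁴ + 336L⁶)/D and the encoding error at most 56L⁴/D; 400L⁶/D
  -- covers both.
  refine ⟨E', h1, h2.trans ?_, h3.trans ?_⟩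
  · calc _ ≤ 2 * (11 * L ^ 4 / D) + 12 * (14 * L ^ 4 / D) * (2 * L ^ 2) := by gcongr
      _ = (22 * L ^ 4 + 336 * L ^ 6) / D := by field_simp; ring
      _ ≤ _ := by gcongr; linarith
  · calc _ ≤ 4 * (14 * L ^ 4 / D) := by gcongr
      _ = 56 * L ^ 4 / D := by ring
      _ ≤ _ := by gcongr; linarith

end SecondOrder

/-! ### Transfer to matrices in the computational basis. -/

section MatrixVersion

open ContinuousLinearMap Matrix
open scoped ComplexOrder

/-- The operator between qubit systems with a given matrix in the computational bases. -/
def rectOp {n m : ℕ} (A : Matrix (Fin m → Fin 2) (Fin n → Fin 2) ℂ) : Qubits n →L[ℂ] Qubits m :=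
  LinearMap.toContinuousLinearMap (Matrix.toEuclideanLin A)

theorem rectOp_apply {n m : ℕ} (A : Matrix (Fin m → Fin 2) (Fin n → Fin 2) ℂ) (x : Qubits n) :
    rectOp A x = WithLp.toLp 2 (A *ᵥ x.ofLp) := rfl

theorem op_eq_rectOp {n : ℕ} (A : Matrix (Fin n → Fin 2) (Fin n → Fin 2) ℂ) :
    op A = rectOp A := rfl

theorem rectOp_mul {n m k : ℕ} (A : Matrix (Fin m → Fin 2) (Fin n → Fin 2) ℂ)
    (B : Matrix (Fin n → Fin 2) (Fin k → Fin 2) ℂ) :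
    rectOp (A * B) = rectOp A ∘L rectOp B := by
  ext x : 1
  simp [rectOp_apply]

theorem rectOp_one {n : ℕ} : rectOp (1 : Matrix (Fin n → Fin 2) (Fin n → Fin 2) ℂ) = 1 := by
  ext x : 1
  simp [rectOp_apply]

theorem rectOp_add {n m : ℕ} (A B : Matrix (Fin m → Fin 2) (Fin n → Fin 2) ℂ) :
    rectOp (A + B) = rectOp A + rectOp B := by
  ext x : 1
  simp [rectOp_apply, Matrix.add_mulVec]

theorem rectOp_sub {n m : ℕ} (A B : Matrix (Fin m → Fin 2) (Fin n → Fin 2) ℂ) :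
    rectOp (A - B) = rectOp A - rectOp B := by
  ext x : 1
  simp [rectOp_apply, Matrix.sub_mulVec]

theorem rectOp_smul {n m : ℕ} (c : ℂ) (A : Matrix (Fin m → Fin 2) (Fin n → Fin 2) ℂ) :
    rectOp (c • A) = c • rectOp A := by
  ext x : 1
  simp [rectOp_apply, Matrix.smul_mulVec]

theorem rectOp_zero {n m : ℕ} :
    rectOp (0 : Matrix (Fin m → Fin 2) (Fin n → Fin 2) ℂ) = 0 := by
  ext x : 1
  simp [rectOp_apply]

theorem adjoint_rectOp {n m : ℕ} (A : Matrix (Fin m → Fin 2) (Fin n → Fin 2) ℂ) :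
    adjoint (rectOp A) = rectOp Aᴴ := by
  apply ContinuousLinearMap.coe_injective
  change _ = Matrix.toEuclideanLin Aᴴ
  rw [Matrix.toEuclideanLin_conjTranspose_eq_adjoint]
  rfl

theorem isSelfAdjoint_rectOp {n : ℕ} {A : Matrix (Fin n → Fin 2) (Fin n → Fin 2) ℂ}
    (hA : A.IsHermitian) : IsSelfAdjoint (rectOp A) := by
  rw [ContinuousLinearMap.isSelfAdjoint_iff', adjoint_rectOp, hA.eq]

theorem gap_of_posSemidef {n m : ℕ} {H₀ : Matrix (Fin m → Fin 2) (Fin m → Fin 2) ℂ}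
    {E : Matrix (Fin m → Fin 2) (Fin n → Fin 2) ℂ} {g : ℝ}
    (h : (H₀ - (g : ℂ) • (1 - E * Eᴴ)).PosSemidef) (x : Qubits m) :
    g * (‖x‖ ^ 2 - ‖adjoint (rectOp E) x‖ ^ 2) ≤ (inner ℂ x (rectOp H₀ x)).re := by
  have h1 := (Matrix.isPositive_toEuclideanLin_iff.mpr h).re_inner_nonneg_right x
  change 0 ≤ (inner ℂ x (rectOp (H₀ - (g : ℂ) • (1 - E * Eᴴ)) x)).re at h1
  rw [rectOp_sub, rectOp_smul, rectOp_sub, rectOp_mul, rectOp_one, ← adjoint_rectOp] at h1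
  have h2 : inner ℂ x ((rectOp E ∘L adjoint (rectOp E)) x) = (‖adjoint (rectOp E) x‖ : ℂ) ^ 2 := by
    rw [ContinuousLinearMap.comp_apply, ← adjoint_inner_left]
    exact inner_self_eq_norm_sq_to_K _
  have h3 : inner ℂ x x = (‖x‖ : ℂ) ^ 2 := inner_self_eq_norm_sq_to_K _
  simp only [_root_.sub_apply, _root_.smul_apply, inner_sub_right, inner_smul_right, h2,
    one_apply_eq_self, h3] at h1
  rw [← Complex.ofReal_pow, ← Complex.ofReal_pow, ← Complex.ofReal_sub, Complex.sub_re,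
    Complex.re_ofReal_mul, Complex.ofReal_re] at h1
  linarith

theorem simulates_second_order_matrix {n m : ℕ} (H₀ X Y : Matrix (Fin m → Fin 2) (Fin m → Fin 2) ℂ)
    (hH : H₀.IsHermitian) (hX : X.IsHermitian) (hY : Y.IsHermitian)
    (E F₁ : Matrix (Fin m → Fin 2) (Fin n → Fin 2) ℂ) {g L D : ℝ} (hg : 0 < g) (hg1 : g ≤ 1)
    (hL : 1 ≤ L) (hgL : 1 ≤ g * L) (hEE : Eᴴ * E = 1) (hE : H₀ * E = 0)
    (hgap : (H₀ - (g : ℂ) • (1 - E * Eᴴ)).PosSemidef)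
    (hF : H₀ * F₁ = X * E) (hEF : Eᴴ * F₁ = 0) (hXn : ‖op X‖ ≤ g * L) (hYn : ‖op Y‖ ≤ g * L)
    (hD : 400 * L ^ 6 ≤ D) :
    ∃ E' : Qubits n →ₗᵢ[ℂ] Qubits m, (∀ x, E' x = rectOp E x) ∧
      Simulates (op (((D : ℂ) ^ 2) • H₀ + (D : ℂ) • X + Y)) E' (op (Eᴴ * Y * E - Eᴴ * X * F₁))
        (400 * L ^ 6 / D) (400 * L ^ 6 / D) := by
  have hn : ∀ x, ‖rectOp E x‖ = ‖x‖ := by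
    rw [ContinuousLinearMap.norm_map_iff_adjoint_comp_self, adjoint_rectOp, ← rectOp_mul, hEE,
      rectOp_one]
  let E' : Qubits n →ₗᵢ[ℂ] Qubits m := ⟨(rectOp E : Qubits n →ₗ[ℂ] Qubits m), hn⟩
  have hE' : E'.toContinuousLinearMap = rectOp E := rfl
  refine ⟨E', fun x => rfl, ?_⟩
  have := simulates_second_order (rectOp H₀) (rectOp X) (rectOp Y) (isSelfAdjoint_rectOp hH)
    (isSelfAdjoint_rectOp hX) (isSelfAdjoint_rectOp hY) E' (rectOp F₁) hg hL hgL
    (by rw [hE', ← rectOp_mul, hE, rectOp_zero])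
    (by rw [hE']; exact gap_of_posSemidef hgap)
    (by rw [hE', ← rectOp_mul, ← rectOp_mul, hF])
    (by rw [hE', adjoint_rectOp, ← rectOp_mul, hEF, rectOp_zero]) hXn hYn hg1
    (op (Eᴴ * Y * E - Eᴴ * X * F₁))
    (by
      rw [hE', adjoint_rectOp, op_eq_rectOp, rectOp_sub, rectOp_mul, rectOp_mul, rectOp_mul,
        rectOp_mul]
      rfl) hD
  rwa [op_eq_rectOp (((D : ℂ) ^ 2) • H₀ + (D : ℂ) • X + Y), rectOp_add, rectOp_add, rectOp_smul,
    rectOp_smul]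

end MatrixVersion

/-! ### Tensor products over sites and local operators. -/

section Tensor

open Matrix Function
open scoped ComplexOrder

variable {ι α β γ : Type*} [Fintype ι] [DecidableEq ι]

/-- The tensor product of a family of matrices. -/
def tens (M : ι → Matrix α β ℂ) : Matrix (ι → α) (ι → β) ℂ :=
  Matrix.of fun x y => ∏ i, M i (x i) (y i)

omit [DecidableEq ι] in
theorem tens_apply (M : ι → Matrix α β ℂ) (x : ι → α) (y : ι → β) :
    tens M x y = ∏ i, M i (x i) (y i) := rfl

theorem tens_mul [Fintype β] (M : ι → Matrix α β ℂ) (N : ι → Matrix β γ ℂ) :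
    tens M * tens N = tens fun i => M i * N i := by
  ext x y
  simp only [Matrix.mul_apply, tens_apply, ← Finset.prod_mul_distrib]
  rw [Finset.prod_univ_sum, Fintype.piFinset_univ]

omit [DecidableEq ι] in
theorem tens_conjTranspose (M : ι → Matrix α β ℂ) : (tens M)ᴴ = tens fun i => (M i)ᴴ := by
  ext x y
  simp [tens_apply, Matrix.conjTranspose_apply]

omit [DecidableEq ι] in
theorem tens_one [DecidableEq α] : tens (fun _ : ι => (1 : Matrix α α ℂ)) = 1 := by
  ext x y
  simp only [tens_apply, Matrix.one_apply]
  rw [Finset.prod_ite_zero]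
  simp [funext_iff]

omit [DecidableEq ι] in
theorem tens_eq_zero (M : ι → Matrix α β ℂ) (i : ι) (h : M i = 0) : tens M = 0 := by
  classical
  ext x y
  rw [tens_apply, Matrix.zero_apply]
  exact Finset.prod_eq_zero (Finset.mem_univ i) (by simp [h])

theorem tens_update_apply (M : ι → Matrix α β ℂ) (i : ι) (A : Matrix α β ℂ) (x : ι → α)
    (y : ι → β) :
    tens (update M i A) x y = A (x i) (y i) * ∏ k ∈ Finset.univ.erase i, M k (x k) (y k) := by
  rw [tens_apply, ← Finset.mul_prod_erase _ _ (Finset.mem_univ i), update_self]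
  congr 1
  refine Finset.prod_congr rfl fun k hk => ?_
  rw [update_of_ne (Finset.ne_of_mem_erase hk)]

theorem tens_update_smul (M : ι → Matrix α β ℂ) (i : ι) (c : ℂ) (A : Matrix α β ℂ) :
    tens (update M i (c • A)) = c • tens (update M i A) := by
  ext x y
  simp [tens_update_apply, mul_assoc]

theorem tens_update_sum {κ : Type*} (s : Finset κ) (M : ι → Matrix α β ℂ) (i : ι)
    (A : κ → Matrix α β ℂ) :
    tens (update M i (∑ k ∈ s, A k)) = ∑ k ∈ s, tens (update M i (A k)) := by
  ext x y
  simp [tens_update_apply, Matrix.sum_apply, Finset.sum_mul]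

theorem tens_update_sub (M : ι → Matrix α β ℂ) (i : ι) (A B : Matrix α β ℂ) :
    tens (update M i (A - B)) = tens (update M i A) - tens (update M i B) := by
  ext x y
  simp [tens_update_apply, sub_mul]

/-- The tensor product with `A` at site `i`, `B` at site `j`, and `v` at all other sites. -/
def duo (v : Matrix α β ℂ) (i j : ι) (A B : Matrix α β ℂ) : Matrix (ι → α) (ι → β) ℂ :=
  tens (update (update (fun _ => v) i A) j B)

theorem duo_sum {κ μ : Type*} (s : Finset κ) (t : Finset μ) (v : Matrix α β ℂ) {i j : ι}
    (hij : i ≠ j) (A : κ → Matrix α β ℂ) (B : μ → Matrix α β ℂ) :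
    duo v i j (∑ k ∈ s, A k) (∑ l ∈ t, B l) = ∑ k ∈ s, ∑ l ∈ t, duo v i j (A k) (B l) := by
  rw [duo, update_comm hij, tens_update_sum]
  refine Finset.sum_congr rfl fun k _ => ?_
  rw [update_comm hij.symm, tens_update_sum]
  rfl

omit [Fintype ι] in
theorem duo_family_apply_left {v A B : Matrix α β ℂ} {i j : ι} (hij : i ≠ j) :
    update (update (fun _ => v) i A) j B i = A := by
  rw [update_of_ne hij, update_self]

omit [Fintype ι] in
theorem duo_family_apply_of_ne {v A B : Matrix α β ℂ} {i j k : ι} (hi : k ≠ i) (hj : k ≠ j) :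
    update (update (fun _ => v) i A) j B k = v := by
  rw [update_of_ne hj, update_of_ne hi]

omit [Fintype ι] in
theorem update_map {δ ε : Type*} (f : δ → ε) (M : ι → δ) (i : ι) (a : δ) (k : ι) :
    f (update M i a k) = update (fun k => f (M k)) i (f a) k := by
  rcases eq_or_ne k i with rfl | h
  · simp
  · simp [h]

theorem duo_conjTranspose (v : Matrix α β ℂ) (i j : ι) (A B : Matrix α β ℂ) :
    (duo v i j A B)ᴴ = duo vᴴ i j Aᴴ Bᴴ := by
  rw [duo, tens_conjTranspose, duo]
  congr 1
  funext k
  rw [update_map (fun M : Matrix α β ℂ => Mᴴ)]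
  congr 1
  funext k
  rw [update_map (fun M : Matrix α β ℂ => Mᴴ)]

theorem duo_mul_duo [Fintype β] (v : Matrix α β ℂ) (w : Matrix β γ ℂ) {i j : ι} (hij : i ≠ j)
    (A B : Matrix α β ℂ) (A' B' : Matrix β γ ℂ) :
    duo v i j A B * duo w i j A' B' = duo (v * w) i j (A * A') (B * B') := by
  rw [duo, duo, tens_mul, duo]
  congr 1
  funext k
  rcases eq_or_ne k j with rfl | hj
  · simp
  rcases eq_or_ne k i with rfl | hi
  · simp [hij]
  · simp [hi, hj]

theorem duo_mul_tens [Fintype β] (v : Matrix α β ℂ) (w : Matrix β γ ℂ) {i j : ι} (hij : i ≠ j)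
    (A B : Matrix α β ℂ) :
    duo v i j A B * tens (fun _ : ι => w) = duo (v * w) i j (A * w) (B * w) := by
  have : tens (fun _ : ι => w) = duo w i j w w := by rw [duo]; simp
  rw [this, duo_mul_duo _ _ hij]

/-- Products of excitations of different pairs of sites have no component along the vacuum. -/
theorem duo_mul_duo_eq_zero [Fintype β] [LinearOrder ι] (v : Matrix α β ℂ) (w : Matrix β γ ℂ)
    {i j k l : ι} (hij : i < j) (hkl : k < l) (hne : ¬ (k = i ∧ l = j)) (A B : Matrix α β ℂ)
    (A' B' : Matrix β γ ℂ) (hA : v * A' = 0) (hB : v * B' = 0) :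
    duo v k l A B * duo w i j A' B' = 0 := by
  rw [duo, duo, tens_mul]
  -- For distinct pairs, i or j lies outside {k, l}. At that site the vacuum factor v meets an
  -- excitation, and the product vanishes.
  by_cases hi : i ≠ k ∧ i ≠ l
  · apply tens_eq_zero _ i
    rw [duo_family_apply_left hij.ne, duo_family_apply_of_ne hi.1 hi.2, hA]
  · have hj : j ≠ k ∧ j ≠ l := by
      constructor
      · rintro rfl
        apply hi
        exact ⟨hij.ne, (hij.trans hkl).ne⟩
      · rintro rfl
        apply hi
        exact ⟨fun h => hne ⟨h.symm, rfl⟩, hij.ne⟩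
    apply tens_eq_zero _ j
    rw [update_self, duo_family_apply_of_ne hj.1 hj.2, hB]

section Site

variable [Fintype α] [DecidableEq α]

/-- The operator `A` applied to site `i`. -/
def site (i : ι) (A : Matrix α α ℂ) : Matrix (ι → α) (ι → α) ℂ :=
  tens (update (fun _ => 1) i A)

theorem site_mul_tens (i : ι) (A : Matrix α α ℂ) (M : ι → Matrix α β ℂ) :
    site i A * tens M = tens (update M i (A * M i)) := by
  rw [site, tens_mul]
  congr 1
  funext k
  rcases eq_or_ne k i with rfl | h
  · simp
  · simp [h]

omit [Fintype α] in
theorem site_apply (i : ι) (A : Matrix α α ℂ) (x y : ι → α) :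
    site i A x y = if ∀ k, k ≠ i → x k = y k then A (x i) (y i) else 0 := by
  rw [site, tens_update_apply]
  simp only [Matrix.one_apply]
  rw [Finset.prod_ite_zero]
  simp

theorem site_mul_apply (i : ι) (A : Matrix α α ℂ) (M : Matrix (ι → α) β ℂ) (x : ι → α) (y : β) :
    (site i A * M) x y = ∑ t, A (x i) t * M (update x i t) y := by
  rw [Matrix.mul_apply]
  symm
  refine Finset.sum_of_injOn (fun t => update x i t) ?_ (fun _ _ => Finset.mem_coe.mpr (Finset.mem_univ _)) ?_ ?_
  · intro s _ t _ h
    simpa using congrFun h i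
  · intro z _ hz
    rw [site_apply, if_neg, zero_mul]
    intro h
    apply hz
    refine ⟨z i, by simp, ?_⟩
    funext k
    rcases eq_or_ne k i with rfl | hk
    · simp
    · simp [hk, h k hk]
  · intro t _
    rw [site_apply, if_pos, update_self]
    intro k hk
    rw [update_of_ne hk]

theorem site_mul_site_same (i : ι) (A B : Matrix α α ℂ) :
    site i A * site i B = site i (A * B) := by
  conv_lhs => rw [site.eq_def i B]
  rw [site_mul_tens, update_self, update_idem]
  rfl

theorem site_mul_site_eq_duo {i j : ι} (hij : i ≠ j) (A B : Matrix α α ℂ) :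
    site i A * site j B = duo 1 i j A B := by
  conv_lhs => rw [site.eq_def j B]
  rw [site_mul_tens, update_of_ne hij, mul_one, update_comm hij.symm]
  rfl

omit [Fintype α] in
theorem site_conjTranspose (i : ι) (A : Matrix α α ℂ) : (site i A)ᴴ = site i Aᴴ := by
  rw [site, tens_conjTranspose, site]
  congr 1
  funext k
  rw [update_map (fun M : Matrix α α ℂ => Mᴴ)]
  simp

omit [Fintype α] in
theorem site_one (i : ι) : site i (1 : Matrix α α ℂ) = 1 := by
  rw [site, ← tens_one]
  congr 1
  exact update_eq_self i _

omit [Fintype α] in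
theorem site_smul (i : ι) (c : ℂ) (A : Matrix α α ℂ) : site i (c • A) = c • site i A :=
  tens_update_smul _ _ _ _

omit [Fintype α] in
theorem site_sum {κ : Type*} (s : Finset κ) (i : ι) (A : κ → Matrix α α ℂ) :
    site i (∑ k ∈ s, A k) = ∑ k ∈ s, site i (A k) :=
  tens_update_sum _ _ _ _

omit [Fintype α] in
theorem site_sub (i : ι) (A B : Matrix α α ℂ) : site i (A - B) = site i A - site i B :=
  tens_update_sub _ _ _ _

omit [Fintype α] in
theorem site_add (i : ι) (A B : Matrix α α ℂ) : site i (A + B) = site i A + site i B := by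
  have := site_sub i (A + B) B
  rw [add_sub_cancel_right] at this
  rw [this, sub_add_cancel]

/-- Sites in their ground state contribute no energy, so only the two excited sites count. -/
theorem sum_site_mul_duo (K : Matrix α α ℂ) (v A B : Matrix α β ℂ) {i j : ι} (hij : i ≠ j)
    (hv : K * v = 0) {e e' : ℂ} (hA : K * A = e • A) (hB : K * B = e' • B) :
    (∑ k : ι, site k K) * duo v i j A B = (e + e') • duo v i j A B := by
  have h : ∀ k, site k K * duo v i j A B =
      (if k = i then e • duo v i j A B else 0) + (if k = j then e' • duo v i j A B else 0) := by
    intro k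
    rw [duo, site_mul_tens]
    rcases eq_or_ne k i with rfl | hi
    · rw [duo_family_apply_left hij, hA, tens_update_smul, if_pos rfl, if_neg hij, add_zero]
      congr 2
      rw [update_eq_self_iff, duo_family_apply_left hij]
    rcases eq_or_ne k j with rfl | hj
    · rw [update_self, hB, tens_update_smul, if_pos rfl, if_neg hi, zero_add]
      simp
    · rw [if_neg hi, if_neg hj, add_zero]
      apply tens_eq_zero _ k
      rw [update_self, duo_family_apply_of_ne hi hj, hv]
  rw [Matrix.sum_mul]
  simp only [h]
  rw [Finset.sum_add_distrib]
  simp [add_smul]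

open scoped MatrixOrder Matrix.Norms.L2Operator in
theorem site_posSemidef (i : ι) {A : Matrix α α ℂ} (hA : A.PosSemidef) : (site i A).PosSemidef := by
  obtain ⟨B, rfl⟩ : ∃ B : Matrix α α ℂ, A = Bᴴ * B := by
    exact CStarAlgebra.nonneg_iff_eq_star_mul_self.mp hA.nonneg
  rw [← site_mul_site_same, ← site_conjTranspose]
  exact Matrix.posSemidef_conjTranspose_mul_self _

/-- Operator union bound for commuting projections on the sites. -/
theorem sum_site_sub_posSemidef (p : Matrix α α ℂ) (hp : pᴴ = p) (hpp : p * p = p) :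
    ((∑ k : ι, site k (1 - p)) - (1 - tens fun _ : ι => p)).PosSemidef := by
  suffices h : ∀ s : Finset ι, ((∑ k ∈ s, site k (1 - p)) -
      (1 - tens fun i : ι => if i ∈ s then p else 1)).PosSemidef by
    simpa using h Finset.univ
  intro s
  induction s using Finset.induction_on with
  | empty => simpa [tens_one] using Matrix.PosSemidef.zero
  | insert k s hk ih =>
    set Q := tens fun i : ι => if i ∈ s then p else 1 with hQ
    have hQh : Qᴴ = Q := by
      rw [hQ, tens_conjTranspose]
      congr 1; funext i; split_ifs <;> simp [hp]
    have hQQ : Q * Q = Q := by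
      rw [hQ, tens_mul]
      congr 1; funext i; split_ifs <;> simp [hpp]
    have h1 : (tens fun i : ι => if i ∈ insert k s then p else 1) = site k p * Q := by
      rw [hQ, site_mul_tens, if_neg hk, mul_one]
      congr 1
      funext i
      rcases eq_or_ne i k with rfl | h
      · simp
      · simp [h]
    have hcomm : site k p * Q = Q * site k p := by
      have h2 : (tens fun i : ι => if i ∈ insert k s then p else 1)ᴴ =
          tens fun i : ι => if i ∈ insert k s then p else 1 := by
        rw [tens_conjTranspose]
        congr 1; funext i; split_ifs <;> simp [hp]
      rw [h1, Matrix.conjTranspose_mul, hQh, site_conjTranspose, hp] at h2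
      exact h2.symm
    -- Adding a site increases the difference by (1 - p_k)(1 - Q), a product of commuting
    -- projections and hence positive.
    have h2 : (∑ i ∈ insert k s, site i (1 - p)) - (1 - site k p * Q) =
        ((∑ i ∈ s, site i (1 - p)) - (1 - Q)) + (1 - site k p) * (1 - Q) := by
      rw [Finset.sum_insert hk, site_sub, site_one]
      noncomm_ring
    rw [h1, h2]
    refine ih.add ?_
    have h3 : (1 - site k p) * (1 - Q) =
        ((1 - site k p) * (1 - Q))ᴴ * ((1 - site k p) * (1 - Q)) := by
      have hs : site k p * site k p = site k p := by rw [site_mul_site_same, hpp]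
      have hsh : (site k p)ᴴ = site k p := by rw [site_conjTranspose, hp]
      have e1 : (1 - site k p) * (1 - site k p) = 1 - site k p := by
        rw [mul_sub, sub_mul, sub_mul, hs]; simp
      have e2 : (1 - Q) * (1 - Q) = 1 - Q := by
        rw [mul_sub, sub_mul, sub_mul, hQQ]; simp
      have e3 : (1 - Q) * (1 - site k p) = (1 - site k p) * (1 - Q) := by
        rw [mul_sub, sub_mul, sub_mul, mul_sub, sub_mul, sub_mul, hcomm]
        simp; abel
      rw [Matrix.conjTranspose_mul, Matrix.conjTranspose_sub, Matrix.conjTranspose_sub,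
        Matrix.conjTranspose_one, hQh, hsh, e3, Matrix.mul_assoc, ← Matrix.mul_assoc (1 - Q), e3,
        Matrix.mul_assoc, e2, ← Matrix.mul_assoc, e1]
    rw [h3]
    exact Matrix.posSemidef_conjTranspose_mul_self _

end Site

end Tensor

/-! ### Coordinates on a block of four qubits. -/

section Cube

open Matrix Function

/-- Bit strings of a block of four qubits; qubit `0` is the center of a star with three leaves. -/
abbrev Cube : Type := Fin 4 → Fin 2

theorem forall_cube {p : Cube → Prop} : (∀ x, p x) ↔ ∀ c i j k, p ![c, i, j, k] := by
  refine ⟨fun h c i j k => h _, fun h x => ?_⟩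
  have : x = ![x 0, x 1, x 2, x 3] := by
    funext q; fin_cases q <;> rfl
  rw [this]
  exact h _ _ _ _

theorem sum_cube {M : Type*} [AddCommMonoid M] (f : Cube → M) :
    ∑ x, f x = ∑ c, ∑ i, ∑ j, ∑ k, f ![c, i, j, k] := by
  let e : Fin 2 × Fin 2 × Fin 2 × Fin 2 ≃ Cube :=
    { toFun := fun t => ![t.1, t.2.1, t.2.2.1, t.2.2.2]
      invFun := fun x => (x 0, x 1, x 2, x 3)
      left_inv := fun t => rfl
      right_inv := fun x => by funext q; fin_cases q <;> rfl }
  rw [← e.sum_comp]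
  simp only [Fintype.sum_prod_type]
  rfl

theorem update_cube_zero (c i j k t : Fin 2) :
    update (![c, i, j, k] : Cube) 0 t = ![t, i, j, k] := by
  funext q; fin_cases q <;> rfl

theorem update_cube_one (c i j k t : Fin 2) :
    update (![c, i, j, k] : Cube) 1 t = ![c, t, j, k] := by
  funext q; fin_cases q <;> rfl

theorem update_cube_two (c i j k t : Fin 2) :
    update (![c, i, j, k] : Cube) 2 t = ![c, i, t, k] := by
  funext q; fin_cases q <;> rfl

theorem update_cube_three (c i j k t : Fin 2) :
    update (![c, i, j, k] : Cube) 3 t = ![c, i, j, t] := by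
  funext q; fin_cases q <;> rfl

/-- The matrix whose columns are given by functions of four bits. -/
def cubeMat {β : Type*} (T : Fin 2 → Fin 2 → Fin 2 → Fin 2 → β → ℂ) : Matrix Cube β ℂ :=
  Matrix.of fun x l => T (x 0) (x 1) (x 2) (x 3) l

theorem cubeMat_apply {β : Type*} (T : Fin 2 → Fin 2 → Fin 2 → Fin 2 → β → ℂ)
    (c i j k : Fin 2) (l : β) : cubeMat T ![c, i, j, k] l = T c i j k l := rfl

theorem cube_ext {β : Type*} {A B : Matrix Cube β ℂ}
    (h : ∀ c i j k l, A ![c, i, j, k] l = B ![c, i, j, k] l) : A = B := by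
  ext x l
  revert x
  rw [forall_cube]
  exact fun c i j k => h c i j k l

theorem site_zero_mul_apply {β : Type*} (A : Matrix (Fin 2) (Fin 2) ℂ) (M : Matrix Cube β ℂ)
    (c i j k : Fin 2) (l : β) : (site (0 : Fin 4) A * M) ![c, i, j, k] l =
      A c 0 * M ![0, i, j, k] l + A c 1 * M ![1, i, j, k] l := by
  rw [site_mul_apply]
  simp only [Fin.sum_univ_two, update_cube_zero]
  rfl

theorem site_one_mul_apply {β : Type*} (A : Matrix (Fin 2) (Fin 2) ℂ) (M : Matrix Cube β ℂ)
    (c i j k : Fin 2) (l : β) : (site (1 : Fin 4) A * M) ![c, i, j, k] l =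
      A i 0 * M ![c, 0, j, k] l + A i 1 * M ![c, 1, j, k] l := by
  rw [site_mul_apply]
  simp only [Fin.sum_univ_two, update_cube_one]
  rfl

theorem site_two_mul_apply {β : Type*} (A : Matrix (Fin 2) (Fin 2) ℂ) (M : Matrix Cube β ℂ)
    (c i j k : Fin 2) (l : β) : (site (2 : Fin 4) A * M) ![c, i, j, k] l =
      A j 0 * M ![c, i, 0, k] l + A j 1 * M ![c, i, 1, k] l := by
  rw [site_mul_apply]
  simp only [Fin.sum_univ_two, update_cube_two]
  rfl

theorem site_three_mul_apply {β : Type*} (A : Matrix (Fin 2) (Fin 2) ℂ) (M : Matrix Cube β ℂ)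
    (c i j k : Fin 2) (l : β) : (site (3 : Fin 4) A * M) ![c, i, j, k] l =
      A k 0 * M ![c, i, j, 0] l + A k 1 * M ![c, i, j, 1] l := by
  rw [site_mul_apply]
  simp only [Fin.sum_univ_two, update_cube_three]
  rfl

end Cube

/-! ### The star Hamiltonian and its Hadamard-rotated form. -/

section Frames

/-- The three Pauli matrices. -/
def pauli : Fin 3 → Matrix (Fin 2) (Fin 2) ℂ := ![pauliX, pauliY, pauliZ]

/-- The three Pauli matrices conjugated by the Hadamard matrix. -/
def rotPauli : Fin 3 → Matrix (Fin 2) (Fin 2) ℂ := ![pauliZ, -pauliY, pauliX]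

/-- The Hadamard matrix. -/
def hadamard : Matrix (Fin 2) (Fin 2) ℂ :=
  (((Real.sqrt 2)⁻¹ : ℝ) : ℂ) • !![1, 1; 1, -1]

theorem inv_sqrt_two_sq : ((((Real.sqrt 2)⁻¹ : ℝ) : ℂ)) * (((Real.sqrt 2)⁻¹ : ℝ) : ℂ) = 1 / 2 := by
  rw [← Complex.ofReal_mul, ← mul_inv, Real.mul_self_sqrt (by norm_num)]
  norm_num

theorem hadamard_mul_self : hadamard * hadamard = 1 := by
  rw [hadamard, Matrix.smul_mul, Matrix.mul_smul, smul_smul, inv_sqrt_two_sq]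
  ext i j
  fin_cases i <;> fin_cases j <;> norm_num [Matrix.mul_apply, Fin.sum_univ_two]

theorem hadamard_conjTranspose : hadamard.conjTranspose = hadamard := by
  ext i j
  fin_cases i <;> fin_cases j <;> simp [hadamard, Matrix.conjTranspose_apply]

theorem hadamard_mul_rotPauli (P : Fin 3) : hadamard * rotPauli P * hadamard = pauli P := by
  rw [hadamard, Matrix.smul_mul, Matrix.smul_mul, Matrix.mul_smul, smul_smul, inv_sqrt_two_sq]
  ext i j
  fin_cases P <;> fin_cases i <;> fin_cases j <;>
    simp [rotPauli, pauli, pauliX, pauliY, pauliZ] <;> ring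

/-- The signs of the three terms of `a XX - YY - ZZ`. -/
def coef (a : ℝ) : Fin 3 → ℂ := ![(a : ℂ), -1, -1]

/-- The star Hamiltonian on four qubits, up to a shift. -/
def starHam (p : Fin 3 → Matrix (Fin 2) (Fin 2) ℂ) (a s : ℝ) : Matrix Cube Cube ℂ :=
  (∑ P, coef a P • (site 0 (p P) * (site 1 (p P) + site 2 (p P) + site 3 (p P)))) +
    ((a + 2 * s : ℝ) : ℂ) • 1

/-- A combination of single-qubit operators of the star, symmetric in the leaves. -/
def starOp (p : Fin 3 → Matrix (Fin 2) (Fin 2) ℂ) (w u : ℝ) (P : Fin 3) : Matrix Cube Cube ℂ :=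
  (w : ℂ) • site 0 (p P) + (u : ℂ) • (site 1 (p P) + site 2 (p P) + site 3 (p P))

/-- The eigenvalue of the Pauli `Z` matrix. -/
def zsign : Fin 2 → ℂ := ![1, -1]

/-- In the rotated frame -XX-YY exchanges the center with an opposite leaf with amplitude -2, and
aZZ is diagonal. Hamming weight is therefore conserved. -/
theorem starHam_rot_mul_apply {β : Type*} (a s : ℝ) (M : Matrix Cube β ℂ) (c i j k : Fin 2)
    (l : β) : (starHam rotPauli a s * M) ![c, i, j, k] l =
      ((a : ℂ) * zsign c * (zsign i + zsign j + zsign k) + a + 2 * s) * M ![c, i, j, k] l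
      - (if c = i then 0 else 2 * M ![i, c, j, k] l)
      - (if c = j then 0 else 2 * M ![j, i, c, k] l)
      - (if c = k then 0 else 2 * M ![k, i, j, c] l) := by
  simp only [starHam, Fin.sum_univ_three, add_mul, Matrix.add_mul, Matrix.smul_mul, Matrix.mul_add,
    Matrix.mul_assoc, Matrix.add_apply, Matrix.smul_apply, site_zero_mul_apply,
    site_one_mul_apply, site_two_mul_apply, site_three_mul_apply, Matrix.one_mul, smul_eq_mul]
  simp only [coef, rotPauli, pauliX, pauliY, pauliZ, zsign]
  revert c i j k
  simp only [Fin.forall_fin_two]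
  refine ⟨⟨⟨⟨?_, ?_⟩, ⟨?_, ?_⟩⟩, ⟨⟨?_, ?_⟩, ⟨?_, ?_⟩⟩⟩, ⟨⟨⟨?_, ?_⟩, ⟨?_, ?_⟩⟩, ⟨⟨?_, ?_⟩, ⟨?_, ?_⟩⟩⟩⟩ <;>
  · simp
    ring_nf
    simp only [Complex.I_sq]
    ring

end Frames

/-! ### Ground states and reachable excited states of one star. -/

section RotatedGround

open Matrix Function

/-- `p |1000⟩ + q (|0100⟩ + |0010⟩ + |0001⟩)`. -/
def upTab (p q : ℂ) : Fin 2 → Fin 2 → Fin 2 → Fin 2 → ℂ :=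
  ![![![![0, q], ![q, 0]], ![![q, 0], ![0, 0]]], ![![![p, 0], ![0, 0]], ![![0, 0], ![0, 0]]]]

/-- `p |0111⟩ + q (|1011⟩ + |1101⟩ + |1110⟩)`. -/
def downTab (p q : ℂ) : Fin 2 → Fin 2 → Fin 2 → Fin 2 → ℂ :=
  ![![![![0, 0], ![0, 0]], ![![0, 0], ![0, p]]], ![![![0, 0], ![0, q]], ![![0, q], ![q, 0]]]]

/-- The vector with value `p` on strings of weight two with center `0` and `q` on strings of
weight two with center `1`. -/
def midTab (p q : ℂ) : Fin 2 → Fin 2 → Fin 2 → Fin 2 → ℂ :=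
  ![![![![0, 0], ![0, p]], ![![0, p], ![p, 0]]], ![![![0, q], ![q, 0]], ![![q, 0], ![0, 0]]]]

/-- `p |0000⟩ + q |1111⟩`. -/
def endTab (p q : ℂ) : Fin 2 → Fin 2 → Fin 2 → Fin 2 → ℂ :=
  ![![![![p, 0], ![0, 0]], ![![0, 0], ![0, 0]]], ![![![0, 0], ![0, 0]], ![![0, 0], ![0, q]]]]

/-- The unnormalized ground states of the star in the rotated frame. -/
def rotGround (r : ℝ) : Matrix Cube (Fin 2) ℂ :=
  cubeMat fun c i j k => ![upTab r 1 c i j k, downTab r 1 c i j k]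

/-- The excited eigenvectors of the star reached from the ground states by `starOp`. -/
def rotExc (r : ℝ) : Matrix Cube (Fin 6) ℂ :=
  cubeMat fun c i j k => ![midTab 1 1 c i j k, midTab (-1) 1 c i j k, endTab 1 0 c i j k,
    endTab 0 1 c i j k, upTab (-3) r c i j k, downTab (-3) r c i j k]

/-- The excitation energies. -/
def excEnergy (a s : ℝ) : Fin 6 → ℝ :=
  ![2 * s - 4, 2 * s + 4, 4 * a + 2 * s, 4 * a + 2 * s, 4 * s, 4 * s]

/-- The squared norms of the columns of `rotExc`. -/
def excNorm (r : ℝ) : Fin 6 → ℝ := ![6, 6, 1, 1, 9 + 3 * r ^ 2, 9 + 3 * r ^ 2]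

/-- The coefficients of `starOp` applied to the ground states. -/
def excCoef (r : ℝ) (P : Fin 3) : Matrix (Fin 6) (Fin 2) ℂ :=
  let bS : ℂ := (r ^ 3 + 5 * r ^ 2 - 3 * r - 3) / 2
  let bA : ℂ := (r ^ 3 + r ^ 2 - 3 * r + 9) / 2
  let b4 : ℂ := 3 * r ^ 3 + 3 * r ^ 2 + 3 * r - 9
  let I := Complex.I
  Matrix.of fun σ l => ![
    ![![0, 0], ![0, 0], ![0, 0], ![0, 0], ![4 * (r : ℂ), 0], ![0, -4 * (r : ℂ)]] σ l,
    ![![-I * bS, I * bS], ![-I * bA, -I * bA], ![I * b4, 0], ![0, -I * b4], ![0, 0], ![0, 0]] σ l,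
    ![![bS, bS], ![bA, -bA], ![b4, 0], ![0, b4], ![0, 0], ![0, 0]] σ l] P

theorem rotGround_gram (r : ℝ) :
    (rotGround r)ᴴ * rotGround r = ((r ^ 2 + 3 : ℝ) : ℂ) • 1 := by
  ext l l'
  rw [Matrix.mul_apply, sum_cube]
  fin_cases l <;> fin_cases l' <;>
  · simp [rotGround, cubeMat_apply, upTab, downTab, Matrix.conjTranspose_apply, Fin.sum_univ_two]
    try ring

set_option maxHeartbeats 1000000 in
theorem rotExc_gram (r : ℝ) :
    (rotExc r)ᴴ * rotExc r = Matrix.diagonal fun σ => (excNorm r σ : ℂ) := by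
  have h3 : (starRingEnd ℂ) 3 = 3 := Complex.conj_ofNat 3
  ext l l'
  rw [Matrix.mul_apply, sum_cube]
  fin_cases l <;> fin_cases l' <;>
  · simp [rotExc, cubeMat_apply, upTab, downTab, midTab, endTab, excNorm,
      Matrix.conjTranspose_apply, Fin.sum_univ_two, h3]
    try ring

/-- On the leaf-symmetric vectors of weight one the Hamiltonian is a 2 × 2 matrix. The condition on
r is its eigenvalue equation, and s = r - a makes the shift a + 2s cancel the eigenvalue. Weight
three is the mirror image under flipping all bits. -/
theorem starHam_mul_rotGround {a r s : ℝ} (hr : r * (r - 2 * a) = 3) (hs : s = r - a) :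
    starHam rotPauli a s * rotGround r = 0 := by
  have h : (r : ℂ) * (r - 2 * a) = 3 := by exact_mod_cast hr
  refine cube_ext fun c i j k l => ?_
  rw [starHam_rot_mul_apply, hs]
  revert c i j k l
  simp only [Fin.forall_fin_two]
  refine ⟨⟨⟨⟨?_, ?_⟩, ⟨?_, ?_⟩⟩, ⟨⟨?_, ?_⟩, ⟨?_, ?_⟩⟩⟩, ⟨⟨⟨?_, ?_⟩, ⟨?_, ?_⟩⟩, ⟨⟨?_, ?_⟩, ⟨?_, ?_⟩⟩⟩⟩ <;>
  · simp only [rotGround, cubeMat_apply]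
    simp [upTab, downTab, zsign]
    try first
      | ring1
      | linear_combination 2 * h

theorem starHam_mul_rotExc {a r s : ℝ} (hr : r * (r - 2 * a) = 3) (hs : s = r - a) :
    starHam rotPauli a s * rotExc r =
      rotExc r * Matrix.diagonal fun σ => (excEnergy a s σ : ℂ) := by
  have h : (r : ℂ) * (r - 2 * a) = 3 := by exact_mod_cast hr
  refine cube_ext fun c i j k l => ?_
  rw [starHam_rot_mul_apply, Matrix.mul_diagonal, hs]
  revert c i j k
  simp only [Fin.forall_fin_two]
  refine ⟨⟨⟨⟨?_, ?_⟩, ⟨?_, ?_⟩⟩, ⟨⟨?_, ?_⟩, ⟨?_, ?_⟩⟩⟩, ⟨⟨⟨?_, ?_⟩, ⟨?_, ?_⟩⟩, ⟨⟨?_, ?_⟩, ⟨?_, ?_⟩⟩⟩⟩ <;>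
  · simp only [rotExc, cubeMat_apply]
    fin_cases l <;>
    · simp [upTab, downTab, midTab, endTab, zsign, excEnergy]
      try first
        | ring1
        | linear_combination 2 * h
        | linear_combination (-2) * h

/-- The weights 3(r²+1) on the center and r²-3 on the leaves balance the polarizations of
`rotGround_center` and `rotGround_leaf`. The ground-space component cancels, leaving only the six
excited columns. -/
theorem starOp_mul_rotGround (r : ℝ) (P : Fin 3) :
    starOp rotPauli (3 * (r ^ 2 + 1)) (r ^ 2 - 3) P * rotGround r = rotExc r * excCoef r P := by
  refine cube_ext fun c i j k l => ?_
  simp only [starOp, Matrix.add_mul, Matrix.smul_mul, Matrix.add_apply, Matrix.smul_apply,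
    site_zero_mul_apply, site_one_mul_apply, site_two_mul_apply, site_three_mul_apply]
  rw [Matrix.mul_apply, Fin.sum_univ_six]
  simp only [rotGround, rotExc, cubeMat_apply]
  revert c i j k
  simp only [Fin.forall_fin_two]
  refine ⟨⟨⟨⟨?_, ?_⟩, ⟨?_, ?_⟩⟩, ⟨⟨?_, ?_⟩, ⟨?_, ?_⟩⟩⟩, ⟨⟨⟨?_, ?_⟩, ⟨?_, ?_⟩⟩, ⟨⟨?_, ?_⟩, ⟨?_, ?_⟩⟩⟩⟩ <;>
  · fin_cases P <;> fin_cases l <;>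
    · simp [upTab, downTab, midTab, endTab, rotPauli, pauliX, pauliY, pauliZ, excCoef]
      try ring

/-- The operators for P ≠ 0 change the weight by one, while the ground states have weights one and
three, so only P = 0 survives. For r² > 3 the sign is opposite to that of a leaf, which later gives
XX with both signs. -/
theorem rotGround_center (r : ℝ) (P : Fin 3) :
    (rotGround r)ᴴ * (site (0 : Fin 4) (rotPauli P) * rotGround r) =
      if P = 0 then ((-(r ^ 2 - 3) : ℝ) : ℂ) • pauliZ else 0 := by
  ext l l'
  rw [Matrix.mul_apply, sum_cube]
  fin_cases P <;> fin_cases l <;> fin_cases l' <;>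
  · simp [rotGround, cubeMat_apply, upTab, downTab, Matrix.conjTranspose_apply, Fin.sum_univ_two,
      site_zero_mul_apply, rotPauli, pauliX, pauliY, pauliZ]
    try ring

theorem rotGround_leaf (r : ℝ) (P : Fin 3) :
    (rotGround r)ᴴ * (site (1 : Fin 4) (rotPauli P) * rotGround r) =
      if P = 0 then ((r ^ 2 + 1 : ℝ) : ℂ) • pauliZ else 0 := by
  ext l l'
  rw [Matrix.mul_apply, sum_cube]
  fin_cases P <;> fin_cases l <;> fin_cases l' <;>
  · simp [rotGround, cubeMat_apply, upTab, downTab, Matrix.conjTranspose_apply, Fin.sum_univ_two,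
      site_one_mul_apply, rotPauli, pauliX, pauliY, pauliZ]
    try ring

end RotatedGround

/-! ### Spectral gap of one star. -/

section RotatedGap

open Matrix Function
open scoped ComplexOrder

theorem site_comm {ι α : Type*} [Fintype ι] [DecidableEq ι] [Fintype α] [DecidableEq α] {i j : ι}
    (hij : i ≠ j) (A B : Matrix α α ℂ) : site i A * site j B = site j B * site i A := by
  rw [site_mul_site_eq_duo hij, site_mul_site_eq_duo hij.symm, duo, duo, update_comm hij]

theorem starHam_isHermitian {p : Fin 3 → Matrix (Fin 2) (Fin 2) ℂ} (hp : ∀ P, (p P)ᴴ = p P)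
    (a s : ℝ) : (starHam p a s).IsHermitian := by
  have h0 : ∀ P, star (coef a P) = coef a P := by
    intro P
    fin_cases P <;> simp [coef]
  have h1 : ∀ (P : Fin 3) (q : Fin 4), q ≠ 0 →
      (site 0 (p P) * site q (p P))ᴴ = site 0 (p P) * site q (p P) := by
    intro P q hq
    rw [Matrix.conjTranspose_mul, site_conjTranspose, site_conjTranspose, hp, site_comm hq]
  rw [Matrix.IsHermitian, starHam, Matrix.conjTranspose_add, Matrix.conjTranspose_sum]
  congr 1
  · refine Finset.sum_congr rfl fun P _ => ?_
    rw [Matrix.conjTranspose_smul, h0]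
    simp only [Matrix.mul_add, Matrix.conjTranspose_add]
    rw [h1 P 1 (by decide), h1 P 2 (by decide), h1 P 3 (by decide)]
  · simp

/-- Sum-of-squares certificate for the weight-one sector, with d the amplitude of the excited center
and w₁, w₂, w₃ those of the leaves. Capital letters stand for the conjugates, treated as independent
variables. -/
theorem star_block_identity {r κ g : ℂ} (hr : r ≠ 0) (hκ : κ * (r ^ 2 + 3) = 1)
    (d w₁ w₂ w₃ D W₁ W₂ W₃ : ℂ) :
    6 * r⁻¹ * (D * d) + 2 * r * (W₁ * w₁ + W₂ * w₂ + W₃ * w₃)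
      - 2 * (D * (w₁ + w₂ + w₃) + (W₁ + W₂ + W₃) * d)
      - g * (D * d + W₁ * w₁ + W₂ * w₂ + W₃ * w₃
        - κ * ((r * D + (W₁ + W₂ + W₃)) * (r * d + (w₁ + w₂ + w₃)))) =
    (2 * r - g) * ((W₁ - r⁻¹ * D) * (w₁ - r⁻¹ * d) + (W₂ - r⁻¹ * D) * (w₂ - r⁻¹ * d)
        + (W₃ - r⁻¹ * D) * (w₃ - r⁻¹ * d))
      + g * κ * ((W₁ + W₂ + W₃ - 3 * r⁻¹ * D) * (w₁ + w₂ + w₃ - 3 * r⁻¹ * d)) := by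
  have h3 : r ^ 2 + 3 ≠ 0 := by
    intro h
    rw [h, mul_zero] at hκ
    exact zero_ne_one hκ
  have : κ = (r ^ 2 + 3)⁻¹ := eq_inv_of_mul_eq_one_left hκ
  rw [this]
  field_simp
  ring

/-- The form splits by Hamming weight. Weights one and three are covered by `star_block_identity`,
weights zero and four have energy 4a + 2s, and weight two is a hopping problem with lowest energy 2s
- 4. -/
theorem star_gap_quadratic {r κ : ℝ} (hr : 3 < r) (hκ : κ * (r ^ 2 + 3) = 1) {a s g : ℝ}
    (hra : r * (r - 2 * a) = 3) (hs : s = r - a) (hg0 : 0 ≤ g) (hg : g ≤ 2 * s - 4) (ha : 0 < a)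
    (x : Cube → ℂ) :
    0 ≤ star x ⬝ᵥ ((starHam rotPauli a s - (g : ℂ) •
      (1 - (κ : ℂ) • (rotGround r * (rotGround r)ᴴ))) *ᵥ x) := by
  have hr0 : (r : ℂ) ≠ 0 := by
    have : r ≠ 0 := by linarith
    exact_mod_cast this
  have hκc : (κ : ℂ) * ((r : ℂ) ^ 2 + 3) = 1 := by exact_mod_cast hκ
  have hκ0 : 0 < κ := by
    have h1 : 0 < r ^ 2 + 3 := by positivity
    by_contra h
    nlinarith
  have hac : (a : ℂ) = (r - 3 * (r : ℂ)⁻¹) / 2 := by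
    have h : (r : ℂ) * (r - 2 * a) = 3 := by exact_mod_cast hra
    field_simp
    linear_combination -h
  have hsc : (s : ℂ) = (r + 3 * (r : ℂ)⁻¹) / 2 := by
    have : (s : ℂ) = r - a := by exact_mod_cast hs
    rw [this, hac]; ring
  have hK : ∀ c i j k, (starHam rotPauli a s *ᵥ x) ![c, i, j, k] =
      ((a : ℂ) * zsign c * (zsign i + zsign j + zsign k) + a + 2 * s) * x ![c, i, j, k]
      - (if c = i then 0 else 2 * x ![i, c, j, k])
      - (if c = j then 0 else 2 * x ![j, i, c, k])
      - (if c = k then 0 else 2 * x ![k, i, j, c]) := by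
    intro c i j k
    have h := starHam_rot_mul_apply a s (Matrix.replicateCol Unit x) c i j k ()
    rw [← Matrix.replicateCol_mulVec] at h
    simpa using h
  have hz0 : ((rotGround r)ᴴ *ᵥ x) 0 = r * x ![1, 0, 0, 0] +
      (x ![0, 1, 0, 0] + x ![0, 0, 1, 0] + x ![0, 0, 0, 1]) := by
    rw [Matrix.mulVec, dotProduct, sum_cube]
    simp [rotGround, cubeMat_apply, upTab, downTab, Matrix.conjTranspose_apply, Fin.sum_univ_two]
    ring
  have hz1 : ((rotGround r)ᴴ *ᵥ x) 1 = r * x ![0, 1, 1, 1] +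
      (x ![1, 0, 1, 1] + x ![1, 1, 0, 1] + x ![1, 1, 1, 0]) := by
    rw [Matrix.mulVec, dotProduct, sum_cube]
    simp [rotGround, cubeMat_apply, upTab, downTab, Matrix.conjTranspose_apply, Fin.sum_univ_two]
    ring
  have hp : star x ⬝ᵥ ((rotGround r * (rotGround r)ᴴ) *ᵥ x) =
      star (((rotGround r)ᴴ *ᵥ x) 0) * ((rotGround r)ᴴ *ᵥ x) 0 +
      star (((rotGround r)ᴴ *ᵥ x) 1) * ((rotGround r)ᴴ *ᵥ x) 1 := by
    have h := Matrix.star_mulVec (rotGround r)ᴴ x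
    rw [Matrix.conjTranspose_conjTranspose] at h
    rw [← Matrix.mulVec_mulVec, Matrix.dotProduct_mulVec, ← h, dotProduct, Fin.sum_univ_two]
    rfl
  have hexp : star x ⬝ᵥ ((starHam rotPauli a s - (g : ℂ) •
      (1 - (κ : ℂ) • (rotGround r * (rotGround r)ᴴ))) *ᵥ x) =
      star x ⬝ᵥ (starHam rotPauli a s *ᵥ x) - g * (star x ⬝ᵥ x
        - κ * (star x ⬝ᵥ ((rotGround r * (rotGround r)ᴴ) *ᵥ x))) := by
    rw [Matrix.sub_mulVec, Matrix.smul_mulVec, Matrix.sub_mulVec, Matrix.smul_mulVec,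
      Matrix.one_mulVec, dotProduct_sub, dotProduct_smul, dotProduct_sub, dotProduct_smul,
      smul_eq_mul, smul_eq_mul]
  have hsq : ∀ (c : ℝ) (z : ℂ), 0 ≤ c → 0 ≤ (c : ℂ) * (star z * z) := fun c z hc =>
    mul_nonneg (by exact_mod_cast hc) (star_mul_self_nonneg z)
  have hblock : ∀ d w₁ w₂ w₃ : ℂ, 0 ≤ (2 * (r : ℂ) - g) *
      (star (w₁ - (r : ℂ)⁻¹ * d) * (w₁ - (r : ℂ)⁻¹ * d)
        + star (w₂ - (r : ℂ)⁻¹ * d) * (w₂ - (r : ℂ)⁻¹ * d)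
        + star (w₃ - (r : ℂ)⁻¹ * d) * (w₃ - (r : ℂ)⁻¹ * d))
      + g * κ * (star (w₁ + w₂ + w₃ - 3 * (r : ℂ)⁻¹ * d) * (w₁ + w₂ + w₃ - 3 * (r : ℂ)⁻¹ * d)) := by
    intro d w₁ w₂ w₃
    have h1 : 0 ≤ 2 * r - g := by nlinarith
    have h2 : 0 ≤ g * κ := by positivity
    have e1 : (2 * (r : ℂ) - g) = ((2 * r - g : ℝ) : ℂ) := by push_cast; ring
    have e2 : (g : ℂ) * κ = ((g * κ : ℝ) : ℂ) := by push_cast; ring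
    rw [e1, e2, mul_add, mul_add]
    exact add_nonneg (add_nonneg (add_nonneg (hsq _ _ h1) (hsq _ _ h1)) (hsq _ _ h1)) (hsq _ _ h2)
  -- The hops join the six weight-two strings into a hexagon, with p for center 1 and m for center
  -- 0. Each edge gives a square, and 2s - 4 - g remains on the diagonal.
  have hmid : ∀ p₁ p₂ p₃ m₁ m₂ m₃ : ℂ, 0 ≤ (2 : ℂ) * (star (p₁ - m₂) * (p₁ - m₂)
      + star (p₁ - m₃) * (p₁ - m₃) + star (p₂ - m₁) * (p₂ - m₁) + star (p₂ - m₃) * (p₂ - m₃)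
      + star (p₃ - m₁) * (p₃ - m₁) + star (p₃ - m₂) * (p₃ - m₂))
      + (2 * (s : ℂ) - 4 - g) * (star p₁ * p₁ + star p₂ * p₂ + star p₃ * p₃
        + star m₁ * m₁ + star m₂ * m₂ + star m₃ * m₃) := by
    intro p₁ p₂ p₃ m₁ m₂ m₃
    have h1 : 0 ≤ 2 * s - 4 - g := by linarith
    have e1 : (2 * (s : ℂ) - 4 - g) = ((2 * s - 4 - g : ℝ) : ℂ) := by push_cast; ring
    have hn := fun z : ℂ => star_mul_self_nonneg z
    rw [e1]
    refine add_nonneg (mul_nonneg (by norm_num) ?_) (mul_nonneg (by exact_mod_cast h1) ?_)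
    · exact add_nonneg (add_nonneg (add_nonneg (add_nonneg (add_nonneg (hn _) (hn _)) (hn _))
        (hn _)) (hn _)) (hn _)
    · exact add_nonneg (add_nonneg (add_nonneg (add_nonneg (add_nonneg (hn _) (hn _)) (hn _))
        (hn _)) (hn _)) (hn _)
  have hend : ∀ z : ℂ, 0 ≤ (4 * (a : ℂ) + 2 * s - g) * (star z * z) := by
    intro z
    have e1 : (4 * (a : ℂ) + 2 * s - g) = ((4 * a + 2 * s - g : ℝ) : ℂ) := by push_cast; ring
    rw [e1]
    exact hsq _ _ (by linarith)
  have hsum := add_nonneg (add_nonneg (add_nonneg (add_nonneg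
    (hblock (x ![1, 0, 0, 0]) (x ![0, 1, 0, 0]) (x ![0, 0, 1, 0]) (x ![0, 0, 0, 1]))
    (hblock (x ![0, 1, 1, 1]) (x ![1, 0, 1, 1]) (x ![1, 1, 0, 1]) (x ![1, 1, 1, 0])))
    (hmid (x ![1, 1, 0, 0]) (x ![1, 0, 1, 0]) (x ![1, 0, 0, 1])
      (x ![0, 0, 1, 1]) (x ![0, 1, 0, 1]) (x ![0, 1, 1, 0])))
    (hend (x ![0, 0, 0, 0]))) (hend (x ![1, 1, 1, 1]))
  refine le_of_le_of_eq hsum ?_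
  have hri : star ((r : ℂ)⁻¹) = (r : ℂ)⁻¹ := by simp
  have hrc : star (r : ℂ) = r := by simp
  have h3 : star (3 : ℂ) = 3 := by simp
  rw [hexp, hp, hz0, hz1, dotProduct, dotProduct, sum_cube, sum_cube]
  simp only [Fin.sum_univ_two, hK, Pi.star_apply, star_sub, star_add, star_mul', hri, hrc, h3]
  have b1 := star_block_identity hr0 hκc (g := g) (x ![1, 0, 0, 0]) (x ![0, 1, 0, 0])
    (x ![0, 0, 1, 0]) (x ![0, 0, 0, 1]) (star (x ![1, 0, 0, 0])) (star (x ![0, 1, 0, 0]))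
    (star (x ![0, 0, 1, 0])) (star (x ![0, 0, 0, 1]))
  have b2 := star_block_identity hr0 hκc (g := g) (x ![0, 1, 1, 1]) (x ![1, 0, 1, 1])
    (x ![1, 1, 0, 1]) (x ![1, 1, 1, 0]) (star (x ![0, 1, 1, 1])) (star (x ![1, 0, 1, 1]))
    (star (x ![1, 1, 0, 1])) (star (x ![1, 1, 1, 0]))
  rw [← b1, ← b2]
  simp only [zsign, Fin.isValue, Matrix.cons_val_zero, Matrix.cons_val_one, if_true,
    zero_ne_one, one_ne_zero, if_false, hac, hsc]
  ring

end RotatedGap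

/-! ### Second-order amplitudes of two coupled stars. -/

section SecondOrderPair

open Matrix Function

/-- The component of `starOp` applied to the ground states along the excited state `σ`. -/
def rotPart (r : ℝ) (P : Fin 3) (σ : Fin 6) : Matrix Cube (Fin 2) ℂ :=
  rotExc r * (Matrix.diagonal (Pi.single σ (1 : ℂ)) * excCoef r P)

theorem sum_rotPart (r : ℝ) (P : Fin 3) : ∑ σ, rotPart r P σ = rotExc r * excCoef r P := by
  simp only [rotPart]
  rw [← Matrix.mul_sum, ← Matrix.sum_mul]
  have : ∑ σ : Fin 6, Matrix.diagonal (Pi.single σ (1 : ℂ)) = 1 := by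
    ext i j
    rw [Matrix.sum_apply]
    rcases eq_or_ne i j with rfl | h
    · simp [Pi.single_apply]
    · simp [h]
  rw [this, Matrix.one_mul]

theorem starHam_mul_rotPart {a r s : ℝ} (hr : r * (r - 2 * a) = 3) (hs : s = r - a) (P : Fin 3)
    (σ : Fin 6) : starHam rotPauli a s * rotPart r P σ = (excEnergy a s σ : ℂ) • rotPart r P σ := by
  rw [rotPart, ← Matrix.mul_assoc, starHam_mul_rotExc hr hs, Matrix.mul_assoc,
    ← Matrix.mul_assoc (Matrix.diagonal _), Matrix.diagonal_mul_diagonal, ← Matrix.mul_smul,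
    ← Matrix.smul_mul]
  congr 2
  ext i j
  rcases eq_or_ne i j with rfl | h
  · rcases eq_or_ne i σ with rfl | h'
    · simp
    · simp [h']
  · simp [h]

theorem rotExc_coef_gram (r : ℝ) (P P' : Fin 3) (σ : Fin 6) (l l' : Fin 2) :
    ((rotExc r * excCoef r P)ᴴ * rotPart r P' σ) l l' =
      (excNorm r σ : ℂ) * (star (excCoef r P σ l) * excCoef r P' σ l') := by
  rw [rotPart, Matrix.conjTranspose_mul, Matrix.mul_assoc, ← Matrix.mul_assoc (rotExc r)ᴴ,
    rotExc_gram, ← Matrix.mul_assoc (Matrix.diagonal _), Matrix.diagonal_mul_diagonal,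
    Matrix.mul_apply, Finset.sum_eq_single σ]
  · rw [Matrix.diagonal_mul, Matrix.conjTranspose_apply]
    simp
    ring
  · intro τ _ hτ
    rw [Matrix.diagonal_mul]
    simp [hτ]
  · simp

/-- The two-site excitation amplitudes produced by the coupling. -/
def pairAmp (a r : ℝ) (σ τ : Fin 6) (l₁ l₂ : Fin 2) : ℂ :=
  ∑ P, coef a P * (excCoef r P σ l₁ * excCoef r P τ l₂)

/-- An explicit table for `pairAmp`. -/
def pairTab (bS bA b4 z : ℝ) : Fin 6 → Fin 6 → Fin 2 → Fin 2 → ℝ :=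
  let off : ℝ → ℝ → Fin 2 → Fin 2 → ℝ := fun p q => ![![0, p], ![q, 0]]
  let dia : ℝ → ℝ → Fin 2 → Fin 2 → ℝ := fun p q => ![![p, 0], ![0, q]]
  ![![off (-2 * bS ^ 2) (-2 * bS ^ 2), off (2 * bS * bA) (-2 * bS * bA), dia (-2 * bS * b4) 0,
      dia 0 (-2 * bS * b4), dia 0 0, dia 0 0],
    ![off (-2 * bS * bA) (2 * bS * bA), off (2 * bA ^ 2) (2 * bA ^ 2), dia (-2 * bA * b4) 0,
      dia 0 (2 * bA * b4), dia 0 0, dia 0 0],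
    ![dia (-2 * bS * b4) 0, dia (-2 * bA * b4) 0, dia 0 0, off (-2 * b4 ^ 2) 0, dia 0 0, dia 0 0],
    ![dia 0 (-2 * bS * b4), dia 0 (2 * bA * b4), off 0 (-2 * b4 ^ 2), dia 0 0, dia 0 0, dia 0 0],
    ![dia 0 0, dia 0 0, dia 0 0, dia 0 0, dia z 0, off (-z) 0],
    ![dia 0 0, dia 0 0, dia 0 0, dia 0 0, off 0 (-z), dia 0 z]]

-- The amplitudes are real because factors of I occur only for P = 1, and there in pairs. bS, bA and
-- b4 are, up to phase, the amplitudes towards the symmetric weight-two, antisymmetric weight-two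
-- and extreme-weight states; z comes from P = 0.
set_option maxHeartbeats 4000000 in
theorem pairAmp_eq (a r : ℝ) (σ τ : Fin 6) (l₁ l₂ : Fin 2) :
    pairAmp a r σ τ l₁ l₂ = (pairTab ((r ^ 3 + 5 * r ^ 2 - 3 * r - 3) / 2)
      ((r ^ 3 + r ^ 2 - 3 * r + 9) / 2) (3 * r ^ 3 + 3 * r ^ 2 + 3 * r - 9) (16 * a * r ^ 2)
      σ τ l₁ l₂ : ℂ) := by
  rw [pairAmp, Fin.sum_univ_three]
  fin_cases σ <;> fin_cases τ <;> fin_cases l₁ <;> fin_cases l₂ <;>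
  · simp [coef, excCoef, pairTab]
    try first
      | ring1
      | (ring_nf; simp only [Complex.I_sq]; ring1)

-- A and B are the diagonal entries for equal and for opposite logical bits. The only off-diagonal
-- entries exchange 01 and 10 and equal 2d, matching the entry 2 of XX + YY. The hypotheses on t
-- encode the degeneracies of the excited levels and the symmetry of the pair.
set_option maxHeartbeats 1000000 in
theorem sum_pairTab (bS bA b4 z : ℝ) (t : Fin 6 → Fin 6 → ℝ) (h10 : t 1 0 = t 0 1)
    (h20 : t 2 0 = t 0 2) (h30 : t 3 0 = t 0 2) (h03 : t 0 3 = t 0 2) (h21 : t 2 1 = t 1 2)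
    (h31 : t 3 1 = t 1 2) (h13 : t 1 3 = t 1 2) (h32 : t 3 2 = t 2 3) (h54 : t 5 4 = t 4 4)
    (h45 : t 4 5 = t 4 4) (h55 : t 5 5 = t 4 4) {A B d : ℝ}
    (hA : A = 8 * t 0 2 * bS ^ 2 * b4 ^ 2 + 8 * t 1 2 * bA ^ 2 * b4 ^ 2 + t 4 4 * z ^ 2)
    (hB : B = 4 * t 0 0 * bS ^ 4 + 4 * t 1 1 * bA ^ 4 + 8 * t 0 1 * bS ^ 2 * bA ^ 2
      + 4 * t 2 3 * b4 ^ 4 + t 4 4 * z ^ 2)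
    (hd : d = 2 * t 0 0 * bS ^ 4 + 2 * t 1 1 * bA ^ 4 - 4 * t 0 1 * bS ^ 2 * bA ^ 2)
    (l₁ l₂ l₁' l₂' : Fin 2) :
    ((∑ σ, ∑ τ, t σ τ * (pairTab bS bA b4 z σ τ l₁ l₂ * pairTab bS bA b4 z σ τ l₁' l₂') : ℝ) : ℂ)
      = ((((A + B) / 2 : ℝ) : ℂ) • (1 : TwoLocal) + (((A - B) / 2 : ℝ) : ℂ) • (pauliZ ⊗ₖ pauliZ)
        + (d : ℂ) • (pauliX ⊗ₖ pauliX + pauliY ⊗ₖ pauliY)) (l₁, l₂) (l₁', l₂') := by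
  simp only [Fin.sum_univ_six, h10, h20, h30, h03, h21, h31, h13, h32, h54, h45, h55, hA, hB, hd]
  fin_cases l₁ <;> fin_cases l₂ <;> fin_cases l₁' <;> fin_cases l₂' <;>
  · simp [pairTab, pauliX, pauliY, pauliZ]
    try ring1

end SecondOrderPair

/-! ### Assembly of the star gadget in the original frame. -/

section Gadget

open Matrix Function
open scoped ComplexOrder

/-- The Hadamard rotation of a block of four qubits. -/
def cubeRot : Matrix Cube Cube ℂ := tens fun _ : Fin 4 => hadamard

theorem cubeRot_mul_self : cubeRot * cubeRot = 1 := by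
  rw [cubeRot, tens_mul]
  simp only [hadamard_mul_self]
  exact tens_one

theorem cubeRot_conjTranspose : cubeRotᴴ = cubeRot := by
  rw [cubeRot, tens_conjTranspose]
  simp only [hadamard_conjTranspose]

theorem pauli_mul_hadamard (P : Fin 3) : pauli P * hadamard = hadamard * rotPauli P := by
  rw [← hadamard_mul_rotPauli, Matrix.mul_assoc, Matrix.mul_assoc, hadamard_mul_self,
    Matrix.mul_one]

theorem pauli_conjTranspose (P : Fin 3) : (pauli P)ᴴ = pauli P := by
  ext i j
  fin_cases P <;> fin_cases i <;> fin_cases j <;>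
    simp [pauli, pauliX, pauliY, pauliZ, Matrix.conjTranspose_apply]

theorem rotPauli_conjTranspose (P : Fin 3) : (rotPauli P)ᴴ = rotPauli P := by
  ext i j
  fin_cases P <;> fin_cases i <;> fin_cases j <;>
    simp [rotPauli, pauliX, pauliY, pauliZ, Matrix.conjTranspose_apply]

theorem site_pauli_mul_cubeRot (q : Fin 4) (P : Fin 3) :
    site q (pauli P) * cubeRot = cubeRot * site q (rotPauli P) := by
  rw [cubeRot, site_mul_tens, pauli_mul_hadamard, site, tens_mul]
  congr 1
  funext k
  rcases eq_or_ne k q with rfl | h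
  · simp
  · simp [h]

theorem starOp_mul_cubeRot (w u : ℝ) (P : Fin 3) :
    starOp pauli w u P * cubeRot = cubeRot * starOp rotPauli w u P := by
  simp only [starOp, Matrix.add_mul, Matrix.mul_add, Matrix.smul_mul, Matrix.mul_smul,
    site_pauli_mul_cubeRot]

theorem starHam_mul_cubeRot (a s : ℝ) :
    starHam pauli a s * cubeRot = cubeRot * starHam rotPauli a s := by
  simp only [starHam, Matrix.add_mul, Matrix.mul_add, Matrix.smul_mul, Matrix.mul_smul,
    Matrix.sum_mul, Matrix.mul_sum, Matrix.one_mul, Matrix.mul_one, Matrix.mul_assoc,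
    site_pauli_mul_cubeRot]
  simp only [← Matrix.mul_assoc, site_pauli_mul_cubeRot]

theorem hadamard_mul_pauliZ : hadamard * (pauliZ * hadamard) = pauliX := by
  rw [← Matrix.mul_assoc]; exact hadamard_mul_rotPauli 0

/-- Ground states, excitations and couplings of a four-qubit star. -/
structure StarGadget (a : ℝ) where
  v : Matrix Cube (Fin 2) ℂ
  y : Fin 3 → Fin 6 → Matrix Cube (Fin 2) ℂ
  e : Fin 6 → ℝ
  (s w u g x₀ x₁ c₀ c₁ d : ℝ)
  s_pos : 0 < s
  w_pos : 0 < w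
  u_pos : 0 < u
  g_pos : 0 < g
  x₀_pos : 0 < x₀
  x₁_pos : 0 < x₁
  d_pos : 0 < d
  g_le : g ≤ 1
  e_pos : ∀ σ, 0 < e σ
  gram : vᴴ * v = 1
  ground : starHam pauli a s * v = 0
  gap : (starHam pauli a s - (g : ℂ) • (1 - v * vᴴ)).PosSemidef
  center : ∀ P, vᴴ * (site (0 : Fin 4) (pauli P) * v) =
    if P = 0 then ((-x₀ : ℝ) : ℂ) • pauliX else 0
  leaf : ∀ P, vᴴ * (site (1 : Fin 4) (pauli P) * v) = if P = 0 then (x₁ : ℂ) • pauliX else 0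
  coupling : ∀ P, starOp pauli w u P * v = ∑ σ, y P σ
  excited : ∀ P σ, starHam pauli a s * y P σ = (e σ : ℂ) • y P σ
  -- The matrix of VH₀⁻¹V on one pair of stars, both being excited in the intermediate state.
  -- Perturbation theory subtracts it, so d > 0 gives -YY-ZZ a positive weight.
  second_order : ∑ P, ∑ P', ∑ σ, ∑ τ, (coef a P * coef a P' * ((e σ + e τ : ℝ) : ℂ)⁻¹) •
      (((starOp pauli w u P * v)ᴴ * y P' σ) ⊗ₖ ((starOp pauli w u P * v)ᴴ * y P' τ)) =
    (c₀ : ℂ) • 1 + (c₁ : ℂ) • XX + (d : ℂ) • (YY + ZZ)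

/-- A strict AM–GM inequality. It gives d > 0: two-star states made from the weight-two levels p and
q have denominators 2p, 2q and p + q, and the mixed ones enter with a negative sign. -/
theorem hopping_pos {p q x y : ℝ} (hp : 0 < p) (hq : p < q) (hy : 0 < y) :
    0 < x ^ 2 / p + y ^ 2 / q - 4 * (x * y) / (p + q) := by
  have hq0 : 0 < q := hp.trans hq
  have : x ^ 2 / p + y ^ 2 / q - 4 * (x * y) / (p + q) =
      ((q * (p + q) * x - 2 * p * q * y) ^ 2 + y ^ 2 * (p * q * (q - p) ^ 2)) /
        (p * q ^ 2 * (p + q) ^ 2) := by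
    field_simp
    ring
  rw [this]
  have := sub_pos.mpr hq
  positivity

theorem star_coef (a : ℝ) (P : Fin 3) : star (coef a P) = coef a P := by
  fin_cases P <;> simp [coef]

/-- The second order weights. -/
def pairWeight (a r s : ℝ) (σ τ : Fin 6) : ℝ :=
  excNorm r σ * excNorm r τ / ((r ^ 2 + 3) ^ 2 * (excEnergy a s σ + excEnergy a s τ))

/-- Orthogonality of the excited states lets the sums over P and P' factor into a product of pair
amplitudes for each intermediate state. -/
theorem rot_second_order_apply (a r s κ : ℝ) (hκ : κ ^ 2 * (r ^ 2 + 3) = 1) (l₁ l₂ l₁' l₂' : Fin 2) :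
    (∑ P, ∑ P', ∑ σ, ∑ τ, (coef a P * coef a P' *
        ((excEnergy a s σ + excEnergy a s τ : ℝ) : ℂ)⁻¹) •
      (((κ ^ 2 : ℝ) : ℂ) • ((rotExc r * excCoef r P)ᴴ * rotPart r P' σ)) ⊗ₖ
        (((κ ^ 2 : ℝ) : ℂ) • ((rotExc r * excCoef r P)ᴴ * rotPart r P' τ))) (l₁, l₂) (l₁', l₂') =
    ∑ σ, ∑ τ, (pairWeight a r s σ τ : ℂ) *
      (star (pairAmp a r σ τ l₁ l₂) * pairAmp a r σ τ l₁' l₂') := by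
  have hκ' : κ ^ 2 = (r ^ 2 + 3)⁻¹ := by
    have : r ^ 2 + 3 ≠ 0 := by positivity
    field_simp
    linarith
  have h1 : ∀ P P' σ τ, ((coef a P * coef a P' *
        ((excEnergy a s σ + excEnergy a s τ : ℝ) : ℂ)⁻¹) •
      (((κ ^ 2 : ℝ) : ℂ) • ((rotExc r * excCoef r P)ᴴ * rotPart r P' σ)) ⊗ₖ
        (((κ ^ 2 : ℝ) : ℂ) • ((rotExc r * excCoef r P)ᴴ * rotPart r P' τ))) (l₁, l₂) (l₁', l₂') =
      (pairWeight a r s σ τ : ℂ) *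
        ((star (coef a P * (excCoef r P σ l₁ * excCoef r P τ l₂))) *
          (coef a P' * (excCoef r P' σ l₁' * excCoef r P' τ l₂'))) := by
    intro P P' σ τ
    rw [Matrix.smul_apply, Matrix.kroneckerMap_apply, Matrix.smul_apply, Matrix.smul_apply,
      rotExc_coef_gram, rotExc_coef_gram, pairWeight, hκ', star_mul', star_mul', star_coef]
    simp only [smul_eq_mul]
    push_cast
    rw [div_eq_mul_inv, mul_inv, ← inv_pow]
    ring
  simp only [Matrix.sum_apply, h1]
  have h2 : ∀ σ τ, (pairWeight a r s σ τ : ℂ) *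
      (star (pairAmp a r σ τ l₁ l₂) * pairAmp a r σ τ l₁' l₂') =
      ∑ P, ∑ P', (pairWeight a r s σ τ : ℂ) *
        ((star (coef a P * (excCoef r P σ l₁ * excCoef r P τ l₂))) *
          (coef a P' * (excCoef r P' σ l₁' * excCoef r P' τ l₂'))) := by
    intro σ τ
    rw [pairAmp, pairAmp, star_sum, Finset.sum_mul_sum, Finset.mul_sum]
    simp only [Finset.mul_sum]
  simp only [h2]
  calc _ = ∑ P, ∑ σ, ∑ P', ∑ τ, (pairWeight a r s σ τ : ℂ) *
        ((star (coef a P * (excCoef r P σ l₁ * excCoef r P τ l₂))) *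
          (coef a P' * (excCoef r P' σ l₁' * excCoef r P' τ l₂'))) :=
        Finset.sum_congr rfl fun P _ => Finset.sum_comm
    _ = ∑ σ, ∑ P, ∑ τ, ∑ P', (pairWeight a r s σ τ : ℂ) *
        ((star (coef a P * (excCoef r P σ l₁ * excCoef r P τ l₂))) *
          (coef a P' * (excCoef r P' σ l₁' * excCoef r P' τ l₂'))) := by
        rw [Finset.sum_comm]
        exact Finset.sum_congr rfl fun σ _ => Finset.sum_congr rfl fun P _ => Finset.sum_comm
    _ = _ := Finset.sum_congr rfl fun σ _ => Finset.sum_comm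

theorem hopping_weight_pos {a r s : ℝ} (hr : 0 < r ^ 3 + r ^ 2 - 3 * r + 9) (hs : 2 < s) (x : ℝ) :
    0 < 2 * pairWeight a r s 0 0 * x ^ 4
      + 2 * pairWeight a r s 1 1 * ((r ^ 3 + r ^ 2 - 3 * r + 9) / 2) ^ 4
      - 4 * pairWeight a r s 0 1 * x ^ 2 * ((r ^ 3 + r ^ 2 - 3 * r + 9) / 2) ^ 2 := by
  have hp : 0 < 2 * s - 4 := by linarith
  have hq : 2 * s - 4 < 2 * s + 4 := by linarith
  have h := hopping_pos (x := x ^ 2) (y := ((r ^ 3 + r ^ 2 - 3 * r + 9) / 2) ^ 2) hp hq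
    (by positivity)
  have hr2 : 0 < 36 / (r ^ 2 + 3) ^ 2 := by positivity
  refine lt_of_lt_of_eq (mul_pos hr2 h) ?_
  have h1 : pairWeight a r s 0 0 = 36 / (r ^ 2 + 3) ^ 2 * (1 / (2 * (2 * s - 4))) := by
    simp [pairWeight, excNorm, excEnergy]; field_simp; norm_num
  have h2 : pairWeight a r s 1 1 = 36 / (r ^ 2 + 3) ^ 2 * (1 / (2 * (2 * s + 4))) := by
    simp [pairWeight, excNorm, excEnergy]; field_simp; norm_num
  have h3 : pairWeight a r s 0 1 = 36 / (r ^ 2 + 3) ^ 2 * (1 / ((2 * s - 4) + (2 * s + 4))) := by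
    simp [pairWeight, excNorm, excEnergy]; field_simp; norm_num
  have hq0 : 2 * s + 4 ≠ 0 := by linarith
  rw [h1, h2, h3]
  field_simp

theorem rot_second_order {a r s κ : ℝ} (hκ : κ ^ 2 * (r ^ 2 + 3) = 1)
    (hr : 0 < r ^ 3 + r ^ 2 - 3 * r + 9) (hs : 2 < s) : ∃ c₀ c₁ d : ℝ, 0 < d ∧
    ∑ P, ∑ P', ∑ σ, ∑ τ, (coef a P * coef a P' *
        ((excEnergy a s σ + excEnergy a s τ : ℝ) : ℂ)⁻¹) •
      (((κ ^ 2 : ℝ) : ℂ) • ((rotExc r * excCoef r P)ᴴ * rotPart r P' σ)) ⊗ₖ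
        (((κ ^ 2 : ℝ) : ℂ) • ((rotExc r * excCoef r P)ᴴ * rotPart r P' τ)) =
    (c₀ : ℂ) • (1 : TwoLocal) + (c₁ : ℂ) • (pauliZ ⊗ₖ pauliZ)
      + (d : ℂ) • (pauliX ⊗ₖ pauliX + pauliY ⊗ₖ pauliY) := by
  obtain ⟨bS, hbS⟩ : ∃ bS, bS = (r ^ 3 + 5 * r ^ 2 - 3 * r - 3) / 2 := ⟨_, rfl⟩
  obtain ⟨bA, hbA⟩ : ∃ bA, bA = (r ^ 3 + r ^ 2 - 3 * r + 9) / 2 := ⟨_, rfl⟩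
  obtain ⟨b4, hb4⟩ : ∃ b4, b4 = 3 * r ^ 3 + 3 * r ^ 2 + 3 * r - 9 := ⟨_, rfl⟩
  obtain ⟨z, hz⟩ : ∃ z, z = 16 * a * r ^ 2 := ⟨_, rfl⟩
  obtain ⟨t, ht⟩ : ∃ t, t = pairWeight a r s := ⟨_, rfl⟩
  have hd := hopping_weight_pos (a := a) hr hs bS
  rw [← hbA, ← ht] at hd
  obtain ⟨A, hA⟩ : ∃ A, A = 8 * t 0 2 * bS ^ 2 * b4 ^ 2 + 8 * t 1 2 * bA ^ 2 * b4 ^ 2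
    + t 4 4 * z ^ 2 := ⟨_, rfl⟩
  obtain ⟨B, hB⟩ : ∃ B, B = 4 * t 0 0 * bS ^ 4 + 4 * t 1 1 * bA ^ 4 + 8 * t 0 1 * bS ^ 2 * bA ^ 2
      + 4 * t 2 3 * b4 ^ 4 + t 4 4 * z ^ 2 := ⟨_, rfl⟩
  refine ⟨(A + B) / 2, (A - B) / 2, _, hd, ?_⟩
  ext ⟨l₁, l₂⟩ ⟨l₁', l₂'⟩
  rw [rot_second_order_apply a r s κ hκ]
  refine Eq.trans ?_ (sum_pairTab bS bA b4 z t ?_ ?_ ?_ ?_ ?_ ?_ ?_ ?_ ?_ ?_ ?_ hA hB rfl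
    l₁ l₂ l₁' l₂')
  · simp only [pairAmp_eq, ← hbS, ← hbA, ← hb4, ← hz, ← ht]
    push_cast
    simp only [Complex.star_def, Complex.conj_ofReal]
  all_goals
    rw [ht]
    simp [pairWeight, excNorm, excEnergy, add_comm, mul_comm]

theorem starHam_gap {a r s κ g : ℝ} (hr : 3 < r) (hκ : κ * (r ^ 2 + 3) = 1)
    (hra : r * (r - 2 * a) = 3) (hs : s = r - a) (hg0 : 0 ≤ g) (hg : g ≤ 2 * s - 4) (ha : 0 < a) :
    (starHam rotPauli a s - (g : ℂ) •
      (1 - (κ : ℂ) • (rotGround r * (rotGround r)ᴴ))).PosSemidef := by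
  refine Matrix.PosSemidef.of_dotProduct_mulVec_nonneg ?_
    fun x => star_gap_quadratic hr hκ hra hs hg0 hg ha x
  have h1 := starHam_isHermitian rotPauli_conjTranspose a s
  rw [Matrix.IsHermitian] at h1 ⊢
  rw [Matrix.conjTranspose_sub, h1, Matrix.conjTranspose_smul, Matrix.conjTranspose_sub,
    Matrix.conjTranspose_smul, Matrix.conjTranspose_mul]
  simp

set_option maxHeartbeats 2000000 in
theorem exists_starGadget {a : ℝ} (ha : 1 < a) : Nonempty (StarGadget a) := by
  -- The hypothesis a > 1 is needed to get s > 2, that is, a positive gap 2s - 4.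
  obtain ⟨s, hs, hs2⟩ : ∃ s : ℝ, 2 < s ∧ s ^ 2 = a ^ 2 + 3 := by
    refine ⟨Real.sqrt (a ^ 2 + 3), ?_, Real.sq_sqrt (by positivity)⟩
    apply Real.lt_sqrt_of_sq_lt
    nlinarith
  obtain ⟨r, hr⟩ : ∃ r, r = a + s := ⟨_, rfl⟩
  have hr3 : 3 < r := by linarith
  have hra : r * (r - 2 * a) = 3 := by rw [hr]; linear_combination hs2
  have hsr : s = r - a := by linarith
  have hN : 0 < r ^ 2 + 3 := by positivity
  obtain ⟨κ, hκ⟩ : ∃ κ : ℝ, κ ^ 2 * (r ^ 2 + 3) = 1 := by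
    refine ⟨(Real.sqrt (r ^ 2 + 3))⁻¹, ?_⟩
    rw [inv_pow, Real.sq_sqrt hN.le, inv_mul_cancel₀ hN.ne']
  have hbA : 0 < r ^ 3 + r ^ 2 - 3 * r + 9 := by nlinarith [sq_nonneg r, mul_pos (by linarith : 0 < r) (by nlinarith : 0 < r ^ 2 - 3)]
  obtain ⟨c₀, c₁, d, hd, hW⟩ := rot_second_order (a := a) hκ hbA hs
  have hκc : ((κ : ℂ)) * κ * ((r : ℂ) ^ 2 + 3) = 1 := by
    rw [← pow_two]; exact_mod_cast hκ
  have hg0 : 0 < min 1 (2 * s - 4) := lt_min one_pos (by linarith)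
  -- The Hadamard on the logical side undoes the rotation there too, so that the logical
  -- polarization is X instead of Z.
  obtain ⟨v, hv⟩ : ∃ v : Matrix Cube (Fin 2) ℂ, v = (κ : ℂ) • (cubeRot * (rotGround r * hadamard)) :=
    ⟨_, rfl⟩
  have hvH : vᴴ = (κ : ℂ) • (hadamard * ((rotGround r)ᴴ * cubeRot)) := by
    rw [hv, Matrix.conjTranspose_smul, Matrix.conjTranspose_mul, Matrix.conjTranspose_mul,
      cubeRot_conjTranspose, hadamard_conjTranspose, Matrix.mul_assoc]
    simp
  have hsand : ∀ A : Matrix Cube Cube ℂ, vᴴ * (cubeRot * (A * (cubeRot * v))) =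
      ((κ : ℂ) * κ) • (hadamard * (((rotGround r)ᴴ * (A * rotGround r)) * hadamard)) := by
    intro A
    rw [hvH, hv]
    simp only [Matrix.smul_mul, Matrix.mul_smul, smul_smul, Matrix.mul_assoc]
    simp only [← Matrix.mul_assoc cubeRot cubeRot, cubeRot_mul_self, Matrix.one_mul]
  have hsite : ∀ (q : Fin 4) P, vᴴ * (site q (pauli P) * v) = ((κ : ℂ) * κ) •
      (hadamard * (((rotGround r)ᴴ * (site q (rotPauli P) * rotGround r)) * hadamard)) := by
    intro q P
    rw [← hsand, ← Matrix.mul_assoc cubeRot, ← site_pauli_mul_cubeRot, Matrix.mul_assoc (site _ _),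
      ← Matrix.mul_assoc cubeRot, cubeRot_mul_self, Matrix.one_mul]
  have hcpl : ∀ P, starOp pauli (3 * (r ^ 2 + 1)) (r ^ 2 - 3) P * v =
      (κ : ℂ) • (cubeRot * (rotExc r * excCoef r P * hadamard)) := by
    intro P
    rw [hv, Matrix.mul_smul, ← Matrix.mul_assoc, starOp_mul_cubeRot, Matrix.mul_assoc cubeRot,
      ← Matrix.mul_assoc (starOp _ _ _ _), starOp_mul_rotGround]
  have hsq : hadamard * (1 * hadamard) = 1 := by rw [Matrix.one_mul, hadamard_mul_self]
  refine ⟨{ v := v, y := fun P σ => (κ : ℂ) • (cubeRot * (rotPart r P σ * hadamard)),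
            e := excEnergy a s, s := s, w := 3 * (r ^ 2 + 1), u := r ^ 2 - 3,
            g := min 1 (2 * s - 4), x₀ := κ ^ 2 * (r ^ 2 - 3), x₁ := κ ^ 2 * (r ^ 2 + 1),
            c₀ := c₀, c₁ := c₁, d := d, s_pos := by linarith, w_pos := by positivity,
            u_pos := by nlinarith, g_pos := hg0, x₀_pos := ?_, x₁_pos := ?_, d_pos := hd,
            g_le := min_le_left _ _, e_pos := ?_, gram := ?_, ground := ?_, gap := ?_,
            center := ?_, leaf := ?_, coupling := ?_, excited := ?_, second_order := ?_ }⟩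
  · have : κ ^ 2 ≠ 0 := by rintro h; rw [h] at hκ; norm_num at hκ
    have : 0 < r ^ 2 - 3 := by nlinarith
    positivity
  · have : κ ^ 2 ≠ 0 := by rintro h; rw [h] at hκ; norm_num at hκ
    positivity
  · intro σ
    fin_cases σ <;> simp [excEnergy] <;> linarith
  · have h := hsand 1
    simp only [Matrix.one_mul, rotGround_gram, ← Matrix.mul_assoc cubeRot cubeRot,
      cubeRot_mul_self] at h
    rw [h, Matrix.smul_mul, Matrix.mul_smul, hsq, smul_smul]
    push_cast
    rw [hκc, one_smul]
  · rw [hv, Matrix.mul_smul, ← Matrix.mul_assoc, starHam_mul_cubeRot, Matrix.mul_assoc cubeRot,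
      ← Matrix.mul_assoc (starHam _ _ _), starHam_mul_rotGround hra hsr]
    simp
  · have h1 := (starHam_gap hr3 hκ hra hsr hg0.le (min_le_right 1 _)
      (by linarith)).mul_mul_conjTranspose_same cubeRot
    have h2 : v * vᴴ = cubeRot * (((κ ^ 2 : ℝ) : ℂ) • (rotGround r * (rotGround r)ᴴ)) * cubeRot := by
      rw [hvH, hv]
      simp only [Matrix.smul_mul, Matrix.mul_smul, smul_smul, Matrix.mul_assoc]
      rw [← Matrix.mul_assoc hadamard hadamard, hadamard_mul_self, Matrix.one_mul]
      push_cast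
      rw [pow_two]
    have h3 : starHam pauli a s = cubeRot * starHam rotPauli a s * cubeRot := by
      rw [← starHam_mul_cubeRot, Matrix.mul_assoc, cubeRot_mul_self, Matrix.mul_one]
    have h4 : (1 : Matrix Cube Cube ℂ) = cubeRot * 1 * cubeRot := by
      rw [Matrix.mul_one, cubeRot_mul_self]
    rw [cubeRot_conjTranspose] at h1
    rw [h2, h3, h4]
    convert h1 using 1
    simp only [Matrix.mul_sub, Matrix.sub_mul, Matrix.mul_smul, Matrix.smul_mul]
  · intro P
    rw [hsite, rotGround_center]
    split_ifs
    · rw [Matrix.smul_mul, Matrix.mul_smul, hadamard_mul_pauliZ, smul_smul]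
      push_cast
      congr 1
      ring
    · simp
  · intro P
    rw [hsite, rotGround_leaf]
    split_ifs
    · rw [Matrix.smul_mul, Matrix.mul_smul, hadamard_mul_pauliZ, smul_smul]
      push_cast
      congr 1
      ring
    · simp
  · intro P
    rw [hcpl, ← sum_rotPart, Matrix.sum_mul, Matrix.mul_sum, Finset.smul_sum]
  · intro P σ
    rw [Matrix.mul_smul, ← Matrix.mul_assoc, starHam_mul_cubeRot, Matrix.mul_assoc cubeRot,
      ← Matrix.mul_assoc (starHam _ _ _), starHam_mul_rotPart hra hsr, Matrix.smul_mul,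
      Matrix.mul_smul, smul_comm]
  · have hT : ∀ P P' σ, (starOp pauli (3 * (r ^ 2 + 1)) (r ^ 2 - 3) P * v)ᴴ *
        ((κ : ℂ) • (cubeRot * (rotPart r P' σ * hadamard))) =
        hadamard * ((((κ ^ 2 : ℝ) : ℂ) • ((rotExc r * excCoef r P)ᴴ * rotPart r P' σ))) *
          hadamard := by
      intro P P' σ
      rw [hcpl, Matrix.conjTranspose_smul, Matrix.conjTranspose_mul, Matrix.conjTranspose_mul,
        cubeRot_conjTranspose, hadamard_conjTranspose]
      simp only [Matrix.smul_mul, Matrix.mul_smul, smul_smul, Matrix.mul_assoc]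
      rw [← Matrix.mul_assoc cubeRot cubeRot, cubeRot_mul_self, Matrix.one_mul]
      push_cast
      simp [pow_two]
    have hHH : (hadamard ⊗ₖ hadamard) * (hadamard ⊗ₖ hadamard) = (1 : TwoLocal) := by
      rw [← Matrix.mul_kronecker_mul, hadamard_mul_self, Matrix.one_kronecker_one]
    have hHP : ∀ P, (hadamard ⊗ₖ hadamard) * ((rotPauli P) ⊗ₖ (rotPauli P)) *
        (hadamard ⊗ₖ hadamard) = pauli P ⊗ₖ pauli P := by
      intro P
      rw [← Matrix.mul_kronecker_mul, ← Matrix.mul_kronecker_mul, hadamard_mul_rotPauli]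
    have h0 := hHP 0
    have h1 := hHP 1
    have h2 := hHP 2
    simp only [rotPauli, pauli, Matrix.cons_val] at h0 h1 h2
    have hneg : (-pauliY) ⊗ₖ (-pauliY) = pauliY ⊗ₖ pauliY := by
      ext i j; simp [Matrix.kroneckerMap_apply]
    rw [hneg] at h1
    have hW' := congrArg (fun M => (hadamard ⊗ₖ hadamard) * M * (hadamard ⊗ₖ hadamard)) hW
    simp only [Matrix.mul_add, Matrix.add_mul, Matrix.mul_sum, Matrix.sum_mul, Matrix.mul_smul,
      Matrix.smul_mul, h0, h1, h2, Matrix.mul_one, hHH] at hW'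
    simp only [hT, Matrix.mul_kronecker_mul]
    rw [hW', XX, YY, ZZ, add_comm (pauliZ ⊗ₖ pauliZ)]

end Gadget

/-! ### Two-qubit terms as products of local operators. -/

section OnPair

open Matrix Function

variable {n : ℕ}

theorem onPair_kronecker_eq_duo {i j : Fin n} (hij : i ≠ j) (A B : Matrix (Fin 2) (Fin 2) ℂ) :
    onPair (A ⊗ₖ B) i j = duo 1 i j A B := by
  ext x y
  rw [onPair, Matrix.of_apply, duo, tens_apply]
  split_ifs with h
  · rw [Finset.prod_eq_mul i j hij]
    · rw [duo_family_apply_left hij, update_self, Matrix.kroneckerMap_apply]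
    · intro k _ hk
      rw [duo_family_apply_of_ne hk.1 hk.2, h k hk.1 hk.2, Matrix.one_apply_eq]
    · simp
    · simp
  · push Not at h
    obtain ⟨k, hi, hj, hk⟩ := h
    rw [Finset.prod_eq_zero (Finset.mem_univ k)]
    rw [duo_family_apply_of_ne hi hj, Matrix.one_apply_ne hk]

theorem onPair_kronecker {i j : Fin n} (hij : i ≠ j) (A B : Matrix (Fin 2) (Fin 2) ℂ) :
    onPair (A ⊗ₖ B) i j = site i A * site j B := by
  rw [onPair_kronecker_eq_duo hij, site_mul_site_eq_duo hij]

theorem onPair_add (K L : TwoLocal) (i j : Fin n) :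
    onPair (K + L) i j = onPair K i j + onPair L i j := by
  ext x y
  simp only [onPair, Matrix.of_apply, Matrix.add_apply]
  split_ifs <;> simp

theorem onPair_smul (c : ℂ) (K : TwoLocal) (i j : Fin n) :
    onPair (c • K) i j = c • onPair K i j := by
  ext x y
  simp only [onPair, Matrix.of_apply, Matrix.smul_apply]
  split_ifs <;> simp

theorem onPair_neg (K : TwoLocal) (i j : Fin n) : onPair (-K) i j = -onPair K i j := by
  have := onPair_smul (-1) K i j
  simpa using this

theorem onPair_sub (K L : TwoLocal) (i j : Fin n) :
    onPair (K - L) i j = onPair K i j - onPair L i j := by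
  rw [sub_eq_add_neg, onPair_add, onPair_neg, sub_eq_add_neg]

theorem onPair_sum {κ : Type*} (s : Finset κ) (K : κ → TwoLocal) (i j : Fin n) :
    onPair (∑ k ∈ s, K k) i j = ∑ k ∈ s, onPair (K k) i j := by
  classical
  induction s using Finset.induction_on with
  | empty =>
    have := onPair_smul 0 0 i j
    simpa using this
  | insert k s hk ih => rw [Finset.sum_insert hk, onPair_add, ih, Finset.sum_insert hk]

theorem onPair_one {i j : Fin n} (hij : i ≠ j) : onPair 1 i j = 1 := by
  rw [← Matrix.one_kronecker_one, onPair_kronecker hij, site_one, site_one, Matrix.mul_one]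

theorem onPair_kronecker_self_comm (A : Matrix (Fin 2) (Fin 2) ℂ) (i j : Fin n) :
    onPair (A ⊗ₖ A) i j = onPair (A ⊗ₖ A) j i := by
  ext x y
  simp only [onPair, Matrix.of_apply, Matrix.kroneckerMap_apply]
  refine if_congr ⟨fun h k hj hi => h k hi hj, fun h k hi hj => h k hj hi⟩ (mul_comm _ _) rfl

/-- The interaction `a XX - YY - ZZ`. -/
def interaction (a : ℝ) : TwoLocal := (a : ℂ) • XX - YY - ZZ

theorem interaction_eq_sum (a : ℝ) : interaction a = ∑ P, coef a P • (pauli P ⊗ₖ pauli P) := by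
  rw [Fin.sum_univ_three, interaction, XX, YY, ZZ]
  simp [coef, pauli]
  abel

theorem onPair_interaction (a : ℝ) {i j : Fin n} (hij : i ≠ j) :
    onPair (interaction a) i j = ∑ P, coef a P • (site i (pauli P) * site j (pauli P)) := by
  rw [interaction_eq_sum, onPair_sum]
  simp only [onPair_smul, onPair_kronecker hij]

theorem pauli_mul_self (P : Fin 3) : pauli P * pauli P = 1 := by
  ext i j
  fin_cases P <;> fin_cases i <;> fin_cases j <;>
    simp [pauli, pauliX, pauliY, pauliZ]

theorem op_add (A B : Matrix (Fin n → Fin 2) (Fin n → Fin 2) ℂ) : op (A + B) = op A + op B :=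
  map_add _ _ _

theorem op_smul (c : ℂ) (A : Matrix (Fin n → Fin 2) (Fin n → Fin 2) ℂ) :
    op (c • A) = c • op A := map_smul (Matrix.toEuclideanCLM (𝕜 := ℂ)) c A

theorem op_sum {κ : Type*} (s : Finset κ) (A : κ → Matrix (Fin n → Fin 2) (Fin n → Fin 2) ℂ) :
    op (∑ k ∈ s, A k) = ∑ k ∈ s, op (A k) := map_sum _ _ _

theorem norm_op_one_le : ‖op (1 : Matrix (Fin n → Fin 2) (Fin n → Fin 2) ℂ)‖ ≤ 1 := by
  rw [op, map_one]
  exact ContinuousLinearMap.norm_id_le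

theorem norm_op_le_one {A : Matrix (Fin n → Fin 2) (Fin n → Fin 2) ℂ} (hA : Aᴴ * A = 1) :
    ‖op A‖ ≤ 1 := by
  have h : star (op A) * op A = op 1 := by
    rw [op, op, ← map_star, ← map_mul, Matrix.star_eq_conjTranspose, hA]
  have h1 := CStarRing.norm_star_mul_self (x := op A)
  rw [h] at h1
  have h2 := norm_op_one_le (n := n)
  rw [h1] at h2
  nlinarith [norm_nonneg (op A)]

theorem norm_op_site_mul_site_le (i j : Fin n) (P : Fin 3) :
    ‖op (site i (pauli P) * site j (pauli P))‖ ≤ 1 := by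
  apply norm_op_le_one
  rw [Matrix.conjTranspose_mul, site_conjTranspose, site_conjTranspose, pauli_conjTranspose,
    Matrix.mul_assoc, ← Matrix.mul_assoc (site i _), site_mul_site_same, pauli_mul_self, site_one,
    Matrix.one_mul, site_mul_site_same, pauli_mul_self, site_one]

theorem norm_op_interaction_le {a : ℝ} (ha : 0 < a) {i j : Fin n} (hij : i ≠ j) :
    ‖op (onPair (interaction a) i j)‖ ≤ a + 2 := by
  rw [onPair_interaction a hij, op_sum]
  simp only [op_smul]
  refine (norm_sum_le _ _).trans ?_
  have h : ∀ P, ‖coef a P • op (site i (pauli P) * site j (pauli P))‖ ≤ ‖coef a P‖ := by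
    intro P
    rw [norm_smul]
    exact mul_le_of_le_one_right (norm_nonneg _) (norm_op_site_mul_site_le i j P)
  refine (Finset.sum_le_sum fun P _ => h P).trans ?_
  rw [Fin.sum_univ_three]
  simp [coef, abs_of_pos ha]
  linarith

end OnPair

/-! ### Identification of 4n qubits with n stars. -/

section Blocks

open Matrix Function

variable {n : ℕ}

/-- Grouping `4 n` qubits into `n` blocks of four. -/
def blockEquiv (n : ℕ) : (Fin (n * 4) → Fin 2) ≃ (Fin n → Cube) where
  toFun x i q := x (finProdFinEquiv (i, q))
  invFun z k := z (finProdFinEquiv.symm k).1 (finProdFinEquiv.symm k).2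
  left_inv x := by
    funext k
    exact congrArg x (finProdFinEquiv.apply_symm_apply k)
  right_inv z := by
    funext i q
    simp only [Equiv.symm_apply_apply]

theorem site_blockEquiv (i : Fin n) (q : Fin 4) (A : Matrix (Fin 2) (Fin 2) ℂ) :
    site (finProdFinEquiv (i, q)) A =
      (site i (site q A)).submatrix (blockEquiv n) (blockEquiv n) := by
  ext x y
  have hiff : (∀ k, k ≠ finProdFinEquiv (i, q) → x k = y k) ↔
      (∀ k, k ≠ i → blockEquiv n x k = blockEquiv n y k) ∧
        ∀ k, k ≠ q → blockEquiv n x i k = blockEquiv n y i k := by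
    refine ⟨fun h => ⟨fun k hk => ?_, fun q' hq => ?_⟩, fun h k hk => ?_⟩
    · funext q'
      refine h _ fun h' => hk ?_
      exact (Prod.mk.inj (finProdFinEquiv.injective h')).1
    · refine h _ fun h' => hq ?_
      exact (Prod.mk.inj (finProdFinEquiv.injective h')).2
    · obtain ⟨⟨k, q'⟩, rfl⟩ := finProdFinEquiv.surjective k
      rcases eq_or_ne k i with rfl | hki
      · refine h.2 q' ?_
        rintro rfl
        exact hk rfl
      · exact congrFun (h.1 k hki) q'
  rw [Matrix.submatrix_apply, site_apply, site_apply, site_apply]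
  by_cases h : ∀ k, k ≠ finProdFinEquiv (i, q) → x k = y k
  · rw [if_pos h, if_pos (hiff.mp h).1, if_pos (hiff.mp h).2]
    rfl
  · rw [if_neg h]
    by_cases h1 : ∀ k, k ≠ i → blockEquiv n x k = blockEquiv n y k
    · rw [if_pos h1, if_neg fun h2 => h (hiff.mpr ⟨h1, h2⟩)]
    · rw [if_neg h1]

theorem onPair_interaction_blockEquiv (a : ℝ) {p p' : Fin n × Fin 4} (hp : p ≠ p') :
    onPair (interaction a) (finProdFinEquiv p) (finProdFinEquiv p') =
      (∑ P, coef a P • (site p.1 (site p.2 (pauli P)) * site p'.1 (site p'.2 (pauli P)))).submatrix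
        (blockEquiv n) (blockEquiv n) := by
  rw [onPair_interaction a (finProdFinEquiv.injective.ne hp)]
  obtain ⟨i, q⟩ := p
  obtain ⟨j, q'⟩ := p'
  ext x y
  rw [Matrix.submatrix_apply, Matrix.sum_apply, Matrix.sum_apply]
  refine Finset.sum_congr rfl fun P _ => ?_
  rw [site_blockEquiv, site_blockEquiv, Matrix.submatrix_mul_equiv, Matrix.smul_apply,
    Matrix.smul_apply, Matrix.submatrix_apply]

end Blocks

/-! ### Closure properties and norm bounds of Hamiltonians with positive weights. -/

section PlusHamiltonian

variable {n : ℕ} {S : Set TwoLocal}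

theorem IsPlusHamiltonian.mono {B C : ℕ} {H : Matrix (Fin n → Fin 2) (Fin n → Fin 2) ℂ}
    (h : IsPlusHamiltonian S n B H) (hBC : B ≤ C) : IsPlusHamiltonian S n C H := by
  obtain ⟨t, K, i, j, w, ht, hw, rfl⟩ := h
  have hBC' : (B : ℝ) ≤ C := by exact_mod_cast hBC
  exact ⟨t, K, i, j, w, ht.trans hBC,
    fun l => ⟨(hw l).1, (hw l).2.1, (hw l).2.2.1, (hw l).2.2.2.trans hBC'⟩, rfl⟩

theorem IsPlusHamiltonian.zero (B : ℕ) : IsPlusHamiltonian S n B 0 :=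
  ⟨0, Fin.elim0, Fin.elim0, Fin.elim0, Fin.elim0, Nat.zero_le _, fun l => l.elim0, by simp⟩

theorem IsPlusHamiltonian.add {B C : ℕ} {H H' : Matrix (Fin n → Fin 2) (Fin n → Fin 2) ℂ}
    (h : IsPlusHamiltonian S n B H) (h' : IsPlusHamiltonian S n C H') :
    IsPlusHamiltonian S n (B + C) (H + H') := by
  obtain ⟨t, K, i, j, w, ht, hw, rfl⟩ := h.mono (Nat.le_refl B)
  obtain ⟨t', K', i', j', w', ht', hw', rfl⟩ := h'.mono (Nat.le_refl C)
  refine ⟨t + t', Fin.append K K', Fin.append i i', Fin.append j j', Fin.append w w',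
    by omega, fun l => ?_, ?_⟩
  · push_cast
    refine Fin.addCases (fun l => ?_) (fun l => ?_) l
    · simp only [Fin.append_left]
      exact ⟨(hw l).1, (hw l).2.1, (hw l).2.2.1, (hw l).2.2.2.trans (by simp)⟩
    · simp only [Fin.append_right]
      exact ⟨(hw' l).1, (hw' l).2.1, (hw' l).2.2.1, (hw' l).2.2.2.trans (by simp)⟩
  · rw [Fin.sum_univ_add]
    simp

theorem IsPlusHamiltonian.sum {κ : Type*} (s : Finset κ) {B : ℕ}
    {H : κ → Matrix (Fin n → Fin 2) (Fin n → Fin 2) ℂ}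
    (h : ∀ k ∈ s, IsPlusHamiltonian S n B (H k)) :
    IsPlusHamiltonian S n (s.card * B) (∑ k ∈ s, H k) := by
  classical
  induction s using Finset.induction_on with
  | empty => simpa using IsPlusHamiltonian.zero 0
  | insert k s hk ih =>
    rw [Finset.sum_insert hk, Finset.card_insert_of_notMem hk, add_mul, one_mul, add_comm (_ * _)]
    exact (h k (Finset.mem_insert_self _ _)).add
      (ih fun l hl => h l (Finset.mem_insert_of_mem hl))

theorem IsPlusHamiltonian.sum_fin {k B : ℕ}
    {H : Fin k → Matrix (Fin n → Fin 2) (Fin n → Fin 2) ℂ}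
    (h : ∀ l, IsPlusHamiltonian S n B (H l)) : IsPlusHamiltonian S n (k * B) (∑ l, H l) := by
  simpa using IsPlusHamiltonian.sum Finset.univ fun l _ => h l

/-- Weight zero is allowed although terms need positive weights: the empty sum is used then. -/
theorem IsPlusHamiltonian.single {K : TwoLocal} (hK : K ∈ S) {i j : Fin n} (hij : i ≠ j) {w : ℝ}
    (hw : 0 ≤ w) {B : ℕ} (hB : 1 ≤ B) (hwB : w ≤ B) :
    IsPlusHamiltonian S n B ((w : ℂ) • onPair K i j) := by
  rcases hw.eq_or_lt with rfl | hw
  · simpa using IsPlusHamiltonian.zero B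
  · exact ⟨1, fun _ => K, fun _ => i, fun _ => j, fun _ => w, hB,
      fun _ => ⟨hK, hij, hw, hwB⟩, by simp⟩

theorem IsPlusHamiltonian.norm_op_le {a : ℝ} (ha : 0 < a) {B : ℕ}
    {H : Matrix (Fin n → Fin 2) (Fin n → Fin 2) ℂ}
    (h : IsPlusHamiltonian {interaction a} n B H) : ‖op H‖ ≤ (B : ℝ) ^ 2 * (a + 2) := by
  obtain ⟨t, K, i, j, w, ht, hw, rfl⟩ := h
  rw [op_sum]
  have h1 : ∀ l ∈ Finset.univ, ‖op ((w l : ℂ) • onPair (K l) (i l) (j l))‖ ≤ B * (a + 2) := by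
    intro l _
    obtain ⟨hK, hij, hw0, hwB⟩ := hw l
    rw [Set.mem_singleton_iff] at hK
    rw [hK, op_smul, norm_smul, Complex.norm_real, Real.norm_of_nonneg hw0.le]
    exact mul_le_mul hwB (norm_op_interaction_le ha hij) (norm_nonneg _) (Nat.cast_nonneg _)
  refine (norm_sum_le_of_le _ h1).trans ?_
  rw [Finset.sum_const, Finset.card_univ, Fintype.card_fin, nsmul_eq_mul, pow_two, mul_assoc]
  have : (t : ℝ) ≤ B := by exact_mod_cast ht
  gcongr

end PlusHamiltonian

/-! ### Perturbation data for n stars. -/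

namespace StarGadget

open Matrix Function
open scoped ComplexOrder

variable {a : ℝ} (G : StarGadget a) (n : ℕ)

/-- The operators coupling a star to the other stars. -/
def coupler (P : Fin 3) : Matrix Cube Cube ℂ := starOp pauli G.w G.u P

/-- The uncoupled stars. -/
def unpert : Matrix (Fin n → Cube) (Fin n → Cube) ℂ := ∑ i : Fin n, site i (starHam pauli a G.s)

/-- The encoding of each qubit in the ground space of a star. -/
def enc : Matrix (Fin n → Cube) (Fin n → Fin 2) ℂ := tens fun _ : Fin n => G.v

variable {n}

/-- The weak coupling of the stars, with weights `f`. -/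
def pert (s : Finset (Fin n × Fin n)) (f : Fin n × Fin n → ℝ) :
    Matrix (Fin n → Cube) (Fin n → Cube) ℂ :=
  ∑ p ∈ s, (f p : ℂ) • ∑ P, coef a P • (site p.1 (G.coupler P) * site p.2 (G.coupler P))

/-- The response of the encoded states to the weak coupling. -/
def resp (s : Finset (Fin n × Fin n)) (f : Fin n × Fin n → ℝ) :
    Matrix (Fin n → Cube) (Fin n → Fin 2) ℂ :=
  ∑ p ∈ s, (f p : ℂ) • ∑ P, ∑ σ, ∑ τ, (coef a P * ((G.e σ + G.e τ : ℝ) : ℂ)⁻¹) •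
    duo G.v p.1 p.2 (G.y P σ) (G.y P τ)

theorem starHam_conjTranspose : (starHam pauli a G.s)ᴴ = starHam pauli a G.s :=
  starHam_isHermitian pauli_conjTranspose a G.s

theorem coupler_conjTranspose (P : Fin 3) : (G.coupler P)ᴴ = G.coupler P := by
  simp [coupler, starOp, site_conjTranspose, pauli_conjTranspose]

/-- Eigenvectors of a Hermitian matrix for the eigenvalues 0 and e σ > 0 are orthogonal. -/
theorem v_mul_y (P : Fin 3) (σ : Fin 6) : G.vᴴ * G.y P σ = 0 := by
  have h : G.vᴴ * (starHam pauli a G.s * G.y P σ) = 0 := by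
    have := congrArg Matrix.conjTranspose G.ground
    rw [Matrix.conjTranspose_mul, starHam_conjTranspose, Matrix.conjTranspose_zero] at this
    rw [← Matrix.mul_assoc, this, Matrix.zero_mul]
  rw [G.excited, Matrix.mul_smul] at h
  refine (smul_eq_zero.mp h).resolve_left ?_
  exact_mod_cast (G.e_pos σ).ne'

theorem enc_gram : (G.enc n)ᴴ * G.enc n = 1 := by
  rw [enc, tens_conjTranspose, tens_mul]
  simp only [G.gram]
  exact tens_one

theorem unpert_mul_enc : G.unpert n * G.enc n = 0 := by
  rw [unpert, Matrix.sum_mul]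
  refine Finset.sum_eq_zero fun i _ => ?_
  rw [enc, site_mul_tens, G.ground]
  exact tens_eq_zero _ i (update_self _ _ _)

theorem unpert_isHermitian : (G.unpert n).IsHermitian := by
  rw [Matrix.IsHermitian, unpert, Matrix.conjTranspose_sum]
  simp only [site_conjTranspose, starHam_conjTranspose]

/-- The gap does not shrink with n: each star has gap g above its own code, and
`sum_site_sub_posSemidef` bounds the sum of the local defects below by the global one. -/
theorem unpert_gap : (G.unpert n - (G.g : ℂ) • (1 - G.enc n * (G.enc n)ᴴ)).PosSemidef := by
  obtain ⟨p, hp⟩ : ∃ p : Matrix Cube Cube ℂ, p = G.v * G.vᴴ := ⟨_, rfl⟩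
  have hpH : pᴴ = p := by rw [hp, Matrix.conjTranspose_mul, Matrix.conjTranspose_conjTranspose]
  have hpp : p * p = p := by
    rw [hp, Matrix.mul_assoc, ← Matrix.mul_assoc G.vᴴ, G.gram, Matrix.one_mul]
  have henc : G.enc n * (G.enc n)ᴴ = tens fun _ : Fin n => p := by
    rw [enc, tens_conjTranspose, tens_mul, hp]
  have hgap := G.gap
  rw [← hp] at hgap
  have h1 : G.unpert n - (G.g : ℂ) • (1 - G.enc n * (G.enc n)ᴴ) =
      (∑ i : Fin n, site i (starHam pauli a G.s - (G.g : ℂ) • (1 - p))) +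
        (G.g : ℂ) • ((∑ i : Fin n, site i (1 - p)) - (1 - tens fun _ : Fin n => p)) := by
    rw [henc, unpert]
    simp only [site_sub, site_smul, smul_sub, Finset.smul_sum, Finset.sum_sub_distrib]
    abel
  rw [h1]
  refine Matrix.PosSemidef.add (Matrix.posSemidef_sum _ fun i _ => site_posSemidef i hgap) ?_
  refine (sum_site_sub_posSemidef p hpH hpp).smul ?_
  exact_mod_cast G.g_pos.le

variable {s : Finset (Fin n × Fin n)} (hs : ∀ p ∈ s, p.1 < p.2) (f : Fin n × Fin n → ℝ)
include hs

theorem pert_isHermitian : (G.pert s f).IsHermitian := by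
  rw [Matrix.IsHermitian, pert, Matrix.conjTranspose_sum]
  refine Finset.sum_congr rfl fun p hp => ?_
  rw [Matrix.conjTranspose_smul, Matrix.conjTranspose_sum]
  congr 1
  · simp
  · refine Finset.sum_congr rfl fun P _ => ?_
    rw [Matrix.conjTranspose_smul, star_coef, site_mul_site_eq_duo (hs p hp).ne, duo_conjTranspose,
      coupler_conjTranspose, Matrix.conjTranspose_one]

theorem pert_mul_enc : G.pert s f * G.enc n = ∑ p ∈ s, (f p : ℂ) • ∑ P, coef a P •
    duo G.v p.1 p.2 (G.coupler P * G.v) (G.coupler P * G.v) := by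
  rw [pert, Matrix.sum_mul]
  refine Finset.sum_congr rfl fun p hp => ?_
  rw [Matrix.smul_mul, Matrix.sum_mul]
  congr 1
  refine Finset.sum_congr rfl fun P _ => ?_
  rw [Matrix.smul_mul, site_mul_site_eq_duo (hs p hp).ne, enc, duo_mul_tens _ _ (hs p hp).ne,
    Matrix.one_mul]

/-- Each summand of `resp` is an eigenvector of energy e σ + e τ, which its coefficient divides out.
Thus `resp` is H₀⁻¹VE. -/
theorem unpert_mul_resp : G.unpert n * G.resp s f = G.pert s f * G.enc n := by
  rw [G.pert_mul_enc hs, resp, Matrix.mul_sum]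
  refine Finset.sum_congr rfl fun p hp => ?_
  rw [Matrix.mul_smul, Matrix.mul_sum]
  congr 1
  refine Finset.sum_congr rfl fun P _ => ?_
  rw [coupler, G.coupling, duo_sum _ _ _ (hs p hp).ne, Matrix.mul_sum, Finset.smul_sum]
  refine Finset.sum_congr rfl fun σ _ => ?_
  rw [Matrix.mul_sum, Finset.smul_sum]
  refine Finset.sum_congr rfl fun τ _ => ?_
  rw [Matrix.mul_smul, unpert, sum_site_mul_duo _ _ _ _ (hs p hp).ne G.ground (G.excited P σ)
    (G.excited P τ), smul_smul]
  have h : ((G.e σ + G.e τ : ℝ) : ℂ) ≠ 0 := by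
    exact_mod_cast (add_pos (G.e_pos σ) (G.e_pos τ)).ne'
  congr 1
  rw [← Complex.ofReal_add, mul_assoc, inv_mul_cancel₀ h, mul_one]

omit hs in
theorem enc_mul_resp : (G.enc n)ᴴ * G.resp s f = 0 := by
  rw [resp, Matrix.mul_sum]
  refine Finset.sum_eq_zero fun p _ => ?_
  simp only [Matrix.mul_smul, Matrix.mul_sum]
  rw [Finset.sum_eq_zero, smul_zero]
  intro P _
  refine Finset.sum_eq_zero fun σ _ => Finset.sum_eq_zero fun τ _ => ?_
  rw [enc, tens_conjTranspose, duo, tens_mul, tens_eq_zero _ p.2, smul_zero]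
  rw [update_self, v_mul_y]

/-- A pair excited by V can only be returned to the code by the coupling of the same pair, so the
double sum over pairs is diagonal and the weights enter squared. -/
theorem enc_mul_pert_mul_resp : (G.enc n)ᴴ * G.pert s f * G.resp s f =
    ∑ p ∈ s, ((f p ^ 2 : ℝ) : ℂ) • onPair
      ((G.c₀ : ℂ) • 1 + (G.c₁ : ℂ) • XX + (G.d : ℂ) • (YY + ZZ)) p.1 p.2 := by
  have hX : (G.enc n)ᴴ * G.pert s f = ∑ p ∈ s, (f p : ℂ) • ∑ P, coef a P •
      duo G.vᴴ p.1 p.2 (G.coupler P * G.v)ᴴ (G.coupler P * G.v)ᴴ := by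
    rw [← (G.pert_isHermitian hs f).eq, ← Matrix.conjTranspose_mul, G.pert_mul_enc hs]
    simp only [Matrix.conjTranspose_sum, Matrix.conjTranspose_smul, duo_conjTranspose, star_coef]
    simp
  rw [hX, resp, Matrix.sum_mul]
  refine Finset.sum_congr rfl fun p hp => ?_
  rw [Matrix.mul_sum, Finset.sum_eq_single p]
  · rw [← G.second_order, onPair_sum, Matrix.smul_mul, Matrix.mul_smul, smul_smul, Matrix.sum_mul]
    rw [pow_two, Complex.ofReal_mul]
    congr 1
    refine Finset.sum_congr rfl fun P _ => ?_
    rw [Matrix.mul_sum, onPair_sum]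
    refine Finset.sum_congr rfl fun P' _ => ?_
    rw [Matrix.mul_sum, onPair_sum]
    refine Finset.sum_congr rfl fun σ _ => ?_
    rw [Matrix.mul_sum, onPair_sum]
    refine Finset.sum_congr rfl fun τ _ => ?_
    rw [onPair_smul, onPair_kronecker_eq_duo (hs p hp).ne, Matrix.smul_mul, Matrix.mul_smul,
      duo_mul_duo _ _ (hs p hp).ne, G.gram, smul_smul, mul_assoc]
    rfl
  · intro p' hp' hne
    rw [Matrix.smul_mul, Matrix.mul_smul, Matrix.sum_mul]
    rw [Finset.sum_eq_zero, smul_zero, smul_zero]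
    intro P _
    simp only [Matrix.mul_sum]
    refine Finset.sum_eq_zero fun P' _ => Finset.sum_eq_zero fun σ _ =>
      Finset.sum_eq_zero fun τ _ => ?_
    rw [Matrix.smul_mul, Matrix.mul_smul, duo_mul_duo_eq_zero _ _ (hs p' hp') (hs p hp), smul_zero,
      smul_zero]
    · rintro ⟨h1, h2⟩
      exact hne (Prod.ext h1.symm h2.symm)
    · exact G.v_mul_y _ _
    · exact G.v_mul_y _ _
  · exact fun h => absurd hp h

omit hs

theorem enc_mul_site_mul_enc {i j : Fin n} (hij : i ≠ j) (A B : Matrix Cube Cube ℂ) :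
    (G.enc n)ᴴ * (site i A * site j B) * G.enc n =
      duo 1 i j (G.vᴴ * (A * G.v)) (G.vᴴ * (B * G.v)) := by
  rw [Matrix.mul_assoc, site_mul_site_eq_duo hij, enc, duo_mul_tens _ _ hij, Matrix.one_mul,
    tens_conjTranspose]
  have : (tens fun _ : Fin n => G.vᴴ) = duo G.vᴴ i j G.vᴴ G.vᴴ := by rw [duo]; simp
  rw [this, duo_mul_duo _ _ hij, G.gram]

theorem enc_leaf_leaf {i j : Fin n} (hij : i ≠ j) :
    (G.enc n)ᴴ * (∑ P, coef a P • (site i (site (1 : Fin 4) (pauli P)) *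
      site j (site (1 : Fin 4) (pauli P)))) * G.enc n = ((a * G.x₁ ^ 2 : ℝ) : ℂ) • onPair XX i j := by
  rw [Matrix.mul_sum, Matrix.sum_mul]
  simp only [Matrix.mul_smul, Matrix.smul_mul, G.enc_mul_site_mul_enc hij, G.leaf]
  rw [Finset.sum_eq_single 0]
  · rw [if_pos rfl, ← onPair_kronecker_eq_duo hij, Matrix.smul_kronecker, Matrix.kronecker_smul,
      onPair_smul, onPair_smul, smul_smul, smul_smul, XX]
    congr 1
    simp [coef]
    ring
  · intro P _ hP
    rw [if_neg hP, duo, tens_eq_zero _ j (update_self _ _ _), smul_zero]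
  · simp

/-- The opposite sign to `enc_leaf_leaf` makes negative XX weights available. -/
theorem enc_leaf_center {i j : Fin n} (hij : i ≠ j) :
    (G.enc n)ᴴ * (∑ P, coef a P • (site i (site (1 : Fin 4) (pauli P)) *
      site j (site (0 : Fin 4) (pauli P)))) * G.enc n =
      ((-(a * G.x₁ * G.x₀) : ℝ) : ℂ) • onPair XX i j := by
  rw [Matrix.mul_sum, Matrix.sum_mul]
  simp only [Matrix.mul_smul, Matrix.smul_mul, G.enc_mul_site_mul_enc hij, G.leaf, G.center]
  rw [Finset.sum_eq_single 0]
  · rw [if_pos rfl, if_pos rfl, ← onPair_kronecker_eq_duo hij, Matrix.smul_kronecker,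
      Matrix.kronecker_smul, onPair_smul, onPair_smul, smul_smul, smul_smul, XX]
    congr 1
    simp [coef]
  · intro P _ hP
    rw [if_neg hP, if_neg hP, duo, tens_eq_zero _ j (update_self _ _ _), smul_zero]
  · simp

end StarGadget

/-! ### Realization on physical qubits by the given interaction. -/

section Physical

open Matrix Function
open scoped ComplexOrder

/-- Operators on `n` blocks of four qubits as operators on `4 n` qubits. -/
def phys (n : ℕ) : Matrix (Fin n → Cube) (Fin n → Cube) ℂ ≃ₐ[ℂ]
    Matrix (Fin (n * 4) → Fin 2) (Fin (n * 4) → Fin 2) ℂ :=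
  Matrix.reindexAlgEquiv ℂ ℂ (blockEquiv n).symm

theorem phys_apply {n : ℕ} (A : Matrix (Fin n → Cube) (Fin n → Cube) ℂ) :
    phys n A = A.submatrix (blockEquiv n) (blockEquiv n) := rfl

theorem onPair_eq_phys {n : ℕ} (a : ℝ) {p p' : Fin n × Fin 4} (hp : p ≠ p') :
    onPair (interaction a) (finProdFinEquiv p) (finProdFinEquiv p') =
      phys n (∑ P, coef a P • (site p.1 (site p.2 (pauli P)) * site p'.1 (site p'.2 (pauli P)))) :=
  onPair_interaction_blockEquiv a hp

/-- The pairs of distinct sites, each listed once. -/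
def pairs (n : ℕ) : Finset (Fin n × Fin n) := Finset.univ.filter fun p => p.1 < p.2

theorem lt_of_mem_pairs {n : ℕ} {p : Fin n × Fin n} (hp : p ∈ pairs n) : p.1 < p.2 :=
  (Finset.mem_filter.mp hp).2

theorem card_pairs_le (n : ℕ) : (pairs n).card ≤ n ^ 2 := by
  refine (Finset.card_filter_le _ _).trans ?_
  simp [pow_two]

namespace StarGadget

variable {a : ℝ} (G : StarGadget a) {n : ℕ}

/-- The strengths of the couplings of the qubits of a star. -/
def strength : Fin 4 → ℝ := ![G.w, G.u, G.u, G.u]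

theorem coupler_eq_sum (P : Fin 3) :
    G.coupler P = ∑ q : Fin 4, (G.strength q : ℂ) • site q (pauli P) := by
  rw [coupler, starOp, Fin.sum_univ_four]
  simp [strength, smul_add, add_assoc]

theorem phys_unpert : phys n (G.unpert n) =
    (∑ i : Fin n, ∑ k : Fin 3, ((1 : ℝ) : ℂ) •
      onPair (interaction a) (finProdFinEquiv (i, (0 : Fin 4))) (finProdFinEquiv (i, k.succ))) +
      ((n * (a + 2 * G.s) : ℝ) : ℂ) • 1 := by
  have h : ∀ i : Fin n, ∀ k : Fin 3, onPair (interaction a) (finProdFinEquiv (i, (0 : Fin 4)))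
      (finProdFinEquiv (i, k.succ)) =
      phys n (∑ P, coef a P • (site i (site (0 : Fin 4) (pauli P) * site k.succ (pauli P)))) := by
    intro i k
    rw [onPair_eq_phys a (by simpa using (Fin.succ_ne_zero k).symm)]
    simp only [site_mul_site_same]
  simp only [h, Complex.ofReal_one, one_smul]
  have h1 : ((n * (a + 2 * G.s) : ℝ) : ℂ) • (1 : Matrix (Fin (n * 4) → Fin 2) _ ℂ) =
      phys n (∑ i : Fin n, site i (((a + 2 * G.s : ℝ) : ℂ) • 1)) := by
    simp only [site_smul, site_one]
    rw [Finset.sum_const, map_nsmul, map_smul, map_one, Finset.card_univ, Fintype.card_fin,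
      ← Nat.cast_smul_eq_nsmul ℂ, smul_smul]
    push_cast
    rfl
  rw [h1]
  simp only [← map_sum]
  rw [← map_add, unpert, ← Finset.sum_add_distrib]
  congr 1
  refine Finset.sum_congr rfl fun i _ => ?_
  rw [starHam, site_add, site_sum, Finset.sum_comm]
  congr 1
  refine Finset.sum_congr rfl fun P _ => ?_
  rw [Fin.sum_univ_three, site_smul, Matrix.mul_add, Matrix.mul_add, site_add, site_add, smul_add,
    smul_add]
  rfl

theorem phys_pert (f : Fin n × Fin n → ℝ) : phys n (G.pert (pairs n) f) =
    ∑ p ∈ pairs n, ∑ q : Fin 4, ∑ q' : Fin 4, ((f p * (G.strength q * G.strength q') : ℝ) : ℂ) •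
      onPair (interaction a) (finProdFinEquiv (p.1, q)) (finProdFinEquiv (p.2, q')) := by
  rw [pert, map_sum]
  refine Finset.sum_congr rfl fun p hp => ?_
  have h : ∀ q q' : Fin 4, onPair (interaction a) (finProdFinEquiv (p.1, q))
      (finProdFinEquiv (p.2, q')) = phys n (∑ P, coef a P •
        (site p.1 (site q (pauli P)) * site p.2 (site q' (pauli P)))) := fun q q' =>
    onPair_eq_phys a fun h => (lt_of_mem_pairs hp).ne (congrArg Prod.fst h)
  simp only [h, ← map_smul, ← map_sum]
  congr 1
  simp only [coupler_eq_sum, site_sum, site_smul, Matrix.sum_mul, Matrix.mul_sum, Matrix.smul_mul,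
    Matrix.mul_smul, Finset.smul_sum, smul_smul]
  rw [Finset.sum_comm]
  conv_rhs => rw [Finset.sum_comm]
  refine Finset.sum_congr rfl fun q _ => ?_
  rw [Finset.sum_comm]
  refine Finset.sum_congr rfl fun q' _ => Finset.sum_congr rfl fun P _ => ?_
  congr 1
  push_cast
  ring

/-- The encoding on physical qubits. -/
def physEnc (n : ℕ) : Matrix (Fin (n * 4) → Fin 2) (Fin n → Fin 2) ℂ :=
  (G.enc n).submatrix (blockEquiv n) id

theorem physEnc_conjTranspose_mul {β : Type*} (A : Matrix (Fin n → Cube) β ℂ) :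
    (G.physEnc n)ᴴ * A.submatrix (blockEquiv n) id = (G.enc n)ᴴ * A := by
  rw [physEnc, Matrix.conjTranspose_submatrix, Matrix.submatrix_mul_equiv, Matrix.submatrix_id_id]

theorem simulates (f : Fin n × Fin n → ℝ) {W : Matrix (Fin n → Cube) (Fin n → Cube) ℂ}
    (hW : W.IsHermitian) {L D : ℝ} (hL : 1 ≤ L) (hgL : 1 ≤ G.g * L)
    (hXn : ‖op (phys n (G.pert (pairs n) f))‖ ≤ G.g * L) (hYn : ‖op (phys n W)‖ ≤ G.g * L)
    (hD : 400 * L ^ 6 ≤ D) :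
    ∃ E' : Qubits n →ₗᵢ[ℂ] Qubits (n * 4), (∀ x, E' x = rectOp (G.physEnc n) x) ∧
      Simulates (op (((D : ℂ) ^ 2) • phys n (G.unpert n) + (D : ℂ) • phys n (G.pert (pairs n) f)
        + phys n W)) E'
        (op ((G.enc n)ᴴ * W * G.enc n - ∑ p ∈ pairs n, ((f p ^ 2 : ℝ) : ℂ) • onPair
          ((G.c₀ : ℂ) • 1 + (G.c₁ : ℂ) • XX + (G.d : ℂ) • (YY + ZZ)) p.1 p.2))
        (400 * L ^ 6 / D) (400 * L ^ 6 / D) := by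
  have hs : ∀ p ∈ pairs n, p.1 < p.2 := fun p hp => lt_of_mem_pairs hp
  have hmul : ∀ (A : Matrix (Fin n → Cube) (Fin n → Cube) ℂ)
      (B : Matrix (Fin n → Cube) (Fin n → Fin 2) ℂ),
      phys n A * B.submatrix (blockEquiv n) id = (A * B).submatrix (blockEquiv n) id :=
    fun A B => Matrix.submatrix_mul_equiv _ _ _ _ _
  have h := simulates_second_order_matrix (phys n (G.unpert n)) (phys n (G.pert (pairs n) f))
    (phys n W) (G.unpert_isHermitian.submatrix _) ((G.pert_isHermitian hs f).submatrix _)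
    (hW.submatrix _) (G.physEnc n) ((G.resp (pairs n) f).submatrix (blockEquiv n) id)
    G.g_pos G.g_le hL hgL ?_ ?_ ?_ ?_ ?_ hXn hYn hD
  · have h1 : (G.physEnc n)ᴴ * phys n W * G.physEnc n = (G.enc n)ᴴ * W * G.enc n := by
      rw [Matrix.mul_assoc, Matrix.mul_assoc, ← physEnc_conjTranspose_mul, ← hmul]
      rfl
    have h2 : (G.physEnc n)ᴴ * phys n (G.pert (pairs n) f) *
        (G.resp (pairs n) f).submatrix (blockEquiv n) id =
        (G.enc n)ᴴ * G.pert (pairs n) f * G.resp (pairs n) f := by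
      rw [Matrix.mul_assoc, hmul, physEnc_conjTranspose_mul, Matrix.mul_assoc]
    rwa [h1, h2, G.enc_mul_pert_mul_resp hs] at h
  · rw [← G.enc_gram, ← physEnc_conjTranspose_mul]
    rfl
  · rw [physEnc, hmul, unpert_mul_enc]
    rfl
  · convert (G.unpert_gap (n := n)).submatrix (blockEquiv n) using 1
    rw [← phys_apply, map_sub, map_smul, map_sub, map_one]
    congr 3
  · rw [hmul, G.unpert_mul_resp hs, physEnc, hmul]
  · rw [physEnc_conjTranspose_mul, G.enc_mul_resp]

theorem isLocalEncoding {E' : Qubits n →ₗᵢ[ℂ] Qubits (n * 4)}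
    (hE' : ∀ x, E' x = rectOp (G.physEnc n) x) : IsLocalEncoding E' := by
  -- There are no ancillas: every physical qubit belongs to a star, and the ancilla state is the
  -- scalar 1.
  refine ⟨fun k => some (finProdFinEquiv.symm k).1, fun _ => 1,
    fun i l f => G.v (fun q => f ⟨finProdFinEquiv (i, q), by simp⟩) l, fun x y => ?_⟩
  rw [hE', rectOp_apply, one_mul]
  simp [physEnc, enc, tens_apply, blockEquiv]

end StarGadget

end Physical

/-! ### Normal form of the target Hamiltonian. -/

section Target

open Matrix Function
open scoped ComplexOrder

/-- Both target terms are symmetric in their two qubits, so all terms on the same unordered pair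
merge. At most B terms of weight at most B add up to B². -/
theorem IsPlusHamiltonian.exists_pair_form {n B : ℕ}
    {H : Matrix (Fin n → Fin 2) (Fin n → Fin 2) ℂ}
    (h : IsPlusHamiltonian {XX, -YY - ZZ} n B H) :
    ∃ α β : Fin n × Fin n → ℝ, (∀ p, 0 ≤ α p) ∧ (∀ p, α p ≤ (B : ℝ) ^ 2) ∧ (∀ p, 0 ≤ β p) ∧
      (∀ p, β p ≤ (B : ℝ) ^ 2) ∧ H = ∑ p ∈ pairs n,
        ((α p : ℂ) • onPair XX p.1 p.2 + (β p : ℂ) • onPair (-YY - ZZ) p.1 p.2) := by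
  obtain ⟨t, K, i, j, w, ht, hw, rfl⟩ := h
  have hone : ∀ l, ∃ p ∈ pairs n, ∃ c d : ℝ, 0 ≤ c ∧ c ≤ B ∧ 0 ≤ d ∧ d ≤ B ∧
      (w l : ℂ) • onPair (K l) (i l) (j l) =
        (c : ℂ) • onPair XX p.1 p.2 + (d : ℂ) • onPair (-YY - ZZ) p.1 p.2 := by
    intro l
    obtain ⟨hK, hij, hw0, hwB⟩ := hw l
    have hB : (0 : ℝ) ≤ B := Nat.cast_nonneg _
    have hcomm : onPair (K l) (i l) (j l) = onPair (K l) (j l) (i l) := by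
      rcases hK with hK | hK
      · rw [hK, XX, onPair_kronecker_self_comm]
      · rw [hK, onPair_sub, onPair_sub, onPair_neg, onPair_neg, YY, ZZ,
          onPair_kronecker_self_comm pauliY, onPair_kronecker_self_comm pauliZ]
    obtain ⟨p, hp, hKp⟩ : ∃ p ∈ pairs n, onPair (K l) (i l) (j l) = onPair (K l) p.1 p.2 := by
      rcases hij.lt_or_gt with h | h
      · exact ⟨(i l, j l), by simp [pairs, h], rfl⟩
      · exact ⟨(j l, i l), by simp [pairs, h], hcomm⟩
    refine ⟨p, hp, ?_⟩
    rw [hKp]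
    rcases hK with hK | hK
    · exact ⟨w l, 0, hw0.le, hwB, le_rfl, hB, by simp [hK]⟩
    · exact ⟨0, w l, le_rfl, hB, hw0.le, hwB, by rw [hK]; simp⟩
  choose p hp c d hc0 hcB hd0 hdB hcd using hone
  have hsingle : ∀ (x : Fin t → ℝ), (∀ l, 0 ≤ x l) → (∀ l, x l ≤ B) → ∀ p',
      0 ≤ ∑ l, (if p l = p' then x l else 0) ∧
        ∑ l, (if p l = p' then x l else 0) ≤ (B : ℝ) ^ 2 := by
    intro x hx0 hxB p'
    refine ⟨Finset.sum_nonneg fun l _ => by split_ifs <;> simp [hx0 l], ?_⟩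
    refine (Finset.sum_le_card_nsmul _ _ (B : ℝ) fun l _ => ?_).trans ?_
    · split_ifs
      · exact hxB l
      · exact Nat.cast_nonneg _
    · rw [Finset.card_univ, Fintype.card_fin, nsmul_eq_mul, pow_two]
      have : (t : ℝ) ≤ B := by exact_mod_cast ht
      gcongr
  refine ⟨fun p' => ∑ l, if p l = p' then c l else 0, fun p' => ∑ l, if p l = p' then d l else 0,
    fun p' => (hsingle c hc0 hcB p').1, fun p' => (hsingle c hc0 hcB p').2,
    fun p' => (hsingle d hd0 hdB p').1, fun p' => (hsingle d hd0 hdB p').2, ?_⟩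
  simp only [hcd, Complex.ofReal_sum, Finset.sum_smul, ← Finset.sum_add_distrib]
  rw [Finset.sum_comm]
  refine Finset.sum_congr rfl fun l _ => ?_
  rw [Finset.sum_eq_single (p l)]
  · simp
  · intro p' _ hne
    simp [hne.symm]
  · exact fun h => absurd (hp l) h

end Target

/-! ### A common bound for the constants of the gadget. -/

namespace StarGadget

open Matrix Function
open scoped ComplexOrder

variable {a : ℝ} (G : StarGadget a)

theorem strength_pos (q : Fin 4) : 0 < G.strength q := by
  have hw := G.w_pos
  have hu := G.u_pos
  fin_cases q <;> simpa [strength]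

/-- A common bound for the constants of the gadget. -/
structure Bound (N : ℕ) : Prop where
  norm : a + 2 ≤ N
  gap : 1 ≤ G.g * N
  inv_d : 1 / G.d ≤ N
  strength : ∀ q q', G.strength q * G.strength q' ≤ N
  c₀ : |G.c₀| / G.d ≤ N
  c₁ : |G.c₁| / G.d ≤ N
  leaf_leaf : 1 / (a * G.x₁ ^ 2) ≤ N
  leaf_center : 1 / (a * G.x₁ * G.x₀) ≤ N
  shift : a + 2 * G.s ≤ N

theorem exists_bound (ha : 0 < a) : ∃ N, 1 ≤ N ∧ G.Bound N := by
  have hg := G.g_pos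
  have hd := G.d_pos
  have hs := G.s_pos
  have h0 := G.x₀_pos
  have h1 := G.x₁_pos
  have hq := fun q q' => mul_pos (G.strength_pos q) (G.strength_pos q')
  have hmem : ∀ q q', G.strength q * G.strength q' ≤ ∑ q, ∑ q', G.strength q * G.strength q' := by
    intro q q'
    refine (Finset.single_le_sum (f := fun q' => G.strength q * G.strength q')
      (fun q' _ => (hq q q').le) (Finset.mem_univ q')).trans ?_
    exact Finset.single_le_sum (f := fun q => ∑ q', G.strength q * G.strength q')
      (fun q _ => Finset.sum_nonneg fun q' _ => (hq q q').le) (Finset.mem_univ q)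
  have e1 : 0 < a + 2 := by linarith
  have e2 : 0 ≤ 1 / G.g := by positivity
  have e3 : 0 ≤ 1 / G.d := by positivity
  have e4 : 0 ≤ ∑ q, ∑ q', G.strength q * G.strength q' := (hq 0 0).le.trans (hmem 0 0)
  have e5 : 0 ≤ |G.c₀| / G.d := by positivity
  have e6 : 0 ≤ |G.c₁| / G.d := by positivity
  have e7 : 0 ≤ 1 / (a * G.x₁ ^ 2) := by positivity
  have e8 : 0 ≤ 1 / (a * G.x₁ * G.x₀) := by positivity
  obtain ⟨N, hN⟩ := exists_nat_ge (1 + (a + 2) + 1 / G.g + 1 / G.d +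
    (∑ q, ∑ q', G.strength q * G.strength q') + |G.c₀| / G.d + |G.c₁| / G.d +
    1 / (a * G.x₁ ^ 2) + 1 / (a * G.x₁ * G.x₀) + (a + 2 * G.s))
  refine ⟨N, ?_, by linarith, ?_, by linarith, fun q q' => (hmem q q').trans (by linarith),
    by linarith, by linarith, by linarith, by linarith, by linarith⟩
  · have : (1 : ℝ) ≤ N := by linarith
    exact_mod_cast this
  · have h : 1 / G.g ≤ N := by linarith
    rwa [div_le_iff₀ hg, mul_comm] at h

end StarGadget

/-! ### Size of the three pieces of the simulator. -/

namespace StarGadget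

open Matrix Function
open scoped ComplexOrder

variable {a : ℝ} (G : StarGadget a) {n : ℕ}

/-- Direct interactions of leaves with leaves and of leaves with centers. -/
def corr (a : ℝ) (wl wc : Fin n × Fin n → ℝ) : Matrix (Fin n → Cube) (Fin n → Cube) ℂ :=
  ∑ p ∈ pairs n, ((wl p : ℂ) • (∑ P, coef a P • (site p.1 (site (1 : Fin 4) (pauli P)) *
      site p.2 (site (1 : Fin 4) (pauli P)))) +
    (wc p : ℂ) • (∑ P, coef a P • (site p.1 (site (1 : Fin 4) (pauli P)) *
      site p.2 (site (0 : Fin 4) (pauli P)))))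

theorem phys_corr (a : ℝ) (wl wc : Fin n × Fin n → ℝ) : phys n (corr a wl wc) =
    ∑ p ∈ pairs n, ((wl p : ℂ) • onPair (interaction a) (finProdFinEquiv (p.1, (1 : Fin 4)))
        (finProdFinEquiv (p.2, (1 : Fin 4))) +
      (wc p : ℂ) • onPair (interaction a) (finProdFinEquiv (p.1, (1 : Fin 4)))
        (finProdFinEquiv (p.2, (0 : Fin 4)))) := by
  rw [corr, map_sum]
  refine Finset.sum_congr rfl fun p hp => ?_
  have hne : ∀ q q' : Fin 4, (p.1, q) ≠ (p.2, q') :=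
    fun q q' h => (lt_of_mem_pairs hp).ne (congrArg Prod.fst h)
  rw [onPair_eq_phys a (hne 1 1), onPair_eq_phys a (hne 1 0), map_add, map_smul, map_smul]

theorem corr_isHermitian (a : ℝ) (wl wc : Fin n × Fin n → ℝ) : (corr a wl wc).IsHermitian := by
  rw [Matrix.IsHermitian, corr, Matrix.conjTranspose_sum]
  refine Finset.sum_congr rfl fun p hp => ?_
  have hne := (lt_of_mem_pairs hp).ne
  simp only [Matrix.conjTranspose_add, Matrix.conjTranspose_smul, Matrix.conjTranspose_sum,
    star_coef, site_mul_site_eq_duo hne, duo_conjTranspose, site_conjTranspose, pauli_conjTranspose,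
    Matrix.conjTranspose_one]
  simp

theorem enc_corr (wl wc : Fin n × Fin n → ℝ) : (G.enc n)ᴴ * corr a wl wc * G.enc n =
    ∑ p ∈ pairs n,
      ((wl p * (a * G.x₁ ^ 2) - wc p * (a * G.x₁ * G.x₀) : ℝ) : ℂ) • onPair XX p.1 p.2 := by
  rw [corr, Matrix.mul_sum, Matrix.sum_mul]
  refine Finset.sum_congr rfl fun p hp => ?_
  have hne := (lt_of_mem_pairs hp).ne
  rw [Matrix.mul_add, Matrix.add_mul, Matrix.mul_smul, Matrix.smul_mul, Matrix.mul_smul,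
    Matrix.smul_mul, G.enc_leaf_leaf hne, G.enc_leaf_center hne, smul_smul, smul_smul, ← add_smul]
  congr 1
  push_cast
  ring

theorem corr_isPlusHamiltonian (a : ℝ) {wl wc : Fin n × Fin n → ℝ} {B : ℕ} (hB : 1 ≤ B)
    (hl : ∀ p, 0 ≤ wl p ∧ wl p ≤ B) (hc : ∀ p, 0 ≤ wc p ∧ wc p ≤ B) :
    IsPlusHamiltonian {interaction a} (n * 4) (2 * n ^ 2 * B) (phys n (corr a wl wc)) := by
  rw [phys_corr]
  refine (IsPlusHamiltonian.sum (B := B + B) _ fun p hp => ?_).mono ?_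
  · have hne : ∀ q q' : Fin 4, finProdFinEquiv (p.1, q) ≠ finProdFinEquiv (p.2, q') := fun q q' h =>
      (lt_of_mem_pairs hp).ne (congrArg Prod.fst (finProdFinEquiv.injective h))
    exact (IsPlusHamiltonian.single (Set.mem_singleton _) (hne _ _) (hl p).1 hB (hl p).2).add
      (IsPlusHamiltonian.single (Set.mem_singleton _) (hne _ _) (hc p).1 hB (hc p).2)
  · have := Nat.mul_le_mul_right (B + B) (card_pairs_le n)
    linarith

theorem pert_isPlusHamiltonian {f : Fin n × Fin n → ℝ} {B : ℕ} (hB : 1 ≤ B)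
    (hf : ∀ p, 0 ≤ f p) (hfB : ∀ p q q', f p * (G.strength q * G.strength q') ≤ B) :
    IsPlusHamiltonian {interaction a} (n * 4) (16 * n ^ 2 * B) (phys n (G.pert (pairs n) f)) := by
  rw [phys_pert]
  refine (IsPlusHamiltonian.sum (B := 4 * (4 * B)) _ fun p hp => ?_).mono ?_
  · have hne : ∀ q q' : Fin 4, finProdFinEquiv (p.1, q) ≠ finProdFinEquiv (p.2, q') := fun q q' h =>
      (lt_of_mem_pairs hp).ne (congrArg Prod.fst (finProdFinEquiv.injective h))
    refine IsPlusHamiltonian.sum_fin fun q => IsPlusHamiltonian.sum_fin fun q' => ?_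
    exact IsPlusHamiltonian.single (Set.mem_singleton _) (hne _ _)
      (mul_nonneg (hf p) (mul_pos (G.strength_pos q) (G.strength_pos q')).le) hB (hfB p q q')
  · have := Nat.mul_le_mul_right (4 * (4 * B)) (card_pairs_le n)
    linarith

theorem stars_isPlusHamiltonian (a : ℝ) {w : ℝ} (hw : 0 ≤ w) {B : ℕ} (hB : 1 ≤ B) (hwB : w ≤ B) :
    IsPlusHamiltonian {interaction a} (n * 4) (n * (3 * B)) (∑ i : Fin n, ∑ k : Fin 3, (w : ℂ) •
      onPair (interaction a) (finProdFinEquiv (i, (0 : Fin 4))) (finProdFinEquiv (i, k.succ))) := by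
  refine IsPlusHamiltonian.sum_fin fun i => IsPlusHamiltonian.sum_fin fun k => ?_
  refine IsPlusHamiltonian.single (Set.mem_singleton _) (finProdFinEquiv.injective.ne ?_) hw hB hwB
  simpa using (Fin.succ_ne_zero k).symm

theorem smul_pert (c : ℝ) (f : Fin n × Fin n → ℝ) :
    (c : ℂ) • G.pert (pairs n) f = G.pert (pairs n) fun p => c * f p := by
  simp only [pert, Finset.smul_sum, smul_smul, Complex.ofReal_mul, mul_assoc]

end StarGadget

/-! ### Polynomial bounds. -/

/-- A bound for the weights of the couplings between stars. -/
def weightBound (N b : ℕ) : ℕ := N * (1 + N) * (1 + b)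

/-- A bound for the norm of the perturbations, in units of the gap. -/
def normBound (N b n : ℕ) : ℕ :=
  N * ((16 * n ^ 2 * weightBound N b) ^ 2 * N + (2 * n ^ 2 * weightBound N b) ^ 2 * N
    + n ^ 2 * b * N + 1)

/-- The ratio between the energy scales. -/
def scale (N b n Q : ℕ) : ℕ := 400 * normBound N b n ^ 6 * (Q + 1)

/-- A bound for the size of the simulator. -/
def sizeBound (N b n Q : ℕ) : ℕ :=
  n * 4 + (n * (3 * scale N b n Q ^ 2) + 16 * n ^ 2 * (scale N b n Q * weightBound N b)
    + 2 * n ^ 2 * weightBound N b) + (scale N b n Q ^ 2 * (n * N) + n ^ 2 * b * N)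

theorem exists_polynomial_sizeBound (N : ℕ) (p q : Polynomial ℕ) :
    ∃ r : Polynomial ℕ, ∀ n, r.eval n = sizeBound N (p.eval n ^ 2) n (q.eval n) := by
  let X : Polynomial ℕ := Polynomial.X
  let C : ℕ → Polynomial ℕ := fun k => Polynomial.C k
  let M : Polynomial ℕ := C (N * (1 + N)) * (1 + p ^ 2)
  let L : Polynomial ℕ := C N * ((16 * X ^ 2 * M) ^ 2 * C N + (2 * X ^ 2 * M) ^ 2 * C N
    + X ^ 2 * p ^ 2 * C N + 1)
  let D : Polynomial ℕ := 400 * L ^ 6 * (q + 1)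
  refine ⟨X * 4 + (X * (3 * D ^ 2) + 16 * X ^ 2 * (D * M) + 2 * X ^ 2 * M)
    + (D ^ 2 * (X * C N) + X ^ 2 * p ^ 2 * C N), fun n => ?_⟩
  simp only [X, C, M, L, D, sizeBound, scale, normBound, weightBound, Polynomial.eval_add,
    Polynomial.eval_mul, Polynomial.eval_pow, Polynomial.eval_C, Polynomial.eval_X,
    Polynomial.eval_one, Polynomial.eval_ofNat]

/-! ### Choice of weights and final estimates. -/

namespace StarGadget

open Matrix Function

variable {a : ℝ} (G : StarGadget a) {n : ℕ}

/-- The weights of the couplings between stars that yield the effective weights `β`. -/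
def hop (β : Fin n × Fin n → ℝ) (p : Fin n × Fin n) : ℝ := Real.sqrt (β p / G.d)

/-- The first order correction needed for the `XX` terms. -/
def residual (α β : Fin n × Fin n → ℝ) (p : Fin n × Fin n) : ℝ := α p + β p * G.c₁ / G.d

/-- The weights of the leaf-leaf interactions. -/
def leafWeight (α β : Fin n × Fin n → ℝ) (p : Fin n × Fin n) : ℝ :=
  max (G.residual α β p) 0 * (1 / (a * G.x₁ ^ 2))

/-- The weights of the leaf-center interactions. -/
def centerWeight (α β : Fin n × Fin n → ℝ) (p : Fin n × Fin n) : ℝ :=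
  max (-G.residual α β p) 0 * (1 / (a * G.x₁ * G.x₀))

/-- The second order energy shift. -/
def energyShift (β : Fin n × Fin n → ℝ) : ℝ := ∑ p ∈ pairs n, β p * G.c₀ / G.d

/-- Squaring the hop weights √(β/d) turns d(YY+ZZ) into β(YY+ZZ). The by-products βc₀/d and
(βc₁/d)XX are compensated by the energy shift and the residual, whose positive and negative parts go
to the leaf-leaf and the leaf-center terms. -/
theorem effective_eq (ha : 0 < a) {α β : Fin n × Fin n → ℝ} (hβ : ∀ p, 0 ≤ β p) :
    (G.enc n)ᴴ * (corr a (G.leafWeight α β) (G.centerWeight α β) + (G.energyShift β : ℂ) • 1) *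
      G.enc n - ∑ p ∈ pairs n, ((G.hop β p ^ 2 : ℝ) : ℂ) • onPair
        ((G.c₀ : ℂ) • 1 + (G.c₁ : ℂ) • XX + (G.d : ℂ) • (YY + ZZ)) p.1 p.2 =
    ∑ p ∈ pairs n, ((α p : ℂ) • onPair XX p.1 p.2 + (β p : ℂ) • onPair (-YY - ZZ) p.1 p.2) := by
  have hd := G.d_pos
  have h0 := G.x₀_pos
  have h1 := G.x₁_pos
  have hc : (G.enc n)ᴴ * ((G.energyShift β : ℂ) • (1 : Matrix (Fin n → Cube) (Fin n → Cube) ℂ)) *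
      G.enc n = ∑ p ∈ pairs n, ((β p * G.c₀ / G.d : ℝ) : ℂ) • (1 : Matrix _ _ ℂ) := by
    rw [Matrix.mul_smul, Matrix.mul_one, Matrix.smul_mul, G.enc_gram, energyShift,
      Complex.ofReal_sum, Finset.sum_smul]
  rw [Matrix.mul_add, Matrix.add_mul, hc, G.enc_corr, ← Finset.sum_add_distrib,
    ← Finset.sum_sub_distrib]
  refine Finset.sum_congr rfl fun p hp => ?_
  have hw : G.leafWeight α β p * (a * G.x₁ ^ 2) - G.centerWeight α β p * (a * G.x₁ * G.x₀) =
      α p + β p * G.c₁ / G.d := by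
    rw [leafWeight, centerWeight, mul_assoc, mul_assoc, one_div_mul_cancel (by positivity),
      one_div_mul_cancel (by positivity), mul_one, mul_one, max_zero_sub_max_neg_zero_eq_self,
      residual]
  have hf : G.hop β p ^ 2 = β p / G.d := Real.sq_sqrt (div_nonneg (hβ p) hd.le)
  have hdc : (G.d : ℂ) ≠ 0 := by exact_mod_cast hd.ne'
  rw [hw, hf, onPair_add, onPair_add, onPair_smul, onPair_smul, onPair_smul, onPair_add,
    onPair_sub, onPair_neg, onPair_one (lt_of_mem_pairs hp).ne]
  push_cast
  simp only [smul_add, smul_sub, smul_neg, smul_smul, add_smul]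
  rw [div_mul_cancel₀ _ hdc]
  simp only [div_mul_eq_mul_div]
  abel

variable {N b : ℕ} {α β : Fin n × Fin n → ℝ}

theorem hop_mul_le (hN : G.Bound N) (hβ : ∀ p, 0 ≤ β p) (hβb : ∀ p, β p ≤ b) (p : Fin n × Fin n)
    (q q' : Fin 4) : G.hop β p * (G.strength q * G.strength q') ≤ weightBound N b := by
  have hd := G.d_pos
  have hx : 0 ≤ β p / G.d := div_nonneg (hβ p) hd.le
  have hx' : β p / G.d ≤ N * b := by
    rw [div_eq_mul_one_div, mul_comm]
    exact mul_le_mul hN.inv_d (hβb p) (hβ p) (Nat.cast_nonneg _)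
  -- √x ≤ 1 + x is used to stay with polynomial bounds.
  have hsq : G.hop β p ≤ 1 + N * b := by
    rw [hop]
    refine Real.sqrt_le_iff.mpr ⟨by positivity, ?_⟩
    nlinarith
  have hN0 : (0 : ℝ) ≤ N := Nat.cast_nonneg _
  have hb0 : (0 : ℝ) ≤ b := Nat.cast_nonneg _
  calc _ ≤ (1 + N * b : ℝ) * N := mul_le_mul hsq (hN.strength q q')
        (mul_pos (G.strength_pos q) (G.strength_pos q')).le (by positivity)
    _ ≤ N * (1 + N) * (1 + b) := by
        have : (0 : ℝ) ≤ N * N + N * b := by positivity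
        nlinarith
    _ = _ := by rw [weightBound]; push_cast; ring

theorem abs_residual_le (hN : G.Bound N) (hα : ∀ p, 0 ≤ α p) (hαb : ∀ p, α p ≤ b)
    (hβ : ∀ p, 0 ≤ β p) (hβb : ∀ p, β p ≤ b) (p : Fin n × Fin n) :
    |G.residual α β p| ≤ (1 + b) * (1 + N) := by
  have hd := G.d_pos
  have h1 : |β p * G.c₁ / G.d| ≤ b * N := by
    rw [abs_div, abs_mul, abs_of_nonneg (hβ p), abs_of_pos hd, mul_div_assoc]
    exact mul_le_mul (hβb p) hN.c₁ (by positivity) (Nat.cast_nonneg _)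
  have h2 : |α p| ≤ b := by rw [abs_of_nonneg (hα p)]; exact hαb p
  have hN0 : (0 : ℝ) ≤ N := Nat.cast_nonneg _
  rw [residual]
  refine (abs_add_le _ _).trans ?_
  nlinarith

theorem max_mul_bounds {x y : ℝ} {N b : ℕ} (hx : |x| ≤ (1 + b) * (1 + N)) (hy : 0 ≤ y)
    (hyN : y ≤ N) : 0 ≤ max x 0 * y ∧ max x 0 * y ≤ weightBound N b := by
  have h0 : 0 ≤ max x 0 := le_max_right _ _
  have h1 : max x 0 ≤ (1 + b) * (1 + N) :=
    max_le ((le_abs_self x).trans hx) ((abs_nonneg x).trans hx)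
  refine ⟨mul_nonneg h0 hy, (mul_le_mul h1 hyN hy (h0.trans h1)).trans_eq ?_⟩
  rw [weightBound]
  push_cast
  ring

theorem abs_energyShift_le (hN : G.Bound N) (hβ : ∀ p, 0 ≤ β p) (hβb : ∀ p, β p ≤ b) :
    |G.energyShift β| ≤ n ^ 2 * b * N := by
  have hd := G.d_pos
  have h1 : ∀ p ∈ pairs n, |β p * G.c₀ / G.d| ≤ b * N := by
    intro p _
    rw [abs_div, abs_mul, abs_of_nonneg (hβ p), abs_of_pos hd, mul_div_assoc]
    exact mul_le_mul (hβb p) hN.c₀ (by positivity) (Nat.cast_nonneg _)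
  refine (Finset.abs_sum_le_sum_abs _ _).trans ((Finset.sum_le_card_nsmul _ _ _ h1).trans ?_)
  rw [nsmul_eq_mul, mul_assoc]
  have : ((pairs n).card : ℝ) ≤ (n : ℝ) ^ 2 := by exact_mod_cast card_pairs_le n
  gcongr

theorem exists_simulation (ha : 0 < a) (hN1 : 1 ≤ N) (hN : G.Bound N) (Q : ℕ) (hα : ∀ p, 0 ≤ α p)
    (hαb : ∀ p, α p ≤ b) (hβ : ∀ p, 0 ≤ β p) (hβb : ∀ p, β p ≤ b) :
    ∃ (Hsim : Matrix (Fin (n * 4) → Fin 2) (Fin (n * 4) → Fin 2) ℂ) (c : ℝ)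
      (E : Qubits n →ₗᵢ[ℂ] Qubits (n * 4)),
      IsPlusHamiltonian {interaction a} (n * 4) (sizeBound N b n Q) Hsim ∧
      |c| ≤ (sizeBound N b n Q : ℕ) ∧ IsLocalEncoding E ∧
      Simulates (op (Hsim + (c : ℂ) • 1)) E
        (op (∑ p ∈ pairs n,
          ((α p : ℂ) • onPair XX p.1 p.2 + (β p : ℂ) • onPair (-YY - ZZ) p.1 p.2)))
        (1 / ((Q : ℝ) + 1)) (1 / ((Q : ℝ) + 1)) := by
  have hg := G.g_pos
  have h0 := G.x₀_pos
  have h1 := G.x₁_pos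
  obtain ⟨M, hM⟩ : ∃ M, M = weightBound N b := ⟨_, rfl⟩
  obtain ⟨L, hL⟩ : ∃ L, L = normBound N b n := ⟨_, rfl⟩
  obtain ⟨D, hD⟩ : ∃ D, D = scale N b n Q := ⟨_, rfl⟩
  have hM1 : 1 ≤ M := by
    rw [hM, weightBound]
    exact Nat.mul_pos (Nat.mul_pos hN1 (by omega)) (by omega)
  have hL1 : 1 ≤ L := by
    rw [hL, normBound]
    exact Nat.mul_pos hN1 (by omega)
  have hD1 : 1 ≤ D := by
    rw [hD, scale, ← hL]
    exact Nat.mul_pos (Nat.mul_pos (by norm_num) (pow_pos hL1 6)) (by omega)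
  have hres := G.abs_residual_le hN hα hαb hβ hβb
  have hhop0 : ∀ p, 0 ≤ G.hop β p := fun p => Real.sqrt_nonneg _
  have hhop : ∀ p q q', G.hop β p * (G.strength q * G.strength q') ≤ M := by
    rw [hM]; exact G.hop_mul_le hN hβ hβb
  have hpert := G.pert_isPlusHamiltonian hM1 hhop0 hhop
  have hcorr := corr_isPlusHamiltonian (n := n) a hM1
    (wl := G.leafWeight α β) (wc := G.centerWeight α β)
    (fun p => hM ▸ max_mul_bounds (hres p) (by positivity) hN.leaf_leaf)
    (fun p => hM ▸ max_mul_bounds ((abs_neg _).trans_le (hres p)) (by positivity) hN.leaf_center)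
  have hshift := G.abs_energyShift_le hN hβ hβb
  have hgL : (((16 * n ^ 2 * M : ℕ) : ℝ) ^ 2 * N + ((2 * n ^ 2 * M : ℕ) : ℝ) ^ 2 * N
      + n ^ 2 * b * N + 1) ≤ G.g * L := by
    rw [hL, normBound, ← hM]
    push_cast
    rw [← mul_assoc]
    exact le_mul_of_one_le_left (by positivity) hN.gap
  have hpn : (0 : ℝ) ≤ ((16 * n ^ 2 * M : ℕ) : ℝ) ^ 2 * N := by positivity
  have hcn : (0 : ℝ) ≤ ((2 * n ^ 2 * M : ℕ) : ℝ) ^ 2 * N := by positivity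
  have hsn : (0 : ℝ) ≤ (n : ℝ) ^ 2 * b * N := by positivity
  have hX : ‖op (phys n (G.pert (pairs n) (G.hop β)))‖ ≤ G.g * L := by
    refine (hpert.norm_op_le ha).trans
      ((mul_le_mul_of_nonneg_left hN.norm (sq_nonneg _)).trans ?_)
    linarith
  have hY : ‖op (phys n (corr a (G.leafWeight α β) (G.centerWeight α β) +
      (G.energyShift β : ℂ) • 1))‖ ≤ G.g * L := by
    rw [map_add, map_smul, map_one, op_add, op_smul]
    refine (norm_add_le _ _).trans ?_
    rw [norm_smul, Complex.norm_real, Real.norm_eq_abs]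
    have e1 := (hcorr.norm_op_le ha).trans (mul_le_mul_of_nonneg_left hN.norm (sq_nonneg _))
    have e2 := mul_le_of_le_one_right (abs_nonneg (G.energyShift β)) (norm_op_one_le (n := n * 4))
    linarith
  have hherm : (corr a (G.leafWeight α β) (G.centerWeight α β) +
      (G.energyShift β : ℂ) • 1).IsHermitian := by
    refine (corr_isHermitian a _ _).add ?_
    rw [Matrix.IsHermitian, Matrix.conjTranspose_smul, Matrix.conjTranspose_one]
    simp
  have hL1' : (1 : ℝ) ≤ L := by exact_mod_cast hL1
  have hD' : (D : ℝ) = 400 * (L : ℝ) ^ 6 * (Q + 1) := by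
    rw [hD, scale, ← hL]; push_cast; ring
  have hLpos : (0 : ℝ) < 400 * (L : ℝ) ^ 6 := by positivity
  have hDle : 400 * (L : ℝ) ^ 6 ≤ D := by
    rw [hD']
    exact le_mul_of_one_le_right hLpos.le (by linarith [(Nat.cast_nonneg Q : (0 : ℝ) ≤ Q)])
  obtain ⟨E, hE, hsim⟩ := G.simulates (G.hop β) hherm hL1' (by linarith) hX hY hDle
  -- `scale` carries the factor Q + 1 precisely for this equality.
  have herr : 400 * (L : ℝ) ^ 6 / D = 1 / ((Q : ℝ) + 1) := by
    rw [hD', div_mul_eq_div_div, div_self hLpos.ne']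
  rw [herr, G.effective_eq ha hβ] at hsim
  -- The shift c raises the ground energy of the n stars, scaled by D², to zero and adds the
  -- second-order energy.
  refine ⟨(∑ i : Fin n, ∑ k : Fin 3, (((D : ℝ) ^ 2 : ℝ) : ℂ) • onPair (interaction a)
      (finProdFinEquiv (i, (0 : Fin 4))) (finProdFinEquiv (i, k.succ))) +
      phys n (G.pert (pairs n) fun p => D * G.hop β p) +
      phys n (corr a (G.leafWeight α β) (G.centerWeight α β)),
    (D : ℝ) ^ 2 * (n * (a + 2 * G.s)) + G.energyShift β, E, ?_, ?_, G.isLocalEncoding hE, ?_⟩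
  · have hs := stars_isPlusHamiltonian (n := n) a (w := (D : ℝ) ^ 2) (by positivity) (B := D ^ 2)
      (Nat.one_le_pow _ _ hD1) (by push_cast; exact le_rfl)
    have hp := G.pert_isPlusHamiltonian (f := fun p => D * G.hop β p) (B := D * M)
      (Nat.mul_pos hD1 hM1) (fun p => mul_nonneg (Nat.cast_nonneg _) (hhop0 p)) fun p q q' => by
        push_cast
        rw [mul_assoc]
        exact mul_le_mul_of_nonneg_left (hhop p q q') (Nat.cast_nonneg _)
    refine ((hs.add hp).add hcorr).mono ?_
    rw [sizeBound, ← hM, ← hD]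
    omega
  · have hs := G.s_pos
    refine (abs_add_le _ _).trans ?_
    rw [abs_of_nonneg (by positivity)]
    have e1 : (D : ℝ) ^ 2 * (n * (a + 2 * G.s)) ≤ (D : ℝ) ^ 2 * (n * N) := by
      have := hN.shift
      gcongr
    refine (add_le_add e1 hshift).trans ?_
    have e2 : D ^ 2 * (n * N) + n ^ 2 * b * N ≤ sizeBound N b n Q := by
      rw [sizeBound, ← hD]
      exact Nat.le_add_left _ _
    exact_mod_cast e2
  · convert hsim using 2
    rw [G.phys_unpert, map_add, map_smul, map_one, ← G.smul_pert, map_smul]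
    have hst : (∑ i : Fin n, ∑ k : Fin 3, (((D : ℝ) ^ 2 : ℝ) : ℂ) • onPair (interaction a)
        (finProdFinEquiv (i, (0 : Fin 4))) (finProdFinEquiv (i, k.succ))) =
        ((D : ℝ) : ℂ) ^ 2 • ∑ i : Fin n, ∑ k : Fin 3, ((1 : ℝ) : ℂ) • onPair (interaction a)
          (finProdFinEquiv (i, (0 : Fin 4))) (finProdFinEquiv (i, k.succ)) := by
      simp only [Finset.smul_sum, smul_smul, Complex.ofReal_one, mul_one, Complex.ofReal_pow]
    rw [hst, smul_add, smul_smul, Complex.ofReal_add, add_smul, Complex.ofReal_mul,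
      Complex.ofReal_pow]
    abel

end StarGadget

end QSim

end

theorem mainTheorem8 (a : ℝ) (ha : 1 < a) :
    QSim.SimulatesToInversePolyError
      {(a : ℂ) • QSim.XX - QSim.YY - QSim.ZZ}
      {QSim.XX, -QSim.YY - QSim.ZZ} := by
  obtain ⟨G⟩ := QSim.exists_starGadget ha
  have ha0 : 0 < a := one_pos.trans ha
  -- N depends on the gadget for a alone, not on n, so `sizeBound` is polynomial in n for fixed p
  -- and q.
  obtain ⟨N, hN1, hN⟩ := G.exists_bound ha0
  intro p q
  obtain ⟨r, hr⟩ := QSim.exists_polynomial_sizeBound N p q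
  refine ⟨r, fun n H hH => ?_⟩
  obtain ⟨α, β, hα, hαb, hβ, hβb, rfl⟩ := hH.exists_pair_form
  have hcast : ((p.eval n : ℕ) : ℝ) ^ 2 = ((p.eval n ^ 2 : ℕ) : ℝ) := by push_cast; rfl
  simp only [hcast] at hαb hβb
  obtain ⟨Hsim, c, E, h1, h2, h3, h4⟩ :=
    G.exists_simulation ha0 hN1 hN (q.eval n) hα hαb hβ hβb
  rw [← hr] at h1 h2
  refine ⟨n * 4, Hsim, c, E, ?_, h1, h2, h3, h4⟩
  rw [hr, QSim.sizeBound, add_assoc]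
  exact Nat.le_add_right _ _
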